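/- **Notation.** For $z>0$ and real $\gamma$, $\int_{\operatorname{Re}s=\gamma}$ denotes the integral along the vertical line $\gamma+i\mathbb R$, upwards; $1/\Gamma$ is read as $0$ at the poles of $\Gamma$. For $0<\alpha<1$ the one-sided Lévy stable density of index $\alpha$ is the Mellin–Barnes integral $$f_\alpha(x)=\frac1{2\pi i}\int_{\operatorname{Re}s=c}\frac{\Gamma\left(\frac1\alpha-\frac s\alpha\right)}{\alpha\,\Gamma(1-s)}\,x^{-s}\,ds\qquad(x>0,\ 0<c<\alpha).$$ For positive $A_i,B_j$ the Fox $H$-function with $n=0$ and $m=q$ is $$H^{q,0}_{p,q}\left[z\,\Big|\,{(a_1,A_1),\dots,(a_p,A_p)\atop(b_1,B_1),\dots,(b_q,B_q)}\right]=\frac1{2\pi i}\int_{\operatorname{Re}s=d}\frac{\prod_{j=1}^{q}\Gamma(b_j+B_js)}{\prod_{i=1}^{p}\Gamma(a_i+A_is)}\,z^{-s}\,ds,$$ where all poles of the numerator lie to the left of the line, i.e. $\operatorname{Re}b_j+B_jd>0$ for all $j$. The generalized Wright function and the generalized hypergeometric series are $${}_p\Psi_q\left[z\,\Big|\,{(a_1,A_1),\dots,(a_p,A_p)\atop(b_1,B_1),\dots,(b_q,B_q)}\right]=\sum_{n\ge0}\frac{\prod_{i=1}^p\Gamma(a_i+A_in)}{\prod_{j=1}^q\Gamma(b_j+B_jn)}\frac{z^n}{n!},\qquad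 {}_pF_q(a_1,\dots,a_p;b_1,\dots,b_q;z)=\sum_{n\ge0}\frac{\prod_{i=1}^p(a_i)_n}{\prod_{j=1}^q(b_j)_n}\frac{z^n}{n!},$$ with $(a)_n=a(a+1)\cdots(a+n-1)$. The Lévy jump function is $\left[\frac jq\right]_n=\frac jq$ if $j<n$ and $\left[\frac jq\right]_n=\frac{j+1}q$ if $j\ge n$. Empty parameter lists and empty products are allowed. **Theorem.** Let $p,q,l_1,l_2$ be positive integers with $p<q$, and put $\alpha=\left(\frac pq\right)^{l_2/l_1}\in(0,1)$ and $l=\left(\frac pq\right)^{l_2/l_1-1}$. For every $c\in(0,\alpha)$ the integral defining $f_\alpha$ converges absolutely, and $\int_0^\infty e^{-tx}f_\alpha(x)\,dx=e^{-t^\alpha}$ (absolutely convergent) for every $t>0$. Moreover, for every $x>0$, with every admissible choice of the lines of integration $c$ and $d$, all integrals and series below being absolutely convergent: 1. If $l$ is not a positive integer (and $l_1\ne l_2$), then with $z=\dfrac{p^{pl}}{x^{pl}q^q}$ and $K=\dfrac{l\sqrt{pq}}{x(2\pi)^{(q-p)/2}}$, $$f_\alpha(x)=K\,H^{q,0}_{p,q}\left[z\,\Big|\,{(1,l),(\frac1p,l),\dots,(\frac{p-1}p,l)\atop(1,1),(\frac1q,1),\dots,(\frac{q-1}q,1)}\right]$$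 and $$f_\alpha(x)=K\,z\;{}_{q-1}\Psi_p\left[-z\,\Big|\,{(-\frac{q-1}q,-1),\dots,(-\frac1q,-1)\atop(1-l,-l),(\frac{q-plq}{pq},-l),\dots,(\frac{(p-1)q-plq}{pq},-l)}\right]$$ $$\qquad+K\sum_{j=1}^{q-1}\frac{p^{jlp/q}}{x^{jlp/q}q^j}\;{}_{q-1}\Psi_p\left[-z\,\Big|\,{(1-[\frac jq]_q,-1),(\frac2q-[\frac jq]_2,-1),\dots,(\frac{q-1}q-[\frac jq]_{q-1},-1)\atop(\frac{pq-jpl}{pq},-l),(\frac{q-jpl}{pq},-l),\dots,(\frac{(p-1)q-jpl}{pq},-l)}\right].$$ 2. If $l=1$ (and $l_1=l_2$), then with $z=\dfrac{p^{p}}{x^{p}q^q}$ and $K=\dfrac{\sqrt{pq}}{x(2\pi)^{(q-p)/2}}$, $$f_\alpha(x)=K\,H^{q-1,0}_{p-1,q-1}\left[z\,\Big|\,{(\frac1p,1),\dots,(\frac{p-1}p,1)\atop(\frac1q,1),\dots,(\frac{q-1}q,1)}\right]$$ and $$f_\alpha(x)=K\sum_{j=1}^{q-1}\frac{p^{jp/q}}{x^{jp/q}q^j}\,\frac{\prod_{i=2}^{q-1}\Gamma\left(\frac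 iq-[\frac jq]_i\right)}{\prod_{i=1}^{p-1}\Gamma\left(\frac{iq-jp}{pq}\right)}\;{}_{p-1}F_{q-2}\left(\left(1-\tfrac{iq-jp}{pq}\right)_{1\le i\le p-1};\left(1-\tfrac iq+[\tfrac jq]_i\right)_{2\le i\le q-1};(-1)^{q-p}z\right).$$ 3. If $l\in\{2,3,4,\dots\}$ (and $l_1\ne l_2$), then with $w=\dfrac{p^{pl}l^l}{x^{pl}q^q}$ and $K=\dfrac{\sqrt{pql}}{x(2\pi)^{(q+1-p-l)/2}}$, $$f_\alpha(x)=K\,H^{q-1,0}_{p+l-2,q-1}\left[w\,\Big|\,{(\frac1l,1),\dots,(\frac{l-1}l,1),(\frac1p,l),\dots,(\frac{p-1}p,l)\atop(\frac1q,1),\dots,(\frac{q-1}q,1)}\right]$$ and $$f_\alpha(x)=K\sum_{j=1}^{q-1}\frac{p^{jlp/q}\,l^{jl/q}}{x^{jlp/q}q^j}\;{}_{q-2}\Psi_{p+l-2}\left[-w\,\Big|\,{(\frac2q-[\frac jq]_2,-1),\dots,(\frac{q-1}q-[\frac jq]_{q-1},-1)\atop(\frac{q-jl}{lq},-1),\dots,(\frac{(l-1)q-jl}{lq},-1),(\frac{q-jpl}{pq},-l),\dots,(\frac{(p-1)q-jpl}{pq},-l)}\right].$$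 -/

import Mathlib

open MeasureTheory

noncomputable section

/-- The Mellin--Barnes kernel `Γ(1/α - s/α) / (α Γ(1 - s))` of the one-sided Lévy stable law. -/
def levyKernel (α : ℝ) (s : ℂ) : ℂ :=
  Complex.Gamma (1 / (α : ℂ) - s / (α : ℂ)) / ((α : ℂ) * Complex.Gamma (1 - s))

/-- The one-sided Lévy stable density of index `α` as the Mellin--Barnes integral
`(1 / 2πi) ∫ levyKernel α s * x ^ (-s) ds` along the vertical line `Re s = c`
(`mellinInv` is exactly this contour integral); the contour is admissible when `0 < c < α`. -/
def levyDensity (α c x : ℝ) : ℂ :=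
  mellinInv c (levyKernel α) x

/-- The Mellin--Barnes kernel of the Fox function `H^{m,n}_{p,q}`. The list `a` holds the `p` upper
pairs `(a_i, A_i)`, the list `b` the `q` lower pairs `(b_j, B_j)`. (`Complex.Gamma` is `0` at its
poles, so that dividing by it is multiplying by the entire function `1/Γ`.) -/
def foxHKernel (m n : ℕ) (a b : List (ℂ × ℝ)) (s : ℂ) : ℂ :=
  (((b.take m).map fun u => Complex.Gamma (u.1 + u.2 * s)).prod *
      ((a.take n).map fun u => Complex.Gamma (1 - u.1 - u.2 * s)).prod) /
    (((b.drop m).map fun u => Complex.Gamma (1 - u.1 - u.2 * s)).prod *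
      ((a.drop n).map fun u => Complex.Gamma (u.1 + u.2 * s)).prod)

/-- The line `Re s = d` separates the poles of the factors `Γ(b_j + B_j s)`, `j ≤ m`, (on its left)
from those of the factors `Γ(1 - a_i - A_i s)`, `i ≤ n`, (on its right); here `A_i, B_j > 0`. -/
def IsFoxHContour (m n : ℕ) (a b : List (ℂ × ℝ)) (d : ℝ) : Prop :=
  (∀ u ∈ b.take m, 0 < u.1.re + u.2 * d) ∧ (∀ u ∈ a.take n, 0 < 1 - u.1.re - u.2 * d)

/-- The Fox function `H^{m,n}_{p,q}[z | a; b]`, `p = a.length`, `q = b.length`, at `z > 0`: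
`(1 / 2πi) ∫ foxHKernel m n a b s * z ^ (-s) ds` along the line `Re s = d`, to be used with
`IsFoxHContour m n a b d`. -/
def foxH (m n : ℕ) (a b : List (ℂ × ℝ)) (d z : ℝ) : ℂ :=
  mellinInv d (foxHKernel m n a b) z

/-- The `n`-th term of the generalized Wright function `ₚΨ_q[z | a; b]`. -/
def wrightTerm (a b : List (ℂ × ℝ)) (z : ℂ) (n : ℕ) : ℂ :=
  (a.map fun u => Complex.Gamma (u.1 + u.2 * n)).prod /
    ((b.map fun u => Complex.Gamma (u.1 + u.2 * n)).prod * (n.factorial : ℂ)) * z ^ n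

/-- The generalized Wright function `ₚΨ_q[z | a; b]`, `p = a.length`, `q = b.length`. -/
def wrightPsi (a b : List (ℂ × ℝ)) (z : ℂ) : ℂ :=
  ∑' n : ℕ, wrightTerm a b z n

/-- The `n`-th term of the generalized hypergeometric series `ₚF_q(a; b; z)`. -/
def hypergeomTerm (a b : List ℂ) (z : ℂ) (n : ℕ) : ℂ :=
  (a.map fun u => (ascPochhammer ℂ n).eval u).prod /
    ((b.map fun u => (ascPochhammer ℂ n).eval u).prod * (n.factorial : ℂ)) * z ^ n

/-- The generalized hypergeometric series `ₚF_q(a; b; z)`, `p = a.length`, `q = b.length`. -/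
def hypergeomF (a b : List ℂ) (z : ℂ) : ℂ :=
  ∑' n : ℕ, hypergeomTerm a b z n

/-- The Lévy jump function `[j/q]_n`. -/
def levyJump (j q n : ℕ) : ℝ :=
  if j < n then (j : ℝ) / q else ((j : ℝ) + 1) / q

/-- The parameter row `g i₀, g (i₀ + 1), …, g i₁` (empty when `i₁ < i₀`). -/
def row (i₀ i₁ : ℕ) (g : ℕ → ℝ) : List ℂ :=
  (List.range' i₀ (i₁ + 1 - i₀)).map fun i => (g i : ℂ)

/-- The parameter row `(g i₀, A), (g (i₀ + 1), A), …, (g i₁, A)` (empty when `i₁ < i₀`). -/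
def pairRow (i₀ i₁ : ℕ) (g : ℕ → ℝ) (A : ℝ) : List (ℂ × ℝ) :=
  (List.range' i₀ (i₁ + 1 - i₀)).map fun i => ((g i : ℂ), A)

end

/-! Everything reduces to one meromorphic function, Γ(1+u)/Γ(1+αu) (`gammaRatio`). With s = 1 - αu
the kernel Γ(u)/(αΓ(αu)) becomes this quotient and x^(-s) becomes y^(-u)/x with y = x^(-α). Its
first possible pole is u = -1, so every line to the right of -1 is admissible.

Since α < 1, the decay of Γ(1+u) in the imaginary direction, at any rate below π/2, beats the growth
of 1/Γ(1+αu), at any rate above απ/2. This gives absolute convergence and the right to move lines.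
The Laplace transform follows from Fubini: the x-integral produces Γ(1-s), which cancels the
denominator of the kernel and leaves the Cahen-Mellin integral of exp(-t^α).

The Fox H-formulas come from u = qs. As αq = pl, Gauss's multiplication formula
(`Gamma_one_add_nat_mul`) splits Γ(1+qs) into q factors Γ(s+j/q) and Γ(1+p·ls) into p factors
Γ(ls+i/p); its constants and powers produce K and z (`prod_Gamma_div_prod_Gamma_eq`,
`levyDensity_eq_mellinInv_of_kernel`). If l = 1, the factor Γ(1+s) cancels. If l = k is an integer,
Γ(1+ks) is split once more and then Γ(1+s) cancels.

The series come from moving the line to -∞ (`hasSum_mellinInv_gammaRatio`). On Re u = -(N+1/2) the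
quotient is of size (N+1)!^α/N! up to geometric factors, so only residues remain, with coefficients
(-1)^m/(m! Γ(1-α(m+1))). Writing m+1 = qn+j with 1 ≤ j ≤ q, Gauss's formula rewrites the reciprocal
Gamma value, and its residue form `neg_one_pow_div_factorial_eq` rewrites 1/m!. This gives the
common expansion `levyDensity_eq_sum_levyTerm`. The class j = q vanishes for integral l, and the
Lévy jump function merely lists the indices different from j. -/

/-! ### Decay of Γ and growth of 1/Γ in the imaginary direction -/

open Filter Complex in
theorem hasDerivAt_integral_cpow_mul_cexp {a r : ℂ} (ha : 0 < a.re) (hr : 0 < r.re) :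
    HasDerivAt (fun r : ℂ => ∫ t : ℝ in Set.Ioi 0, (t : ℂ) ^ (a - 1) * cexp (-(r * t)))
      (∫ t : ℝ in Set.Ioi 0, (t : ℂ) ^ (a - 1) * (cexp (-(r * t)) * (-t))) r := by
  have hcont : ∀ r : ℂ, ContinuousOn (fun t : ℝ => (t : ℂ) ^ (a - 1) * cexp (-(r * t)))
      (Set.Ioi 0) := fun r => by
    refine ContinuousOn.mul (fun t ht => ?_) (by fun_prop)
    exact (continuousAt_ofReal_cpow_const _ _ (Or.inr (ne_of_gt ht))).continuousWithinAt
  have hnorm : ∀ (r : ℂ) (t : ℝ), t ∈ Set.Ioi (0 : ℝ) →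
      ‖(t : ℂ) ^ (a - 1) * cexp (-(r * t))‖ = t ^ (a.re - 1) * Real.exp (-(r.re * t)) := by
    intro r t ht
    rw [norm_mul, Complex.norm_cpow_eq_rpow_re_of_pos ht, Complex.norm_exp]
    simp
  have hint : ∀ {b c : ℝ}, 0 < b → 0 < c →
      IntegrableOn (fun t : ℝ => t ^ (b - 1) * Real.exp (-(c * t))) (Set.Ioi 0) := by
    intro b c hb hc
    have := integrableOn_rpow_mul_exp_neg_mul_rpow (s := b - 1) (p := 1) (b := c)
      (by linarith) one_pos hc
    simpa using this
  refine (hasDerivAt_integral_of_dominated_loc_of_deriv_le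
    (bound := fun t : ℝ => t ^ ((a.re + 1) - 1) * Real.exp (-((r.re / 2) * t)))
    (F := fun (r : ℂ) (t : ℝ) => (t : ℂ) ^ (a - 1) * cexp (-(r * t)))
    (F' := fun (r : ℂ) (t : ℝ) => (t : ℂ) ^ (a - 1) * (cexp (-(r * t)) * (-t)))
    (Metric.ball_mem_nhds r (half_pos hr)) ?_ ?_ ?_ ?_ ?_ ?_).2
  · exact Eventually.of_forall fun x =>
      (hcont x).aestronglyMeasurable measurableSet_Ioi
  · refine (hint ha hr).mono' ((hcont r).aestronglyMeasurable measurableSet_Ioi) ?_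
    filter_upwards [ae_restrict_mem measurableSet_Ioi] with t ht
    rw [hnorm r t ht]
  · have : ContinuousOn (fun t : ℝ => ((t : ℂ) ^ (a - 1) * cexp (-(r * t))) * (-t))
      (Set.Ioi 0) := (hcont r).mul (by fun_prop)
    simpa only [mul_assoc] using this.aestronglyMeasurable measurableSet_Ioi
  · filter_upwards [ae_restrict_mem measurableSet_Ioi] with t ht x hx
    have ht' : (0 : ℝ) < t := ht
    rw [← mul_assoc, norm_mul, hnorm x t ht, norm_neg, Complex.norm_real, Real.norm_of_nonneg ht'.le]
    have hx' : r.re / 2 ≤ x.re := by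
      have h1 := (Complex.abs_re_le_norm (x - r)).trans (mem_ball_iff_norm.1 hx).le
      rw [Complex.sub_re] at h1
      linarith [neg_le_of_abs_le h1]
    have : t ^ (a.re + 1 - 1) = t ^ (a.re - 1) * t := by
      rw [← Real.rpow_add_one ht'.ne']; ring_nf
    rw [this, mul_right_comm]
    gcongr
  · exact hint (by linarith) (half_pos hr)
  · filter_upwards with t x _
    refine HasDerivAt.const_mul _ ?_
    have : HasDerivAt (fun x : ℂ => -(x * t)) (-t : ℂ) x := by
      simpa using! ((hasDerivAt_id x).mul_const (t : ℂ)).neg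
    exact this.cexp

open Filter Topology Complex in
/-- The Gamma integral along a rotated ray. -/
theorem integral_cpow_mul_cexp_neg_mul_Ioi_of_re_pos {a r : ℂ} (ha : 0 < a.re) (hr : 0 < r.re) :
    ∫ t : ℝ in Set.Ioi 0, (t : ℂ) ^ (a - 1) * cexp (-(r * t)) = (1 / r) ^ a * Gamma a := by
  set U : Set ℂ := {z | 0 < z.re}
  have hU : IsOpen U := isOpen_lt continuous_const Complex.continuous_re
  have h1 : AnalyticOnNhd ℂ
      (fun r : ℂ => ∫ t : ℝ in Set.Ioi 0, (t : ℂ) ^ (a - 1) * cexp (-(r * t))) U :=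
    DifferentiableOn.analyticOnNhd (fun z hz =>
      (hasDerivAt_integral_cpow_mul_cexp ha hz).differentiableAt.differentiableWithinAt) hU
  have h2 : AnalyticOnNhd ℂ (fun r : ℂ => (1 / r) ^ a * Gamma a) U := by
    refine DifferentiableOn.analyticOnNhd (fun z hz => ?_) hU
    have hz0 : z ≠ 0 := by rintro rfl; simp [U] at hz
    have hs : (1 / z) ∈ slitPlane := by
      refine Or.inl ?_
      rw [one_div, Complex.inv_re]
      exact div_pos hz (Complex.normSq_pos.2 hz0)
    exact (((differentiableAt_const _).div differentiableAt_id hz0).cpow_const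
      hs).mul_const _ |>.differentiableWithinAt
  refine h1.eqOn_of_preconnected_of_frequently_eq h2 (convex_halfSpace_re_gt 0).isPreconnected
    (z₀ := 1) (by simp [U]) ?_ hr
  -- The formula is known for real r > 0. The reals 1 + 1/(n+1) accumulate at 1 without reaching it,
  -- which is enough for the identity theorem on the half-plane.
  have hseq : Tendsto (fun n : ℕ => (((1 : ℝ) + 1 / ((n : ℝ) + 1) : ℝ) : ℂ)) atTop (𝓝[≠] 1) := by
    refine tendsto_nhdsWithin_iff.2 ⟨?_, Eventually.of_forall fun n => ?_⟩
    · have := (tendsto_one_div_add_atTop_nhds_zero_nat (𝕜 := ℝ)).const_add 1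
      rw [add_zero] at this
      exact_mod_cast (Complex.continuous_ofReal.tendsto _).comp this
    · have : (0 : ℝ) < 1 / ((n : ℝ) + 1) := by positivity
      simp only [Set.mem_compl_iff, Set.mem_singleton_iff]
      intro h
      rw [← Complex.ofReal_one, Complex.ofReal_inj] at h
      linarith
  refine hseq.frequently (Frequently.of_forall fun n => ?_)
  exact integral_cpow_mul_exp_neg_mul_Ioi ha (by positivity)

open Complex in
/-- Exponential decay of `Γ` in the imaginary direction, at any rate below `π / 2`. -/
theorem norm_Gamma_le_exp {θ : ℝ} (h0 : 0 ≤ θ) (h1 : θ < Real.pi / 2) {s : ℂ} (hs : 0 < s.re) :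
    ‖Gamma s‖ ≤ Real.Gamma s.re * (1 / Real.cos θ) ^ s.re * Real.exp (-(θ * |s.im|)) := by
  have key : ∀ φ : ℝ, |φ| < Real.pi / 2 →
      ‖Gamma s‖ * Real.exp (φ * s.im) ≤ Real.Gamma s.re * (1 / Real.cos φ) ^ s.re := by
    intro φ hφ
    have hc : 0 < Real.cos φ := Real.cos_pos_of_mem_Ioo (by rw [abs_lt] at hφ; exact hφ)
    -- On this ray |r^(-s)| = exp(φ Im s), while |exp(-rt)| = exp(-t cos φ). Giving φ the sign of Im
    -- s turns the estimate into decay.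
    set r : ℂ := cexp (φ * I) with hrdef
    have hre : r.re = Real.cos φ := by rw [hrdef, Complex.exp_ofReal_mul_I_re]
    have hI := integral_cpow_mul_cexp_neg_mul_Ioi_of_re_pos hs (r := r) (by rw [hre]; exact hc)
    have hpow : ‖(1 / r) ^ s‖ = Real.exp (φ * s.im) := by
      have hlog : Complex.log (1 / r) = -(φ * I) := by
        rw [one_div, hrdef, ← Complex.exp_neg, Complex.log_exp]
        · simp; rw [abs_lt] at hφ; linarith [Real.pi_pos]
        · simp; rw [abs_lt] at hφ; linarith [Real.pi_pos]
      rw [Complex.cpow_def_of_ne_zero (by simp [hrdef]), hlog, Complex.norm_exp]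
      simp
    have hle : ‖∫ t : ℝ in Set.Ioi 0, (t : ℂ) ^ (s - 1) * cexp (-(r * t))‖ ≤
        ∫ t : ℝ in Set.Ioi 0, t ^ (s.re - 1) * Real.exp (-(Real.cos φ * t)) := by
      refine (norm_integral_le_integral_norm _).trans_eq ?_
      refine setIntegral_congr_fun measurableSet_Ioi fun t ht => ?_
      rw [norm_mul, Complex.norm_cpow_eq_rpow_re_of_pos ht, Complex.norm_exp]
      simp [hre]
    rw [hI, norm_mul, hpow, Real.integral_rpow_mul_exp_neg_mul_Ioi hs hc] at hle
    linarith
  rw [Real.exp_neg, ← div_eq_mul_inv, le_div_iff₀ (Real.exp_pos _)]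
  rcases le_total 0 s.im with h | h
  · rw [abs_of_nonneg h]
    exact key θ (by rwa [abs_of_nonneg h0])
  · have := key (-θ) (by rwa [abs_neg, abs_of_nonneg h0])
    rw [Real.cos_neg] at this
    rwa [abs_of_nonpos h, mul_neg, ← neg_mul]

/-- Each step of Γ(s+1) = sΓ(s) multiplies by a number of modulus at least |Im s| ≥ 1. Bounds valid
for positive real part thereby extend to the left. -/
theorem norm_Gamma_le_norm_Gamma_add_nat {s : ℂ} (hs : 1 ≤ |s.im|) (n : ℕ) :
    ‖Complex.Gamma s‖ ≤ ‖Complex.Gamma (s + n)‖ := by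
  induction n with
  | zero => simp
  | succ n ih =>
    have him : (s + n).im = s.im := by simp
    have h1 : 1 ≤ ‖s + n‖ := by
      have := Complex.abs_im_le_norm (s + n)
      rw [him] at this
      exact hs.trans this
    have h0 : s + n ≠ 0 := by
      intro h; rw [h] at h1; norm_num at h1
    push_cast
    rw [← add_assoc, Complex.Gamma_add_one _ h0, norm_mul]
    exact ih.trans (le_mul_of_one_le_left (norm_nonneg _) h1)

/-- A shift by N brings the strip into real parts in [1, M+N], a compact set on which the factor
depending on Re s is bounded. -/
theorem exists_norm_Gamma_le_exp {θ : ℝ} (h0 : 0 ≤ θ) (h1 : θ < Real.pi / 2) (M : ℝ) :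
    ∃ C : ℝ, 0 < C ∧ ∀ s : ℂ, |s.re| ≤ M → 1 ≤ |s.im| →
      ‖Complex.Gamma s‖ ≤ C * Real.exp (-(θ * |s.im|)) := by
  obtain ⟨N, hN⟩ := exists_nat_ge (M + 1)
  have hc : 0 < Real.cos θ := Real.cos_pos_of_mem_Ioo ⟨by linarith [Real.pi_pos], h1⟩
  have hcont : ContinuousOn (fun σ : ℝ => Real.Gamma σ * (1 / Real.cos θ) ^ σ)
      (Set.Icc 1 (M + N)) := by
    refine ContinuousOn.mul (fun σ hσ => ?_) ?_
    · exact (Real.differentiableAt_Gamma fun m => by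
        have : (0 : ℝ) ≤ m := Nat.cast_nonneg m
        linarith [hσ.1]).continuousAt.continuousWithinAt
    · exact (Real.continuous_const_rpow (by positivity)).continuousOn
  obtain ⟨C, hC⟩ := isCompact_Icc.exists_bound_of_continuousOn hcont
  refine ⟨max C 1, by positivity, fun s hs ht => ?_⟩
  rw [abs_le] at hs
  have hre : (s + N).re = s.re + N := by simp
  have him : (s + N).im = s.im := by simp
  refine (norm_Gamma_le_norm_Gamma_add_nat ht N).trans ?_
  refine (norm_Gamma_le_exp h0 h1 (by rw [hre]; linarith)).trans ?_
  rw [him, hre]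
  gcongr
  exact (le_abs_self _).trans ((hC _ ⟨by linarith, by linarith⟩).trans (le_max_left _ _))

theorem norm_sin_le_exp (z : ℂ) : ‖Complex.sin z‖ ≤ Real.exp |z.im| := by
  have h : Complex.sin z = (Complex.exp (-z * Complex.I) - Complex.exp (z * Complex.I)) *
    Complex.I / 2 := rfl
  rw [h, norm_div, norm_mul, Complex.norm_I, mul_one, Complex.norm_ofNat, div_le_iff₀ two_pos]
  refine (norm_sub_le _ _).trans ?_
  rw [Complex.norm_exp, Complex.norm_exp]
  have h1 : Real.exp (-z * Complex.I).re ≤ Real.exp |z.im| := by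
    simpa using le_abs_self z.im
  have h2 : Real.exp (z * Complex.I).re ≤ Real.exp |z.im| := by
    simpa using neg_le_abs z.im
  linarith

/-- The reflection formula 1/Γ(s) = sin(πs)Γ(1-s)/π. The hypothesis excludes the poles of Γ(1-s),
where the product sin·Γ would be lost to the value 0 assigned to Γ there. -/
theorem norm_inv_Gamma_le {s : ℂ} (hs : Complex.Gamma (1 - s) ≠ 0) :
    ‖(Complex.Gamma s)⁻¹‖ ≤ Real.exp (Real.pi * |s.im|) * ‖Complex.Gamma (1 - s)‖ := by
  have h := Complex.Gamma_mul_Gamma_one_sub s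
  have hinv : (Complex.Gamma s)⁻¹ =
      Complex.sin (Real.pi * s) * Complex.Gamma (1 - s) / Real.pi := by
    have hπ : (Real.pi : ℂ) ≠ 0 := by exact_mod_cast Real.pi_ne_zero
    by_cases hsin : Complex.sin (Real.pi * s) = 0
    · rw [hsin, div_zero, mul_eq_zero, or_iff_left hs] at h
      simp [h, hsin]
    · have : Complex.Gamma s ≠ 0 := by
        intro h'
        rw [h', zero_mul] at h
        exact div_ne_zero hπ hsin h.symm
      rw [eq_div_iff hsin] at h
      rw [inv_eq_one_div, div_eq_div_iff this hπ]
      linear_combination -h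
  have hsin := norm_sin_le_exp (Real.pi * s)
  rw [Complex.im_ofReal_mul, abs_mul, abs_of_pos Real.pi_pos] at hsin
  rw [hinv, norm_div, norm_mul, Complex.norm_real, Real.norm_of_nonneg Real.pi_pos.le]
  refine (div_le_self (by positivity) (by linarith [Real.pi_gt_three])).trans ?_
  gcongr

/-! ### Factorial growth against geometric growth -/

/-- Growth of the Gamma function along a ray of slope less than one. -/
theorem Gamma_one_add_le_factorial_rpow {α x : ℝ} {n : ℕ} (hα : α < 1) (hx : 0 ≤ x)
    (hxn : x ≤ α * n) : Real.Gamma (1 + x) ≤ (n.factorial : ℝ) ^ α := by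
  rcases hx.eq_or_lt with rfl | hx
  · rcases Nat.eq_zero_or_pos n with rfl | hn
    · simp
    · have hn' : (0 : ℝ) < n := by exact_mod_cast hn
      simp only [add_zero, Real.Gamma_one]
      exact Real.one_le_rpow (by exact_mod_cast Nat.factorial_pos n)
        (by by_contra! h; nlinarith)
  · have hn : (0 : ℝ) < n := by
      rcases (Nat.cast_nonneg n : (0 : ℝ) ≤ n).eq_or_lt with h | h
      · rw [← h] at hxn; linarith
      · exact h
    have hβ : x / n ≤ α := by rwa [div_le_iff₀ hn]
    have hβ0 : 0 < x / n := div_pos hx hn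
    -- Log-convexity between 1 and n+1 with weight x/n ≤ α on the right end: Γ(1+x) ≤ n!^(x/n).
    have h := Real.Gamma_mul_add_mul_le_rpow_Gamma_mul_rpow_Gamma (s := 1) (t := n + 1)
      (a := 1 - x / n) (b := x / n) one_pos (by linarith) (by linarith) hβ0 (by ring)
    have he : (1 - x / n) * 1 + x / n * (n + 1) = 1 + x := by field_simp; ring
    rw [he, Real.Gamma_one, Real.one_rpow, one_mul, Real.Gamma_nat_eq_factorial] at h
    exact h.trans (Real.rpow_le_rpow_of_exponent_le
      (by exact_mod_cast Nat.factorial_pos n) hβ)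

-- The quotient is the γ-th power of (B^(1/γ))^n / n!.
open Filter Topology in
theorem tendsto_pow_div_factorial_rpow {γ : ℝ} (hγ : 0 < γ) {B : ℝ} (hB : 0 ≤ B) :
    Tendsto (fun n : ℕ => B ^ n / (n.factorial : ℝ) ^ γ) atTop (𝓝 0) := by
  have h := (FloorSemiring.tendsto_pow_div_factorial_atTop (B ^ (1 / γ))).rpow_const
    (p := γ) (Or.inr hγ.le)
  rw [Real.zero_rpow hγ.ne'] at h
  refine h.congr fun n => ?_
  rw [Real.div_rpow (by positivity) (by positivity), ← Real.rpow_natCast, ← Real.rpow_mul hB,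
    ← Real.rpow_mul hB, ← Real.rpow_natCast]
  congr 2
  field_simp

theorem summable_mul_pow_div_factorial_rpow {γ : ℝ} (hγ : 0 < γ) {B : ℝ} (hB : 0 ≤ B) :
    Summable (fun n : ℕ => n * (B ^ n / (n.factorial : ℝ) ^ γ)) := by
  -- 4 = 2·2: one factor 2^n absorbs n, the other leaves the geometric ratio 1/2.
  obtain ⟨D, hD⟩ := (tendsto_pow_div_factorial_rpow hγ
    (mul_nonneg (by norm_num : (0 : ℝ) ≤ 4) hB)).bddAbove_range
  refine Summable.of_nonneg_of_le (fun n => by positivity) (fun n => ?_)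
    ((summable_geometric_of_lt_one (r := (1 / 2 : ℝ)) (by norm_num) (by norm_num)).mul_left D)
  have h1 : (4 * B) ^ n / (n.factorial : ℝ) ^ γ ≤ D := hD ⟨n, rfl⟩
  have h2 : (n : ℝ) ≤ 2 ^ n := by exact_mod_cast (Nat.lt_two_pow_self).le
  calc (n : ℝ) * (B ^ n / (n.factorial : ℝ) ^ γ)
      ≤ 2 ^ n * (B ^ n / (n.factorial : ℝ) ^ γ) := by gcongr
    _ = (4 * B) ^ n / (n.factorial : ℝ) ^ γ * (1 / 2) ^ n := by
      rw [mul_pow, show (4 : ℝ) = 2 * 2 by norm_num, mul_pow]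
      field_simp
      rw [mul_comm, ← mul_assoc, ← mul_pow]; norm_num
    _ ≤ D * (1 / 2) ^ n := by gcongr

/-! ### Moving vertical lines of integration -/

open Filter Topology Complex in
/-- Cauchy's theorem for an infinite vertical strip. -/
theorem tendsto_integral_vertical_sub {g : ℂ → ℂ} {a b : ℝ} (hab : a ≤ b)
    (hg : DifferentiableOn ℂ g (Complex.re ⁻¹' Set.Icc a b)) {B : ℝ → ℝ}
    (hB : Tendsto B atTop (𝓝 0))
    (hgB : ∀ᶠ T in atTop, ∀ x ∈ Set.Icc a b, ∀ t : ℝ, |t| = T → ‖g (x + t * I)‖ ≤ B T) :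
    Tendsto (fun T : ℝ => (∫ y in (-T)..T, g (b + y * I)) - ∫ y in (-T)..T, g (a + y * I))
      atTop (𝓝 0) := by
  have hB' : Tendsto (fun T => (B T * |b - a|) + (B T * |b - a|)) atTop (𝓝 0) := by
    simpa using (hB.mul_const |b - a|).add (hB.mul_const |b - a|)
  refine squeeze_zero_norm' ?_ hB'
  filter_upwards [hgB, eventually_ge_atTop 0] with T hT hT0
  have h := integral_boundary_rect_eq_zero_of_differentiableOn g (a + (-T : ℝ) * I) (b + T * I)
    (hg.mono fun z hz => by
      have := hz.1
      simpa [Set.uIcc_of_le hab] using this)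
  simp only [add_re, ofReal_re, mul_re, I_re, mul_zero, ofReal_im, I_im, mul_one, sub_self,
    add_zero, add_im, mul_im, zero_add] at h
  have hbd : ∀ t : ℝ, |t| = T → ‖∫ x : ℝ in a..b, g (x + t * I)‖ ≤ B T * |b - a| := fun t ht =>
    intervalIntegral.norm_integral_le_of_norm_le_const fun x hx => by
      rw [Set.uIoc_of_le hab] at hx
      exact hT x ⟨hx.1.le, hx.2⟩ t ht
  have h1 := hbd (-T) (by rw [abs_neg, abs_of_nonneg hT0])
  have h2 := hbd T (abs_of_nonneg hT0)
  have hI : (∫ y in (-T)..T, g (b + y * I)) - (∫ y in (-T)..T, g (a + y * I)) =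
      I * ((∫ x : ℝ in a..b, g (x + (-T : ℝ) * I)) - ∫ x : ℝ in a..b, g (x + T * I)) := by
    simp only [smul_eq_mul] at h
    linear_combination (-I) * h +
      ((∫ y in (-T)..T, g (b + y * I)) - (∫ y in (-T)..T, g (a + y * I))) * I_mul_I
  rw [hI, norm_mul, norm_I, one_mul]
  exact (norm_sub_le _ _).trans (add_le_add h1 h2)

open Filter Topology Complex in
theorem integral_vertical_eq_of_differentiableOn {g : ℂ → ℂ} {a b : ℝ} (hab : a ≤ b)
    (hg : DifferentiableOn ℂ g (Complex.re ⁻¹' Set.Icc a b)) {B : ℝ → ℝ}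
    (hB : Tendsto B atTop (𝓝 0))
    (hgB : ∀ᶠ T in atTop, ∀ x ∈ Set.Icc a b, ∀ t : ℝ, |t| = T → ‖g (x + t * I)‖ ≤ B T)
    (ha : Complex.VerticalIntegrable g a) (hb : Complex.VerticalIntegrable g b) :
    ∫ y : ℝ, g (b + y * I) = ∫ y : ℝ, g (a + y * I) := by
  have h1 := intervalIntegral_tendsto_integral ha tendsto_neg_atTop_atBot tendsto_id
  have h2 := intervalIntegral_tendsto_integral hb tendsto_neg_atTop_atBot tendsto_id
  exact sub_eq_zero.1 (tendsto_nhds_unique (h2.sub h1) (tendsto_integral_vertical_sub hab hg hB hgB))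

-- The difference equals 4/(1+4y²). Each inverse alone is not absolutely integrable on its line, so
-- the residue contribution 2π is computed from the difference.
open Complex in
theorem integrable_and_integral_inv_half_strip :
    Integrable (fun y : ℝ => ((1 / 2 : ℂ) + y * I)⁻¹ - (-(1 / 2 : ℂ) + y * I)⁻¹) ∧
      ∫ y : ℝ, (((1 / 2 : ℂ) + y * I)⁻¹ - (-(1 / 2 : ℂ) + y * I)⁻¹) = 2 * Real.pi := by
  have h : (fun y : ℝ => ((1 / 2 : ℂ) + y * I)⁻¹ - (-(1 / 2 : ℂ) + y * I)⁻¹) =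
      fun y : ℝ => ((4 * (1 + (2 * y) ^ 2)⁻¹ : ℝ) : ℂ) := by
    ext y
    have h1 : (1 / 2 : ℂ) + y * I ≠ 0 := fun h => by simpa using congrArg re h
    have h2 : -(1 / 2 : ℂ) + y * I ≠ 0 := fun h => by simpa using congrArg re h
    have h3 : (1 + (2 * (y : ℂ)) ^ 2) ≠ 0 := by
      have : (0 : ℝ) < 1 + (2 * y) ^ 2 := by positivity
      exact_mod_cast this.ne'
    push_cast
    rw [inv_sub_inv h1 h2, ← div_eq_mul_inv, div_eq_div_iff (mul_ne_zero h1 h2) h3]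
    ring_nf
    rw [I_sq]
    ring
  rw [h]
  constructor
  · exact ((integrable_inv_one_add_sq.comp_mul_left' (by norm_num : (2 : ℝ) ≠ 0)).const_mul 4).ofReal
  · rw [integral_complex_ofReal, integral_const_mul,
      Measure.integral_comp_mul_left (fun y : ℝ => (1 + y ^ 2)⁻¹), integral_univ_inv_one_add_sq]
    norm_num [abs_of_pos]
    ring

open Filter Topology Complex in
/-- Moving a vertical line of integration across a simple pole at the centre of a unit strip. -/
theorem integral_vertical_eq_add_residue {f h : ℂ → ℂ} {a : ℝ}
    (hh : DifferentiableOn ℂ h (Complex.re ⁻¹' Set.Ioo (a - 1) (a + 1)))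
    (hf : ∀ u : ℂ, u ≠ a → f u = h u / (u - a)) {B : ℝ → ℝ}
    (hB : Tendsto B atTop (𝓝 0))
    (hfB : ∀ᶠ T in atTop, ∀ x ∈ Set.Icc (a - 1 / 2) (a + 1 / 2), ∀ t : ℝ, |t| = T →
      ‖f (x + t * I)‖ ≤ B T)
    (h1 : Complex.VerticalIntegrable f (a - 1 / 2))
    (h2 : Complex.VerticalIntegrable f (a + 1 / 2)) :
    ∫ y : ℝ, f ((a + 1 / 2 : ℝ) + y * I) =
      (∫ y : ℝ, f ((a - 1 / 2 : ℝ) + y * I)) + 2 * Real.pi * h a := by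
  have hmem : Complex.re ⁻¹' Set.Ioo (a - 1) (a + 1) ∈ 𝓝 (a : ℂ) :=
    (isOpen_Ioo.preimage continuous_re).mem_nhds (by simp)
  -- `dslope h a` is f with its polar part h(a)/(u-a) subtracted. It is holomorphic across a, so
  -- Cauchy's theorem applies to it on the strip.
  have hg : DifferentiableOn ℂ (dslope h a) (Complex.re ⁻¹' Set.Icc (a - 1 / 2) (a + 1 / 2)) :=
    ((differentiableOn_dslope hmem).2 hh).mono
      (Set.preimage_mono (Set.Icc_subset_Ioo (by linarith) (by linarith)))
  have hgf : ∀ u : ℂ, u ≠ a → dslope h a u = f u - h a * (u - a)⁻¹ := by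
    intro u hu
    have : u - a ≠ 0 := sub_ne_zero.2 hu
    rw [dslope_of_ne _ hu, slope_def_field, hf u hu]
    field_simp
  have hB' : Tendsto (fun T => B T + ‖h a‖ * T⁻¹) atTop (𝓝 0) := by
    simpa using hB.add (tendsto_inv_atTop_zero.const_mul ‖h a‖)
  have hne : ∀ (x t : ℝ), x ≠ a ∨ t ≠ 0 → (x + t * I : ℂ) ≠ a := by
    intro x t hx he
    rcases hx with hx | hx
    · exact hx (by simpa using congrArg re he)
    · exact hx (by simpa using congrArg im he)
  have key := tendsto_integral_vertical_sub (by linarith) hg hB' (by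
    filter_upwards [hfB, eventually_gt_atTop 0] with T hT hT0 x hx t ht
    have ht0 : t ≠ 0 := by rintro rfl; simp at ht; linarith
    rw [hgf _ (hne x t (Or.inr ht0))]
    refine (norm_sub_le _ _).trans (add_le_add (hT x hx t ht) ?_)
    rw [norm_mul, norm_inv]
    gcongr
    have := abs_im_le_norm (x + t * I - a)
    simpa [ht] using this)
  obtain ⟨hi, hv⟩ := integrable_and_integral_inv_half_strip
  have hint : Integrable (fun y : ℝ => f ((a + 1 / 2 : ℝ) + y * I) - f ((a - 1 / 2 : ℝ) + y * I) -
      h a * (((1 / 2 : ℂ) + y * I)⁻¹ - (-(1 / 2 : ℂ) + y * I)⁻¹)) :=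
    (h2.sub h1).sub (hi.const_mul _)
  have hlim := intervalIntegral_tendsto_integral hint tendsto_neg_atTop_atBot tendsto_id
  have hcont : ∀ x : ℝ, x ∈ Set.Icc (a - 1 / 2) (a + 1 / 2) → ∀ T : ℝ,
      IntervalIntegrable (fun y : ℝ => dslope h a (x + y * I)) volume (-T) T := fun x hx T =>
    (hg.continuousOn.comp_continuous (by fun_prop) fun y => by simpa using hx).intervalIntegrable _ _
  have heq : ∀ T : ℝ, (∫ y in (-T)..T, dslope h a ((a + 1 / 2 : ℝ) + y * I)) -
      (∫ y in (-T)..T, dslope h a ((a - 1 / 2 : ℝ) + y * I)) = ∫ y in (-T)..T,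
        (f ((a + 1 / 2 : ℝ) + y * I) - f ((a - 1 / 2 : ℝ) + y * I) -
          h a * (((1 / 2 : ℂ) + y * I)⁻¹ - (-(1 / 2 : ℂ) + y * I)⁻¹)) := by
    intro T
    rw [← intervalIntegral.integral_sub (hcont _ (by constructor <;> linarith) T)
      (hcont _ (by constructor <;> linarith) T)]
    refine intervalIntegral.integral_congr fun y _ => ?_
    rw [hgf _ (hne _ _ (Or.inl (by linarith))), hgf _ (hne _ _ (Or.inl (by linarith)))]
    push_cast
    ring_nf
  have h0 := tendsto_nhds_unique (hlim.congr fun T => (heq T).symm) key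
  have hsub : ∫ y : ℝ, (f ((a + 1 / 2 : ℝ) + y * I) - f ((a - 1 / 2 : ℝ) + y * I)) =
      (∫ y : ℝ, f ((a + 1 / 2 : ℝ) + y * I)) - ∫ y : ℝ, f ((a - 1 / 2 : ℝ) + y * I) :=
    integral_sub h2 h1
  have h3 := integral_sub (h2.sub h1) (hi.const_mul (h a))
  simp only [Pi.sub_apply] at h3
  rw [h3, integral_const_mul, hv, hsub] at h0
  linear_combination h0

/-! ### Bounds for the quotient Γ(1+u)/Γ(1+αu) -/

/-- The meromorphic function `Γ(1 + u) / Γ(1 + α u)`. -/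
noncomputable def gammaRatio (α : ℝ) (u : ℂ) : ℂ :=
  Complex.Gamma (1 + u) * (Complex.Gamma (1 + α * u))⁻¹

/-- Valid at every s: if a factor s+j vanishes, then s is a pole of Γ and both sides are 0 by
convention. -/
theorem Gamma_eq_Gamma_add_nat_div (s : ℂ) (n : ℕ) :
    Complex.Gamma s = Complex.Gamma (s + n) / ∏ j ∈ Finset.range n, (s + j) := by
  induction n with
  | zero => simp
  | succ n ih =>
    rw [ih, Finset.prod_range_succ]
    rcases eq_or_ne (s + n) 0 with h | h
    · simp [h]
    · push_cast
      rw [← add_assoc, Complex.Gamma_add_one _ h, mul_comm (∏ j ∈ Finset.range n, (s + (j : ℂ))),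
        mul_div_mul_left _ _ h]

/-- Γ(1+u) gains the rate θ, and 1/Γ(1+αu) costs π by reflection minus the θ gained by Γ(-αu), all
scaled by α. The balance is positive once θ > πα/(1+α), which lies below π/2 because α < 1. -/
theorem exists_decay_angle {α : ℝ} (h0 : 0 < α) (h1 : α < 1) :
    ∃ θ : ℝ, 0 ≤ θ ∧ θ < Real.pi / 2 ∧ 0 < θ - (Real.pi - θ) * α := by
  have hπ := Real.pi_pos
  have h : Real.pi * α / (1 + α) < Real.pi / 2 := by
    rw [div_lt_div_iff₀ (by linarith) two_pos]; nlinarith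
  obtain ⟨θ, hl, hr⟩ := exists_between h
  refine ⟨θ, le_trans (by positivity) hl.le, hr, ?_⟩
  rw [div_lt_iff₀ (by linarith)] at hl
  linarith

theorem one_add_mul_im (α : ℝ) (u : ℂ) : (1 + (α : ℂ) * u).im = α * u.im := by simp

theorem norm_inv_Gamma_one_add_mul_le {α : ℝ} (hα : 0 < α) {u : ℂ}
    (hu : Complex.Gamma (-(α * u)) ≠ 0) :
    ‖(Complex.Gamma (1 + α * u))⁻¹‖ ≤
      Real.exp (Real.pi * α * |u.im|) * ‖Complex.Gamma (-(α * u))‖ := by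
  have he : 1 - (1 + (α : ℂ) * u) = -(α * u) := by ring
  have h := norm_inv_Gamma_le (s := 1 + α * u) (by rwa [he])
  rwa [he, one_add_mul_im, abs_mul, abs_of_pos hα, ← mul_assoc] at h

theorem exists_norm_gammaRatio_le_exp {α θ : ℝ} (hα0 : 0 < α) (hα1 : α < 1) (h0 : 0 ≤ θ)
    (h1 : θ < Real.pi / 2) (M : ℝ) :
    ∃ C : ℝ, 0 < C ∧ ∀ u : ℂ, |u.re| ≤ M → 1 / α ≤ |u.im| →
      ‖gammaRatio α u‖ ≤ C * Real.exp (-((θ - (Real.pi - θ) * α) * |u.im|)) := by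
  obtain ⟨C, hC0, hC⟩ := exists_norm_Gamma_le_exp h0 h1 (M + 1)
  refine ⟨C * C, by positivity, fun u hu ht => ?_⟩
  have hM : 0 ≤ M := (abs_nonneg _).trans hu
  -- The threshold 1/α makes both |Im u| and α|Im u| at least 1, as the strip bound for Γ requires
  -- at 1+u and at -αu.
  have h1α : 1 ≤ 1 / α := by rw [le_div_iff₀ hα0]; linarith
  have hαt : 1 ≤ α * |u.im| := by rwa [div_le_iff₀' hα0] at ht
  have e1 : ‖Complex.Gamma (1 + u)‖ ≤ C * Real.exp (-(θ * |u.im|)) := by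
    have := hC (1 + u) (by
      have : (1 + u).re = 1 + u.re := by simp
      rw [this]
      exact (abs_add_le _ _).trans (by rw [abs_one]; linarith)) (by simpa using h1α.trans ht)
    simpa using this
  have him : |(-((α : ℂ) * u)).im| = α * |u.im| := by simp [abs_mul, abs_of_pos hα0]
  have e2 : ‖Complex.Gamma (-(α * u))‖ ≤ C * Real.exp (-(θ * (α * |u.im|))) := by
    have := hC (-(α * u)) (by
      have : |(-((α : ℂ) * u)).re| = α * |u.re| := by simp [abs_mul, abs_of_pos hα0]
      rw [this]
      nlinarith [abs_nonneg u.re]) (by rwa [him])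
    rwa [him] at this
  have hne : Complex.Gamma (-(α * u)) ≠ 0 := Complex.Gamma_ne_zero fun m h => by
    have := congrArg Complex.im h
    simp only [Complex.neg_im, Complex.im_ofReal_mul, Complex.natCast_im, neg_zero,
      neg_eq_zero, mul_eq_zero] at this
    rcases this with h | h
    · exact hα0.ne' h
    · rw [h] at hαt; norm_num at hαt
  have e3 := norm_inv_Gamma_one_add_mul_le hα0 hne
  rw [gammaRatio, norm_mul]
  calc _ ≤ (C * Real.exp (-(θ * |u.im|))) *
        (Real.exp (Real.pi * α * |u.im|) * (C * Real.exp (-(θ * (α * |u.im|))))) := by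
        gcongr
        exact e3.trans (by gcongr)
    _ = C * C * (Real.exp (-(θ * |u.im|)) * Real.exp (Real.pi * α * |u.im|) *
        Real.exp (-(θ * (α * |u.im|)))) := by ring
    _ = _ := by
      rw [← Real.exp_add, ← Real.exp_add]
      ring_nf

theorem integrable_exp_neg_mul_abs {κ : ℝ} (hκ : 0 < κ) :
    Integrable fun t : ℝ => Real.exp (-(κ * |t|)) := by
  have h : IntegrableOn (fun t : ℝ => Real.exp (-(κ * |t|))) (Set.Ioi 0) :=
    (integrableOn_exp_mul_Ioi (neg_lt_zero.2 hκ) 0).congr_fun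
      (fun t ht => by simp [abs_of_pos (Set.mem_Ioi.1 ht)]) measurableSet_Ioi
  have h' : IntegrableOn (fun t : ℝ => Real.exp (-(κ * |t|))) (Set.Iic 0) :=
    (integrableOn_exp_mul_Iic hκ 0).congr_fun
      (fun t ht => by simp [abs_of_nonpos (Set.mem_Iic.1 ht)]) measurableSet_Iic
  rw [← integrableOn_univ, ← Set.Iic_union_Ioi (a := (0 : ℝ))]
  exact h'.union h

theorem integrable_of_continuous_of_exp_decay {f : ℝ → ℂ} (hf : Continuous f) {C κ T : ℝ}
    (hC : 0 ≤ C) (hκ : 0 < κ)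
    (h : ∀ t, T ≤ |t| → ‖f t‖ ≤ C * Real.exp (-(κ * |t|))) : Integrable f := by
  obtain ⟨B, hB⟩ := (isCompact_Icc (a := -T) (b := T)).exists_bound_of_continuousOn hf.continuousOn
  refine ((integrable_exp_neg_mul_abs hκ).const_mul (C + |B| * Real.exp (κ * T))).mono'
    hf.aestronglyMeasurable (Filter.Eventually.of_forall fun t => ?_)
  rw [add_mul]
  rcases le_total T |t| with ht | ht
  · exact (h t ht).trans (le_add_of_nonneg_right (by positivity))
  · refine (hB t (abs_le.1 ht)).trans ((le_abs_self B).trans ?_)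
    refine le_add_of_nonneg_of_le (by positivity) ?_
    rw [mul_assoc, ← Real.exp_add]
    refine le_mul_of_one_le_right (abs_nonneg _) (Real.one_le_exp ?_)
    nlinarith

theorem differentiableAt_gammaRatio (α : ℝ) {u : ℂ} (hu : ∀ m : ℕ, u ≠ -(m + 1)) :
    DifferentiableAt ℂ (gammaRatio α) u := by
  have h1 : DifferentiableAt ℂ Complex.Gamma (1 + u) :=
    Complex.differentiableAt_Gamma _ fun m h => hu m (by linear_combination h)
  have h2 : DifferentiableAt ℂ (fun s : ℂ => (Complex.Gamma s)⁻¹) (1 + α * u) :=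
    Complex.differentiable_one_div_Gamma _
  exact (h1.comp u (f := fun u : ℂ => 1 + u) (by fun_prop)).mul
    (h2.comp u (f := fun u : ℂ => 1 + (α : ℂ) * u) (by fun_prop))

theorem verticalIntegrable_gammaRatio {α : ℝ} (hα0 : 0 < α) (hα1 : α < 1) {r : ℝ}
    (hr : ∀ m : ℕ, r ≠ -(m + 1)) : Complex.VerticalIntegrable (gammaRatio α) r := by
  obtain ⟨θ, h0, h1, hκ⟩ := exists_decay_angle hα0 hα1
  obtain ⟨C, hC0, hC⟩ := exists_norm_gammaRatio_le_exp hα0 hα1 h0 h1 |r|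
  refine integrable_of_continuous_of_exp_decay (T := 1 / α) ?_ hC0.le hκ fun t ht => ?_
  · refine continuous_iff_continuousAt.2 fun t => ?_
    refine ContinuousAt.comp (f := fun t : ℝ => (r + t * Complex.I : ℂ))
      (differentiableAt_gammaRatio α fun m h => hr m ?_).continuousAt (by fun_prop)
    simpa using congrArg Complex.re h
  · simpa using hC (r + t * Complex.I) (by simp) (by simpa using ht)

theorem norm_ofReal_cpow_neg_vertical {y : ℝ} (hy : 0 < y) (u : ℂ) :
    ‖(y : ℂ) ^ (-u)‖ = y ^ (-u.re) := by
  rw [Complex.norm_cpow_eq_rpow_re_of_pos hy, Complex.neg_re]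

theorem verticalIntegrable_cpow_mul {f : ℂ → ℂ} {r : ℝ} (hf : Complex.VerticalIntegrable f r)
    {y : ℝ} (hy : 0 < y) : Complex.VerticalIntegrable (fun u => (y : ℂ) ^ (-u) * f u) r := by
  refine Integrable.bdd_mul (c := y ^ (-r)) hf ?_ (Filter.Eventually.of_forall fun t => ?_)
  · exact (Continuous.const_cpow (by fun_prop)
      (Or.inl (by exact_mod_cast hy.ne'))).aestronglyMeasurable
  · rw [norm_ofReal_cpow_neg_vertical hy]; simp

open Filter Topology in
theorem exists_strip_bound_cpow_mul_gammaRatio {α : ℝ} (hα0 : 0 < α) (hα1 : α < 1) {y : ℝ}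
    (hy : 0 < y) (a b : ℝ) : ∃ B : ℝ → ℝ, Tendsto B atTop (𝓝 0) ∧
      ∀ᶠ T in atTop, ∀ x ∈ Set.Icc a b, ∀ t : ℝ, |t| = T →
        ‖(y : ℂ) ^ (-(x + t * Complex.I)) * gammaRatio α (x + t * Complex.I)‖ ≤ B T := by
  obtain ⟨θ, h0, h1, hκ⟩ := exists_decay_angle hα0 hα1
  obtain ⟨C, hC0, hC⟩ := exists_norm_gammaRatio_le_exp hα0 hα1 h0 h1 (max |a| |b|)
  obtain ⟨Y, hY⟩ := (isCompact_Icc (a := a) (b := b)).exists_bound_of_continuousOn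
    (f := fun x : ℝ => y ^ (-x))
    ((Real.continuous_const_rpow hy.ne').comp continuous_neg).continuousOn
  refine ⟨fun T => Y * (C * Real.exp (-((θ - (Real.pi - θ) * α) * T))), ?_, ?_⟩
  · have : Tendsto (fun T : ℝ => Real.exp (-((θ - (Real.pi - θ) * α) * T))) atTop (𝓝 0) :=
      Real.tendsto_exp_neg_atTop_nhds_zero.comp (tendsto_id.const_mul_atTop hκ)
    simpa using (this.const_mul C).const_mul Y
  · filter_upwards [eventually_ge_atTop (1 / α)] with T hT x hx t ht
    have hYx := hY x hx
    rw [Real.norm_of_nonneg (by positivity)] at hYx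
    rw [norm_mul, norm_ofReal_cpow_neg_vertical hy]
    have := hC (x + t * Complex.I) (by simpa using! abs_le_max_abs_abs hx.1 hx.2)
      (by simpa [ht] using hT)
    have hre : (x + t * Complex.I : ℂ).re = x := by simp
    have him : |(x + t * Complex.I : ℂ).im| = T := by simp [ht]
    rw [him] at this
    rw [hre]
    gcongr
    exact (by positivity : (0 : ℝ) ≤ y ^ (-x)).trans hYx

/-- The j-th factor has real part of modulus N-j-1/2 ≥ (N-j)/2. This is the source of the 1/N! decay
of Γ(1+u) on Re u = -(N+1/2). -/
theorem factorial_div_two_pow_le_prod (N : ℕ) (t : ℝ) :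
    (N.factorial : ℝ) / 2 ^ N ≤
      ∏ j ∈ Finset.range N, ‖(1 / 2 - N + t * Complex.I + j : ℂ)‖ := by
  induction N with
  | zero => simp
  | succ N ih =>
    rw [Finset.prod_range_succ', Nat.factorial_succ, pow_succ]
    have h1 : ∏ j ∈ Finset.range N, ‖(1 / 2 - (N + 1 : ℕ) + t * Complex.I + (j + 1 : ℕ) : ℂ)‖ =
        ∏ j ∈ Finset.range N, ‖(1 / 2 - N + t * Complex.I + j : ℂ)‖ :=
      Finset.prod_congr rfl fun j _ => by push_cast; ring_nf
    rw [h1]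
    have h2 : ((N : ℝ) + 1) / 2 ≤
        ‖(1 / 2 - (N + 1 : ℕ) + t * Complex.I + (0 : ℕ) : ℂ)‖ := by
      refine le_trans ?_ (Complex.abs_re_le_norm _)
      have : (1 / 2 - (N + 1 : ℕ) + t * Complex.I + (0 : ℕ) : ℂ).re = -(N + 1 / 2) := by
        simp; ring
      rw [this, abs_neg, abs_of_nonneg (by positivity)]
      have : (0 : ℝ) ≤ N := Nat.cast_nonneg N
      linarith
    calc (((N + 1) * N.factorial : ℕ) : ℝ) / (2 ^ N * 2)
        = N.factorial / 2 ^ N * (((N : ℝ) + 1) / 2) := by push_cast; field_simp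
      _ ≤ _ := by gcongr

/-- A bound for `gammaRatio α` on the vertical lines midway between its poles. -/
theorem exists_norm_gammaRatio_half_le {α θ : ℝ} (hα0 : 0 < α) (hα1 : α < 1) (h0 : 0 ≤ θ)
    (h1 : θ < Real.pi / 2) : ∃ A D : ℝ, 0 ≤ A ∧ 0 ≤ D ∧ ∀ (N : ℕ) (t : ℝ),
      ‖gammaRatio α ((-(N + 1 / 2) : ℝ) + t * Complex.I)‖ ≤
        D * A ^ N * ((N + 1).factorial : ℝ) ^ α / N.factorial *
          Real.exp (-((θ - (Real.pi - θ) * α) * |t|)) := by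
  have hcos : 0 < Real.cos θ := Real.cos_pos_of_mem_Ioo ⟨by linarith [Real.pi_pos], h1⟩
  set c := 1 / Real.cos θ with hc
  have hc1 : 1 ≤ c := by rw [hc, le_div_iff₀ hcos]; linarith [Real.cos_le_one θ]
  refine ⟨2 * c, Real.Gamma (1 / 2) * c ^ (1 / 2 : ℝ) * (2 / α) * c, by positivity,
    mul_nonneg (mul_nonneg (mul_nonneg (Real.Gamma_nonneg_of_nonneg (by norm_num))
      (by positivity)) (by positivity)) (by positivity), fun N t => ?_⟩
  set u : ℂ := (-(N + 1 / 2) : ℝ) + t * Complex.I with hu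
  have hure : u.re = -(N + 1 / 2) := by simp [hu]
  have huim : u.im = t := by simp [hu]
  have hN : (0 : ℝ) ≤ N := Nat.cast_nonneg N
  have hfac : (0 : ℝ) < N.factorial := by exact_mod_cast N.factorial_pos
  -- Shifting by N to real part 1/2 gives 1/N! here. The reflected factor Γ(-αu) below costs only
  -- (N+1)!^α, so their product is small because α < 1.
  have e1 : ‖Complex.Gamma (1 + u)‖ ≤ 2 ^ N / N.factorial *
      (Real.Gamma (1 / 2) * c ^ (1 / 2 : ℝ) * Real.exp (-(θ * |t|))) := by
    have hs : 1 + u = 1 / 2 - N + t * Complex.I := by rw [hu]; push_cast; ring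
    rw [hs, Gamma_eq_Gamma_add_nat_div _ N, norm_div, norm_prod, div_le_iff₀
      (lt_of_lt_of_le (by positivity) (factorial_div_two_pow_le_prod N t))]
    have hre : (1 / 2 - N + t * Complex.I + N : ℂ).re = 1 / 2 := by simp
    have him : (1 / 2 - N + t * Complex.I + N : ℂ).im = t := by simp
    have hG := norm_Gamma_le_exp h0 h1 (s := 1 / 2 - N + t * Complex.I + N)
      (by rw [hre]; norm_num)
    rw [hre, him] at hG
    have hpos : 0 ≤ Real.Gamma (1 / 2) * c ^ (1 / 2 : ℝ) * Real.exp (-(θ * |t|)) :=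
      (norm_nonneg _).trans hG
    calc _ ≤ Real.Gamma (1 / 2) * c ^ (1 / 2 : ℝ) * Real.exp (-(θ * |t|)) := hG
      _ = 2 ^ N / N.factorial * (Real.Gamma (1 / 2) * c ^ (1 / 2 : ℝ) * Real.exp (-(θ * |t|))) *
          (N.factorial / 2 ^ N) := by field_simp
      _ ≤ _ := by
        gcongr
        exact factorial_div_two_pow_le_prod N t
  have hαR : 0 < α * (N + 1 / 2) := by positivity
  have hre' : (-((α : ℂ) * u)).re = α * (N + 1 / 2) := by simp [hure]; ring
  have him' : |(-((α : ℂ) * u)).im| = α * |t| := by simp [huim, abs_mul, abs_of_pos hα0]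
  have e2 : ‖Complex.Gamma (-(α * u))‖ ≤ 2 / α * ((N + 1).factorial : ℝ) ^ α * c ^ (N + 1) *
      Real.exp (-(θ * (α * |t|))) := by
    have hG := norm_Gamma_le_exp h0 h1 (s := -(α * u)) (by rw [hre']; exact hαR)
    rw [hre', him'] at hG
    refine hG.trans ?_
    have g1 : Real.Gamma (α * (N + 1 / 2)) ≤ 2 / α * ((N + 1).factorial : ℝ) ^ α := by
      have hg := Gamma_one_add_le_factorial_rpow (n := N + 1) hα1 hαR.le
        (by push_cast; nlinarith)
      rw [add_comm, Real.Gamma_add_one hαR.ne'] at hg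
      have hG0 := (Real.Gamma_pos_of_pos hαR).le
      rw [div_mul_eq_mul_div, le_div_iff₀ hα0]
      nlinarith [mul_nonneg hG0 hα0.le]
    have g2 : c ^ (α * (N + 1 / 2)) ≤ c ^ (N + 1) := by
      rw [← Real.rpow_natCast]
      refine Real.rpow_le_rpow_of_exponent_le hc1 ?_
      push_cast; nlinarith
    gcongr
  have e3 := norm_inv_Gamma_one_add_mul_le hα0 (u := u)
    (Complex.Gamma_ne_zero_of_re_pos (by rw [hre']; exact hαR))
  rw [huim] at e3
  rw [gammaRatio, norm_mul]
  calc _ ≤ (2 ^ N / N.factorial *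
      (Real.Gamma (1 / 2) * c ^ (1 / 2 : ℝ) * Real.exp (-(θ * |t|)))) *
      (Real.exp (Real.pi * α * |t|) * (2 / α * ((N + 1).factorial : ℝ) ^ α * c ^ (N + 1) *
      Real.exp (-(θ * (α * |t|))))) := by
        refine mul_le_mul e1 (e3.trans (by gcongr)) (norm_nonneg _) ((norm_nonneg _).trans e1)
    _ = Real.Gamma (1 / 2) * c ^ (1 / 2 : ℝ) * (2 / α) * c * (2 * c) ^ N *
        ((N + 1).factorial : ℝ) ^ α / N.factorial * (Real.exp (-(θ * |t|)) *
        Real.exp (Real.pi * α * |t|) * Real.exp (-(θ * (α * |t|)))) := by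
      rw [mul_pow, pow_succ]; ring
    _ = _ := by
      rw [← Real.exp_add, ← Real.exp_add]
      ring_nf

/-! ### The residue series of the quotient -/

theorem prod_range_sub_eq (n : ℕ) :
    ∏ j ∈ Finset.range n, ((j : ℂ) - n) = (-1) ^ n * n.factorial := by
  rw [← Finset.prod_range_add_one_eq_factorial, ← Finset.prod_range_reflect]
  push_cast
  rw [← Finset.card_range n, ← Finset.prod_const, Finset.card_range, ← Finset.prod_mul_distrib]
  refine Finset.prod_congr rfl fun j hj => ?_
  have hj := Finset.mem_range.1 hj
  rw [show n - 1 - j = n - (1 + j) by omega, Nat.cast_sub (by omega)]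
  push_cast
  ring

/-- The residue of `y ^ (-u) * Γ(1 + u) / Γ(1 + α u)` at `u = -(k + 1)`. -/
noncomputable def gammaRatioResidue (α y : ℝ) (k : ℕ) : ℂ :=
  (-1) ^ k / k.factorial * (Complex.Gamma (1 - α * (k + 1)))⁻¹ * (y : ℂ) ^ (k + 1)

/-- Reflection on the real axis bounds the left side by Γ(α(k+1)), and log-convexity bounds that. -/
theorem norm_inv_Gamma_one_sub_le {α : ℝ} (hα0 : 0 < α) (hα1 : α < 1) (k : ℕ) :
    ‖(Complex.Gamma (1 - α * (k + 1)))⁻¹‖ ≤ 1 / α * ((k + 1).factorial : ℝ) ^ α := by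
  have hx : 0 < α * (k + 1) := by positivity
  have he : (-((α : ℂ) * (-(k + 1) : ℝ))) = ((α * (k + 1) : ℝ) : ℂ) := by push_cast; ring
  have h := norm_inv_Gamma_one_add_mul_le hα0 (u := ((-(k + 1) : ℝ) : ℂ)) (by
    rw [he]
    exact Complex.Gamma_ne_zero_of_re_pos (by simpa using hx))
  rw [he, Complex.Gamma_ofReal, Complex.ofReal_im, Complex.norm_real, Real.norm_of_nonneg
    (Real.Gamma_nonneg_of_nonneg hx.le)] at h
  simp only [abs_zero, mul_zero, Real.exp_zero, one_mul] at h
  have hg := Gamma_one_add_le_factorial_rpow (n := k + 1) hα1 hx.le (by push_cast; exact le_rfl)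
  rw [add_comm, Real.Gamma_add_one hx.ne'] at hg
  have e : (1 : ℂ) - α * (k + 1) = 1 + α * ((-(k + 1) : ℝ) : ℂ) := by push_cast; ring
  rw [e]
  refine h.trans ?_
  rw [one_div, inv_mul_eq_div, le_div_iff₀ hα0]
  have hG0 := (Real.Gamma_pos_of_pos hx).le
  have hk : (0 : ℝ) ≤ k := Nat.cast_nonneg k
  nlinarith [mul_nonneg (mul_nonneg hG0 hα0.le) hk]

theorem factorial_succ_rpow_div (α : ℝ) (k : ℕ) :
    ((k + 1).factorial : ℝ) ^ α / k.factorial =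
      ((k + 1 : ℕ) : ℝ) / ((k + 1).factorial : ℝ) ^ (1 - α) := by
  have h1 : (0 : ℝ) < (k + 1).factorial := by exact_mod_cast (k + 1).factorial_pos
  have h2 : (0 : ℝ) < k.factorial := by exact_mod_cast k.factorial_pos
  rw [div_eq_div_iff h2.ne' (by positivity), ← Real.rpow_add h1]
  simp [Nat.factorial_succ]

theorem summable_gammaRatioResidue {α y : ℝ} (hα0 : 0 < α) (hα1 : α < 1) (hy : 0 < y) :
    Summable (gammaRatioResidue α y) := by
  have h := (summable_mul_pow_div_factorial_rpow (sub_pos.2 hα1) hy.le)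
  have h' := ((summable_nat_add_iff 1).2 h).mul_left (1 / α)
  refine Summable.of_norm_bounded h' fun k => ?_
  rw [gammaRatioResidue, norm_mul, norm_mul, norm_div, norm_pow, norm_pow, norm_neg, norm_one,
    one_pow, Complex.norm_natCast, Complex.norm_real, Real.norm_of_nonneg hy.le]
  calc _ ≤ 1 / (k.factorial : ℝ) * (1 / α * ((k + 1).factorial : ℝ) ^ α) * y ^ (k + 1) := by
        gcongr
        exact norm_inv_Gamma_one_sub_le hα0 hα1 k
    _ = 1 / α * y ^ (k + 1) * (((k + 1).factorial : ℝ) ^ α / k.factorial) := by ring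
    _ = _ := by rw [factorial_succ_rpow_div]; ring

theorem integral_cpow_mul_gammaRatio_eq_add {α y : ℝ} (hα0 : 0 < α) (hα1 : α < 1) (hy : 0 < y)
    (k : ℕ) :
    ∫ t : ℝ, (y : ℂ) ^ (-((-(k + 1 / 2) : ℝ) + t * Complex.I)) *
        gammaRatio α ((-(k + 1 / 2) : ℝ) + t * Complex.I) =
      (∫ t : ℝ, (y : ℂ) ^ (-((-((k + 1 : ℕ) + 1 / 2) : ℝ) + t * Complex.I)) *
        gammaRatio α ((-((k + 1 : ℕ) + 1 / 2) : ℝ) + t * Complex.I)) +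
      2 * Real.pi * gammaRatioResidue α y k := by
  set f : ℂ → ℂ := fun u => (y : ℂ) ^ (-u) * gammaRatio α u with hf
  -- The integrand with the factor 1+u+k removed from the denominator of Γ(1+u) = Γ(2+u+k)/∏(1+u+j).
  -- That factor alone carries the pole at u = -(k+1).
  set h : ℂ → ℂ := fun u => (y : ℂ) ^ (-u) * (Complex.Gamma (1 + u + (k + 1 : ℕ)) /
    ∏ j ∈ Finset.range k, (1 + u + j)) * (Complex.Gamma (1 + α * u))⁻¹ with hh
  have hhalf : ∀ n m : ℕ, (-(n + 1 / 2) : ℝ) ≠ -(m + 1) := by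
    intro n m he
    have h3 : ((2 * n + 1 : ℕ) : ℝ) = (2 * (m + 1) : ℕ) := by push_cast; linarith
    have := Nat.cast_injective h3
    omega
  have hint : ∀ n : ℕ, Complex.VerticalIntegrable f (-(n + 1 / 2)) := fun n =>
    verticalIntegrable_cpow_mul (verticalIntegrable_gammaRatio hα0 hα1 (hhalf n)) hy
  have hdiff : DifferentiableOn ℂ h
      (Complex.re ⁻¹' Set.Ioo ((-(k + 1) : ℝ) - 1) ((-(k + 1) : ℝ) + 1)) := by
    intro u hu
    obtain ⟨hu1, hu2⟩ := hu
    refine DifferentiableAt.differentiableWithinAt ?_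
    have d1 : DifferentiableAt ℂ (fun u : ℂ => (y : ℂ) ^ (-u)) u :=
      DifferentiableAt.const_cpow (by fun_prop) (Or.inl (by exact_mod_cast hy.ne'))
    have d2 : DifferentiableAt ℂ Complex.Gamma (1 + u + (k + 1 : ℕ)) :=
      Complex.differentiableAt_Gamma _ fun m hm => by
        have := congrArg Complex.re hm
        simp at this
        have hm0 : (0 : ℝ) ≤ m := Nat.cast_nonneg m
        linarith
    have d3 : DifferentiableAt ℂ (fun s : ℂ => (Complex.Gamma s)⁻¹) (1 + α * u) :=
      Complex.differentiable_one_div_Gamma _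
    have hprod : ∏ j ∈ Finset.range k, (1 + u + j) ≠ 0 := by
      refine Finset.prod_ne_zero_iff.2 fun j hj he => ?_
      have := congrArg Complex.re he
      simp at this
      have hj' : (j : ℝ) + 1 ≤ k := by exact_mod_cast Finset.mem_range.1 hj
      linarith
    refine (d1.mul (DifferentiableAt.div ?_ (by fun_prop) hprod)).mul ?_
    · exact d2.comp u (f := fun u : ℂ => 1 + u + (k + 1 : ℕ)) (by fun_prop)
    · exact d3.comp u (f := fun u : ℂ => 1 + (α : ℂ) * u) (by fun_prop)
  have hfh : ∀ u : ℂ, u ≠ ((-(k + 1) : ℝ) : ℂ) → f u = h u / (u - ((-(k + 1) : ℝ) : ℂ)) := by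
    intro u _
    simp only [hf, hh, gammaRatio]
    rw [Gamma_eq_Gamma_add_nat_div (1 + u) (k + 1), Finset.prod_range_succ]
    push_cast
    rw [← div_div, show u - (-(k + 1) : ℂ) = 1 + u + k by ring]
    ring
  obtain ⟨B, hB, hfB⟩ := exists_strip_bound_cpow_mul_gammaRatio hα0 hα1 hy
    (-(k + 1) - 1 / 2) (-(k + 1) + 1 / 2)
  have e1 : (-(k + 1) + 1 / 2 : ℝ) = -(k + 1 / 2) := by ring
  have e2 : (-(k + 1) - 1 / 2 : ℝ) = -((k + 1 : ℕ) + 1 / 2) := by push_cast; ring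
  have key := integral_vertical_eq_add_residue hdiff hfh hB hfB
    (by rw [e2]; exact hint (k + 1)) (by rw [e1]; exact hint k)
  rw [e1, e2] at key
  rw [key]
  congr 2
  have hp : ∏ j ∈ Finset.range k, (1 + ((-(k + 1) : ℝ) : ℂ) + j) = (-1) ^ k * k.factorial := by
    rw [← prod_range_sub_eq]
    refine Finset.prod_congr rfl fun j _ => ?_
    push_cast
    ring
  simp only [hh, gammaRatioResidue]
  rw [hp]
  have e3 : (1 + ((-(k + 1) : ℝ) : ℂ) + (k + 1 : ℕ)) = 1 := by push_cast; ring
  have e4 : (1 : ℂ) + α * ((-(k + 1) : ℝ) : ℂ) = 1 - α * (k + 1) := by push_cast; ring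
  have e5 : (y : ℂ) ^ (-((-(k + 1) : ℝ) : ℂ)) = (y : ℂ) ^ (k + 1) := by
    rw [← Complex.cpow_natCast]; push_cast; ring_nf
  rw [e3, e4, e5, Complex.Gamma_one]
  have e6 : (1 : ℂ) / ((-1) ^ k * k.factorial) = (-1) ^ k / k.factorial := by
    rw [← div_div, one_div, ← inv_pow]; norm_num
  rw [e6]
  ring

open Filter Topology in
theorem tendsto_integral_cpow_mul_gammaRatio {α y : ℝ} (hα0 : 0 < α) (hα1 : α < 1) (hy : 0 < y) :
    Tendsto (fun N : ℕ => ∫ t : ℝ, (y : ℂ) ^ (-((-(N + 1 / 2) : ℝ) + t * Complex.I)) *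
        gammaRatio α ((-(N + 1 / 2) : ℝ) + t * Complex.I)) atTop (𝓝 0) := by
  obtain ⟨θ, h0, h1, hκ⟩ := exists_decay_angle hα0 hα1
  obtain ⟨A, D, hA, hD, hAD⟩ := exists_norm_gammaRatio_half_le hα0 hα1 h0 h1
  set κ := θ - (Real.pi - θ) * α
  set J := ∫ t : ℝ, Real.exp (-(κ * |t|))
  -- A+1 replaces A because A may be below 1, and A^N has to be dominated by a power with exponent
  -- N+1.
  have hs := summable_mul_pow_div_factorial_rpow (sub_pos.2 hα1)
    (mul_nonneg (by linarith : 0 ≤ A + 1) hy.le)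
  have ht := (((tendsto_add_atTop_iff_nat 1).2 hs.tendsto_atTop_zero).const_mul
    (y ^ (1 / 2 : ℝ) * y⁻¹ * D)).mul_const J
  rw [mul_zero, zero_mul] at ht
  refine squeeze_zero_norm (fun N => ?_) ht
  have hbd := norm_integral_le_of_norm_le (f := fun t : ℝ =>
      (y : ℂ) ^ (-((-(N + 1 / 2) : ℝ) + t * Complex.I)) *
        gammaRatio α ((-(N + 1 / 2) : ℝ) + t * Complex.I))
    ((integrable_exp_neg_mul_abs hκ).const_mul (y ^ (N + 1 / 2 : ℝ) *
      (D * A ^ N * ((N + 1).factorial : ℝ) ^ α / N.factorial))) (Eventually.of_forall fun t => by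
        rw [norm_mul, norm_ofReal_cpow_neg_vertical hy, mul_assoc]
        have : (-((-(N + 1 / 2) : ℝ) + t * Complex.I : ℂ).re) = (N + 1 / 2 : ℝ) := by simp
        rw [this]
        gcongr
        exact hAD N t)
  refine hbd.trans ?_
  rw [integral_const_mul]
  refine mul_le_mul_of_nonneg_right ?_ (integral_nonneg fun t => (Real.exp_pos _).le)
  rw [mul_div_assoc, factorial_succ_rpow_div, Real.rpow_add hy, Real.rpow_natCast]
  calc _ = y ^ (1 / 2 : ℝ) * y⁻¹ * D * (((N + 1 : ℕ) : ℝ) *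
        (A ^ N * y ^ (N + 1) / ((N + 1).factorial : ℝ) ^ (1 - α))) := by
        rw [pow_succ y]; field_simp
    _ ≤ _ := by
        rw [mul_pow]
        gcongr
        calc A ^ N ≤ (A + 1) ^ N := by gcongr; linarith
          _ ≤ (A + 1) ^ (N + 1) := pow_le_pow_right₀ (by linarith) (Nat.le_succ N)

/-- The Mellin--Barnes integral of `Γ(1 + u) / Γ(1 + α u)` as the sum of its residues. -/
theorem hasSum_mellinInv_gammaRatio {α r y : ℝ} (hα0 : 0 < α) (hα1 : α < 1) (hr : -1 < r)
    (hy : 0 < y) : HasSum (gammaRatioResidue α y) (mellinInv r (gammaRatio α) y) := by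
  rw [(summable_gammaRatioResidue hα0 hα1 hy).hasSum_iff_tendsto_nat]
  set J : ℕ → ℂ := fun N => ∫ t : ℝ, (y : ℂ) ^ (-((-(N + 1 / 2) : ℝ) + t * Complex.I)) *
        gammaRatio α ((-(N + 1 / 2) : ℝ) + t * Complex.I) with hJ
  have hπ : (2 * Real.pi : ℂ) ≠ 0 := by
    exact_mod_cast (mul_pos two_pos Real.pi_pos).ne'
  -- Each residue is the difference of the integrals over consecutive half-integer lines, so partial
  -- sums telescope.
  have hsum : ∀ N : ℕ, ∑ k ∈ Finset.range N, gammaRatioResidue α y k =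
      (J 0 - J N) / (2 * Real.pi) := by
    intro N
    induction N with
    | zero => simp
    | succ N ih =>
      rw [Finset.sum_range_succ, ih]
      have := integral_cpow_mul_gammaRatio_eq_add hα0 hα1 hy N
      rw [show J N = J (N + 1) + 2 * Real.pi * gammaRatioResidue α y N from this]
      field_simp
      ring
  have hnot : ∀ x : ℝ, -1 < x → ∀ m : ℕ, x ≠ -(m + 1) := by
    intro x hx m he
    have : (0 : ℝ) ≤ m := Nat.cast_nonneg m
    linarith
  have hvi : ∀ x : ℝ, -1 < x →
      Complex.VerticalIntegrable (fun u => (y : ℂ) ^ (-u) * gammaRatio α u) x := fun x hx =>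
    verticalIntegrable_cpow_mul (verticalIntegrable_gammaRatio hα0 hα1 (hnot x hx)) hy
  -- No poles lie to the right of -1, so the line r may be moved to -1/2, the line of J 0.
  have hmove : ∀ a b : ℝ, -1 < a → a ≤ b →
      ∫ t : ℝ, (y : ℂ) ^ (-(b + t * Complex.I)) * gammaRatio α (b + t * Complex.I) =
      ∫ t : ℝ, (y : ℂ) ^ (-(a + t * Complex.I)) * gammaRatio α (a + t * Complex.I) := by
    intro a b ha hab
    obtain ⟨B, hB, hfB⟩ := exists_strip_bound_cpow_mul_gammaRatio hα0 hα1 hy a b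
    refine integral_vertical_eq_of_differentiableOn hab (g := fun u =>
      (y : ℂ) ^ (-u) * gammaRatio α u) (fun u hu => ?_) hB hfB (hvi a ha)
      (hvi b (by linarith))
    refine DifferentiableAt.differentiableWithinAt (DifferentiableAt.mul
      (DifferentiableAt.const_cpow (by fun_prop) (Or.inl (by exact_mod_cast hy.ne')))
      (differentiableAt_gammaRatio α fun m he => hnot u.re (by linarith [hu.1]) m ?_))
    simpa using congrArg Complex.re he
  have hval : mellinInv r (gammaRatio α) y = (J 0 - 0) / (2 * Real.pi) := by
    have hJ0 : ∫ t : ℝ, (y : ℂ) ^ (-(r + t * Complex.I)) * gammaRatio α (r + t * Complex.I) =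
        J 0 := by
      have e : J 0 = ∫ t : ℝ, (y : ℂ) ^ (-((-(1 / 2) : ℝ) + t * Complex.I)) *
          gammaRatio α ((-(1 / 2) : ℝ) + t * Complex.I) := by simp [hJ]
      rw [e]
      rcases le_total r (-(1 / 2)) with h | h
      · exact (hmove r _ hr h).symm
      · exact hmove _ r (by norm_num) h
    rw [mellinInv]
    simp only [smul_eq_mul]
    rw [hJ0, sub_zero, Complex.real_smul]
    push_cast
    ring
  rw [hval]
  refine Filter.Tendsto.congr (fun N => (hsum N).symm) ?_
  exact (tendsto_const_nhds.sub (tendsto_integral_cpow_mul_gammaRatio hα0 hα1 hy)).div_const _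

/-! ### Gauss's multiplication formula -/

theorem prod_range_mul_eq {M : Type*} [CommMonoid M] (f : ℕ → M) (q m : ℕ) :
    ∏ i ∈ Finset.range (q * m), f i =
      ∏ j ∈ Finset.range q, ∏ i ∈ Finset.range m, f (q * i + j) := by
  induction m with
  | zero => simp
  | succ m ih =>
    rw [Nat.mul_succ, Finset.prod_range_add, ih, ← Finset.prod_mul_distrib]
    exact Finset.prod_congr rfl fun j _ => (Finset.prod_range_succ _ _).symm

theorem sum_range_mul_eq {M : Type*} [AddCommMonoid M] (f : ℕ → M) (q m : ℕ) :
    ∑ i ∈ Finset.range (q * m), f i =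
      ∑ j ∈ Finset.range q, ∑ i ∈ Finset.range m, f (q * i + j) := by
  induction m with
  | zero => simp
  | succ m ih =>
    rw [Nat.mul_succ, Finset.sum_range_add, ih, ← Finset.sum_add_distrib]
    exact Finset.sum_congr rfl fun j _ => (Finset.sum_range_succ _ _).symm

theorem prod_Icc_one_eq {M : Type*} [CommMonoid M] (f : ℕ → M) (q : ℕ) :
    ∏ j ∈ Finset.Icc 1 q, f j = ∏ j ∈ Finset.range q, f (j + 1) := by
  have := Finset.prod_Ico_eq_prod_range f 1 (q + 1)
  simpa [add_comm] using! this

-- Stirling at n+1, raised to the power k+1, against Stirling at (k+1)(n+1): the exponential and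
-- power factors cancel and √π^(k+1)/√π survives.
open Filter Topology in
theorem tendsto_gauss_multiplication_const (k : ℕ) :
    Tendsto (fun n : ℕ => √(n : ℝ) ^ (k + 2) * (n.factorial : ℝ) ^ (k + 1) *
        ((k : ℝ) + 1) ^ ((k + 1) * (n + 1)) /
        ((((k + 1) * n + k : ℕ) : ℝ) * ((k + 1) * n + k).factorial))
      atTop (𝓝 (√(2 * Real.pi) ^ k / √((k : ℝ) + 1))) := by
  have hst := Stirling.tendsto_stirlingSeq_sqrt_pi
  have hπ : √Real.pi ≠ 0 := (Real.sqrt_pos.2 Real.pi_pos).ne'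
  have hn1 : Tendsto (fun n : ℕ => n + 1) atTop atTop := tendsto_add_atTop_nat 1
  have hn2 : Tendsto (fun n : ℕ => (k + 1) * (n + 1)) atTop atTop :=
    tendsto_atTop_mono (fun n => by nlinarith) hn1
  have h1 : Tendsto (fun n : ℕ => (n : ℝ) / (n + 1)) atTop (𝓝 1) :=
    tendsto_natCast_div_add_atTop 1
  have h2 : Tendsto (fun n : ℕ => √((n : ℝ) / (n + 1)) ^ (k + 2)) atTop (𝓝 1) := by
    simpa using ((Real.continuous_sqrt.tendsto 1).comp h1).pow (k + 2)
  have h3 : Tendsto (fun n : ℕ => (((k + 1) * n + k : ℕ) : ℝ) / ((k + 1) * n + k + 1 : ℕ)) atTop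
      (𝓝 1) := by
    have : Tendsto (fun n : ℕ => (k + 1) * n + k) atTop atTop :=
      tendsto_atTop_mono (fun n => show n ≤ _ by nlinarith) tendsto_id
    refine ((tendsto_natCast_div_add_atTop (1 : ℝ)).comp this).congr fun n => ?_
    simp
  have hlim := (((hst.comp hn1).pow (k + 1)).div (hst.comp hn2) hπ).mul_const
    (√2 ^ k / √((k : ℝ) + 1)) |>.mul h2 |>.div h3 one_ne_zero
  have hval : √Real.pi ^ (k + 1) / √Real.pi * (√2 ^ k / √((k : ℝ) + 1)) * 1 / 1 =
      √(2 * Real.pi) ^ k / √((k : ℝ) + 1) := by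
    rw [Real.sqrt_mul zero_le_two, mul_pow, pow_succ]
    field_simp
  rw [hval] at hlim
  refine hlim.congr' ?_
  filter_upwards [eventually_gt_atTop 0] with n hn
  have hn' : (0 : ℝ) < n := by exact_mod_cast hn
  have hN : (0 : ℝ) < (((k + 1) * n + k : ℕ) : ℝ) := by
    have : 0 < (k + 1) * n + k := by positivity
    exact_mod_cast this
  have hfN : (((k + 1) * (n + 1)).factorial : ℝ) =
      ((k + 1) * (n + 1)) * ((k + 1) * n + k).factorial := by
    rw [show (k + 1) * (n + 1) = ((k + 1) * n + k) + 1 by ring, Nat.factorial_succ]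
    push_cast; ring
  have hfn : ((n + 1).factorial : ℝ) = (n + 1) * n.factorial := by
    rw [Nat.factorial_succ]; push_cast; ring
  have hF : (0 : ℝ) < n.factorial := by exact_mod_cast n.factorial_pos
  have hF' : (0 : ℝ) < ((k + 1) * n + k).factorial := by
    exact_mod_cast Nat.factorial_pos _
  simp only [Pi.div_apply, Function.comp_apply, Stirling.stirlingSeq]
  rw [hfN, hfn]
  have hM : (0 : ℝ) < (n : ℝ) + 1 := by positivity
  have hk : (0 : ℝ) < (k : ℝ) + 1 := by positivity
  have hE := Real.exp_pos 1
  have hcast : (((k + 1) * n + k + 1 : ℕ) : ℝ) = (k + 1) * (n + 1) := by push_cast; ring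
  have hcast2 : (((k + 1) * (n + 1) : ℕ) : ℝ) = (k + 1) * (n + 1) := by push_cast; ring
  rw [hcast, hcast2, Real.sqrt_div hn'.le]
  push_cast
  rw [Real.sqrt_mul zero_le_two, Real.sqrt_mul zero_le_two, Real.sqrt_mul hk.le]
  push_cast at hN
  set a := √((n : ℝ) + 1) with ha
  set b := √((k : ℝ) + 1)
  set w := √(2 : ℝ)
  have ha0 : 0 < a := Real.sqrt_pos.2 hM
  have hb0 : 0 < b := Real.sqrt_pos.2 hk
  have hw0 : 0 < w := Real.sqrt_pos.2 two_pos
  have ha2 : (n : ℝ) + 1 = a ^ 2 := (Real.sq_sqrt hM.le).symm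
  have hpow : (((k : ℝ) + 1) * (n + 1) / Real.exp 1) ^ ((k + 1) * (n + 1)) =
      ((k : ℝ) + 1) ^ ((k + 1) * (n + 1)) * ((((n : ℝ) + 1) / Real.exp 1) ^ (n + 1)) ^ (k + 1) := by
    rw [mul_div_assoc, mul_pow, ← pow_mul]
    ring_nf
  rw [hpow]
  set P := (((n : ℝ) + 1) / Real.exp 1) ^ (n + 1)
  have hP : 0 < P := by positivity
  rw [ha2]
  simp only [mul_pow, div_pow, pow_succ, pow_zero, one_mul]
  field_simp

/-- The exponents (j+1)/(k+1), j ≤ k, add up to (k+2)/2. -/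
theorem prod_cpow_natCast_add_div {n k : ℕ} (hn : n ≠ 0) (s : ℂ) :
    ∏ j ∈ Finset.range (k + 1), (n : ℂ) ^ (s + (j + 1) / (k + 1)) =
      (n : ℂ) ^ ((k + 1) * s) * ((√(n : ℝ) ^ (k + 2) : ℝ) : ℂ) := by
  have hn' : (n : ℂ) ≠ 0 := by exact_mod_cast hn
  have hk : ((k : ℂ) + 1) ≠ 0 := by exact_mod_cast k.succ_ne_zero
  have hsq : ((√(n : ℝ) ^ (k + 2) : ℝ) : ℂ) = (n : ℂ) ^ (((k : ℂ) + 2) / 2) := by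
    rw [Real.sqrt_eq_rpow, ← Real.rpow_natCast, ← Real.rpow_mul (Nat.cast_nonneg n),
      Complex.ofReal_cpow (Nat.cast_nonneg n)]
    push_cast
    ring_nf
  rw [hsq, ← Complex.cpow_add _ _ hn']
  simp_rw [Complex.cpow_def_of_ne_zero hn']
  rw [← Complex.exp_sum, ← Finset.mul_sum, Finset.sum_add_distrib, ← Finset.sum_div]
  have hg : ∑ j ∈ Finset.range (k + 1), ((j : ℂ) + 1) = (k + 1) * (k + 2) / 2 := by
    have : ∀ m : ℕ, ∑ j ∈ Finset.range m, ((j : ℂ) + 1) = m * (m + 1) / 2 := by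
      intro m
      induction m with
      | zero => simp
      | succ m ih => rw [Finset.sum_range_succ, ih]; push_cast; ring
    rw [this]; push_cast; ring
  rw [hg]
  congr 2
  simp
  field_simp

/-- Gauss's formula already holds for Euler's approximants up to explicit factors. The index
(k+1)n+k is chosen so that the single approximant has (k+1)(n+1) denominator factors; sorted by
residue modulo k+1 they are those of the product on the left. -/
theorem prod_GammaSeq_eq {n k : ℕ} (hn : n ≠ 0) (s : ℂ) :
    ∏ j ∈ Finset.range (k + 1), Complex.GammaSeq (s + (j + 1) / (k + 1)) n =
      Complex.GammaSeq (1 + (k + 1) * s) ((k + 1) * n + k) *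
        ((√(n : ℝ) ^ (k + 2) * (n.factorial : ℝ) ^ (k + 1) *
        ((k : ℝ) + 1) ^ ((k + 1) * (n + 1)) /
        ((((k + 1) * n + k : ℕ) : ℝ) * ((k + 1) * n + k).factorial) : ℝ) : ℂ) *
        (((n : ℝ) / ((k + 1) * n + k : ℕ) : ℝ) : ℂ) ^ ((k + 1) * s) := by
  have hk : ((k : ℂ) + 1) ≠ 0 := by exact_mod_cast k.succ_ne_zero
  set N := (k + 1) * n + k with hN
  have hN0 : N ≠ 0 := by rw [hN]; positivity
  have hNc : (N : ℂ) ≠ 0 := by exact_mod_cast hN0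
  have hF : (N.factorial : ℂ) ≠ 0 := by exact_mod_cast N.factorial_ne_zero
  simp only [Complex.GammaSeq]
  rw [Finset.prod_div_distrib, Finset.prod_mul_distrib, prod_cpow_natCast_add_div hn,
    Finset.prod_const, Finset.card_range]
  have hden : ∏ i ∈ Finset.range (N + 1), (1 + ((k : ℂ) + 1) * s + i) =
      ((k : ℂ) + 1) ^ ((k + 1) * (n + 1)) *
        ∏ j ∈ Finset.range (k + 1), ∏ i ∈ Finset.range (n + 1), (s + (j + 1) / (k + 1) + i) := by
    rw [show N + 1 = (k + 1) * (n + 1) by rw [hN]; ring, prod_range_mul_eq, pow_mul',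
      ← Finset.card_range (k + 1), ← Finset.prod_const, Finset.card_range,
      ← Finset.prod_mul_distrib]
    refine Finset.prod_congr rfl fun j _ => ?_
    have hc : ((k : ℂ) + 1) ^ (n + 1) = ∏ _i ∈ Finset.range (n + 1), ((k : ℂ) + 1) := by simp
    rw [hc, ← Finset.prod_mul_distrib]
    refine Finset.prod_congr rfl fun i _ => ?_
    push_cast
    field_simp
    ring
  rw [hden]
  set Q := ∏ j ∈ Finset.range (k + 1), ∏ i ∈ Finset.range (n + 1), (s + (j + 1) / (k + 1) + i)
  have hcp : (((n : ℝ) / (N : ℕ) : ℝ) : ℂ) ^ (((k : ℂ) + 1) * s) =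
      (n : ℂ) ^ (((k : ℂ) + 1) * s) / (N : ℂ) ^ (((k : ℂ) + 1) * s) := by
    rw [div_eq_mul_inv, Complex.ofReal_mul,
      Complex.mul_cpow_ofReal_nonneg (Nat.cast_nonneg n) (by positivity), Complex.ofReal_inv,
      Complex.ofReal_natCast, Complex.ofReal_natCast, Complex.inv_cpow, ← div_eq_mul_inv]
    rw [Complex.natCast_arg]
    exact Real.pi_pos.ne
  rw [hcp, Complex.cpow_add _ _ hNc, Complex.cpow_one]
  have hX : (N : ℂ) ^ (((k : ℂ) + 1) * s) ≠ 0 := by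
    rw [Complex.cpow_def_of_ne_zero hNc]; exact Complex.exp_ne_zero _
  -- At the zeros of the denominators both sides are 0 by the division convention.
  rcases eq_or_ne Q 0 with hQ | hQ
  · simp [hQ]
  push_cast
  field_simp

open Filter Topology in
/-- **Gauss's multiplication formula**, in the form that absorbs the factor `s`. -/
theorem Gamma_one_add_nat_mul (q : ℕ) (hq : 0 < q) (s : ℂ) :
    Complex.Gamma (1 + q * s) = (q : ℂ) ^ (q * s) *
      ((√(q : ℝ) / √(2 * Real.pi) ^ (q - 1) : ℝ) : ℂ) *
      ∏ j ∈ Finset.Icc 1 q, Complex.Gamma (s + j / q) := by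
  obtain ⟨k, rfl⟩ : ∃ k, q = k + 1 := ⟨q - 1, by omega⟩
  have hIcc : ∏ j ∈ Finset.Icc 1 (k + 1), Complex.Gamma (s + j / ((k + 1 : ℕ) : ℂ)) =
      ∏ j ∈ Finset.range (k + 1), Complex.Gamma (s + (j + 1) / (k + 1)) := by
    rw [prod_Icc_one_eq]
    push_cast
    rfl
  rw [hIcc]
  have hL : Tendsto (fun n : ℕ => ∏ j ∈ Finset.range (k + 1),
      Complex.GammaSeq (s + (j + 1) / (k + 1)) n) atTop
      (𝓝 (∏ j ∈ Finset.range (k + 1), Complex.Gamma (s + (j + 1) / (k + 1)))) :=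
    tendsto_finsetProd _ fun j _ => Complex.GammaSeq_tendsto_Gamma _
  have hN : Tendsto (fun n : ℕ => (k + 1) * n + k) atTop atTop :=
    tendsto_atTop_mono (fun n => show n ≤ _ by nlinarith) tendsto_id
  have h1 := (Complex.GammaSeq_tendsto_Gamma (1 + (k + 1) * s)).comp hN
  have h2 := (Complex.continuous_ofReal.tendsto _).comp (tendsto_gauss_multiplication_const k)
  have hk : (0 : ℝ) < (k : ℝ) + 1 := by positivity
  have hr : Tendsto (fun n : ℕ => (n : ℝ) / ((k + 1) * n + k : ℕ)) atTop (𝓝 (1 / (k + 1))) := by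
    have h0 : Tendsto (fun n : ℕ => (k : ℝ) + 1 + k / n) atTop (𝓝 (k + 1)) := by
      simpa using (tendsto_const_div_atTop_nhds_zero_nat (k : ℝ)).const_add ((k : ℝ) + 1)
    refine (tendsto_const_nhds.div h0 hk.ne').congr' ?_
    filter_upwards [eventually_gt_atTop 0] with n hn
    have hn' : (0 : ℝ) < n := by exact_mod_cast hn
    push_cast
    simp only [Pi.div_apply]
    field_simp
  have h3 := ((Complex.continuous_ofReal.tendsto _).comp hr)
  have h4 : Tendsto (fun n : ℕ => (((n : ℝ) / ((k + 1) * n + k : ℕ) : ℝ) : ℂ) ^ ((k + 1) * s))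
      atTop (𝓝 (((1 / (k + 1) : ℝ) : ℂ) ^ ((k + 1) * s))) :=
    (continuousAt_cpow_const (Complex.ofReal_mem_slitPlane.2 (by positivity))).tendsto.comp h3
  have hlim := tendsto_nhds_unique hL (((h1.mul h2).mul h4).congr' (by
    filter_upwards [eventually_ne_atTop 0] with n hn
    exact (prod_GammaSeq_eq hn s).symm))
  have hkc : ((k : ℂ) + 1) ≠ 0 := by exact_mod_cast k.succ_ne_zero
  have hinv : ((1 / (k + 1) : ℝ) : ℂ) ^ ((k + 1) * s) = ((k + 1 : ℂ) ^ ((k + 1) * s))⁻¹ := by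
    rw [one_div, Complex.ofReal_inv, Complex.inv_cpow]
    · push_cast; rfl
    · rw [Complex.arg_ofReal_of_nonneg hk.le]; exact Real.pi_pos.ne
  have hX : ((k : ℂ) + 1) ^ (((k : ℂ) + 1) * s) ≠ 0 := by
    rw [Complex.cpow_def_of_ne_zero hkc]; exact Complex.exp_ne_zero _
  rw [hlim, hinv]
  have hs1 : ((√((k : ℝ) + 1) : ℝ) : ℂ) ≠ 0 := by exact_mod_cast (Real.sqrt_pos.2 hk).ne'
  have hs2 : ((√(2 * Real.pi) : ℝ) : ℂ) ≠ 0 := by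
    exact_mod_cast (Real.sqrt_pos.2 (mul_pos two_pos Real.pi_pos)).ne'
  push_cast [Nat.add_sub_cancel]
  field_simp

/-! ### From the Lévy kernel to the Gamma quotient -/

/-- Γ(z+1) = zΓ(z) in numerator and denominator. The singularity at s = 1 is removable, but the
kernel takes the conventional value 0 there and the quotient is 1, hence the exclusion. -/
theorem levyKernel_eq_gammaRatio {α : ℝ} (hα : α ≠ 0) {s : ℂ} (hs : s ≠ 1) :
    levyKernel α s = gammaRatio α ((1 - s) / α) := by
  have hα' : (α : ℂ) ≠ 0 := by exact_mod_cast hα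
  have h1 : 1 - s ≠ 0 := sub_ne_zero.2 hs.symm
  rw [levyKernel, gammaRatio, mul_div_cancel₀ _ hα', add_comm 1 ((1 - s) / (α : ℂ)),
    add_comm 1 (1 - s), Complex.Gamma_add_one _ h1, Complex.Gamma_add_one _ (div_ne_zero h1 hα'),
    ← sub_div, mul_inv]
  field_simp

theorem integral_comp_vertical_scale {α : ℝ} (hα : 0 < α) (c : ℝ) (g : ℂ → ℂ) :
    ∫ y : ℝ, g (c + y * Complex.I) =
      α * ∫ t : ℝ, g (1 - α * (((1 - c) / α : ℝ) + t * Complex.I)) := by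
  have h := Measure.integral_comp_mul_left (fun y : ℝ => g (c + y * Complex.I)) (-α)
  have hα' : (α : ℂ) ≠ 0 := by exact_mod_cast hα.ne'
  rw [abs_of_nonpos (inv_nonpos.2 (neg_nonpos.2 hα.le)), inv_neg, neg_neg] at h
  have h2 : ∀ t : ℝ, (1 : ℂ) - α * (((1 - c) / α : ℝ) + t * Complex.I) =
      c + ((-α * t : ℝ) : ℂ) * Complex.I := by
    intro t
    push_cast
    field_simp
    ring
  simp_rw [h2, h]
  rw [Complex.real_smul, ← mul_assoc, Complex.ofReal_inv, mul_inv_cancel₀ hα', one_mul]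

theorem cpow_neg_one_sub_mul {α x : ℝ} (hx : 0 < x) (u : ℂ) :
    (x : ℂ) ^ (-(1 - α * u)) = (x : ℂ)⁻¹ * ((x ^ (-α) : ℝ) : ℂ) ^ (-u) := by
  have hx' : (x : ℂ) ≠ 0 := by exact_mod_cast hx.ne'
  rw [← Complex.cpow_mul_ofReal_nonneg hx.le, ← Complex.cpow_neg_one,
    ← Complex.cpow_add _ _ hx']
  push_cast
  ring_nf

theorem levyDensity_eq_mellinInv_gammaRatio {α c x : ℝ} (hα : 0 < α) (hc : c < 1) (hx : 0 < x) :
    levyDensity α c x =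
      (α / x : ℝ) * mellinInv ((1 - c) / α) (gammaRatio α) (x ^ (-α)) := by
  have hα' : (α : ℂ) ≠ 0 := by exact_mod_cast hα.ne'
  rw [levyDensity, mellinInv, mellinInv, integral_comp_vertical_scale hα c
    (fun s => (x : ℂ) ^ (-s) • levyKernel α s)]
  have h : ∀ t : ℝ, (x : ℂ) ^ (-(1 - α * (((1 - c) / α : ℝ) + t * Complex.I))) •
      levyKernel α (1 - α * (((1 - c) / α : ℝ) + t * Complex.I)) =
      (x : ℂ)⁻¹ * (((x ^ (-α) : ℝ) : ℂ) ^ (-(((1 - c) / α : ℝ) + t * Complex.I)) •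
        gammaRatio α (((1 - c) / α : ℝ) + t * Complex.I)) := by
    intro t
    have hne : (((1 - c) / α : ℝ) + t * Complex.I : ℂ) ≠ 0 := by
      intro h
      have := congrArg Complex.re h
      simp at this
      rcases this with h | h
      · linarith
      · exact hα.ne' h
    rw [cpow_neg_one_sub_mul hx, levyKernel_eq_gammaRatio hα.ne' (by
      rw [Ne, sub_eq_self]; exact mul_ne_zero hα' hne), sub_sub_cancel, mul_div_cancel_left₀ _ hα',
      smul_eq_mul, smul_eq_mul, mul_assoc]
  simp_rw [h]
  rw [integral_const_mul, Complex.real_smul, Complex.real_smul]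
  push_cast
  ring

theorem verticalIntegrable_levyKernel {α c : ℝ} (hα0 : 0 < α) (hα1 : α < 1) (hc : c < 1) :
    Complex.VerticalIntegrable (levyKernel α) c := by
  have h := verticalIntegrable_gammaRatio hα0 hα1 (r := (1 - c) / α) fun m h => by
    have h1 : 0 < (1 - c) / α := div_pos (by linarith) hα0
    have : (0 : ℝ) ≤ m := Nat.cast_nonneg m
    linarith
  have h' := h.comp_mul_left' (R := (-α)⁻¹) (inv_ne_zero (neg_ne_zero.2 hα0.ne'))
  refine h'.congr (Filter.Eventually.of_forall fun y => ?_)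
  have hα' : (α : ℂ) ≠ 0 := by exact_mod_cast hα0.ne'
  simp only
  rw [levyKernel_eq_gammaRatio hα0.ne']
  · congr 1
    push_cast
    field_simp
    ring
  · intro h
    have := congrArg Complex.re h
    simp at this
    linarith

/-! ### The Laplace transform -/

theorem verticalIntegrable_Gamma {r : ℝ} (hr : 0 < r) :
    Complex.VerticalIntegrable Complex.Gamma r := by
  have hpi : (1 : ℝ) < Real.pi / 2 := by linarith [Real.pi_gt_three]
  have hcos := Real.cos_pos_of_mem_Ioo (x := 1) ⟨by linarith, hpi⟩
  refine integrable_of_continuous_of_exp_decay (T := 0) (κ := 1)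
    (C := Real.Gamma r * (1 / Real.cos 1) ^ r) ?_ (by positivity) one_pos fun t _ => ?_
  · refine continuous_iff_continuousAt.2 fun t => ?_
    refine ContinuousAt.comp (f := fun t : ℝ => (r + t * Complex.I : ℂ))
      (Complex.differentiableAt_Gamma _ fun m h => ?_).continuousAt (by fun_prop)
    have := congrArg Complex.re h
    simp at this
    have h0 : (0 : ℝ) ≤ m := Nat.cast_nonneg m
    linarith
  · simpa using norm_Gamma_le_exp zero_le_one hpi (s := r + t * Complex.I) (by simpa using hr)

/-- The Cahen--Mellin integral. -/
theorem mellinInv_Gamma {r y : ℝ} (hr : 0 < r) (hy : 0 < y) :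
    mellinInv r Complex.Gamma y = (Real.exp (-y) : ℂ) := by
  have hm : ∀ t : ℝ, mellin (fun x : ℝ => (Real.exp (-x) : ℂ)) (r + t * Complex.I) =
      Complex.Gamma (r + t * Complex.I) := fun t => by
    rw [← Complex.GammaIntegral_eq_mellin, Complex.Gamma_eq_integral (by simpa using hr)]
  have h := mellinInv_mellin_eq r (fun x : ℝ => (Real.exp (-x) : ℂ)) hy ?_ ?_ ?_
  · rw [← h, mellinInv, mellinInv]
    simp_rw [hm]
  · have := Complex.GammaIntegral_convergent (s := r) (by simpa using hr)
    refine this.congr_fun (fun x _ => ?_) measurableSet_Ioi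
    simp only [smul_eq_mul]
    push_cast
    rw [mul_comm]
  · refine (verticalIntegrable_Gamma hr).congr (Filter.Eventually.of_forall fun t => (hm t).symm)
  · fun_prop

/-- The norm factors as x^(-c)exp(-tx) times |k|, and c < 1 gives integrability at 0. This justifies
Fubini. -/
theorem integrable_laplace_kernel {c t : ℝ} (hc : c < 1) (ht : 0 < t) {k : ℝ → ℂ}
    (hk : Integrable k) :
    Integrable (fun z : ℝ × ℝ => (Real.exp (-(t * z.1)) : ℂ) *
      ((z.1 : ℂ) ^ (-(c + z.2 * Complex.I)) * k z.2))
      ((volume.restrict (Set.Ioi 0)).prod volume) := by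
  have h1 : IntegrableOn (fun x : ℝ => x ^ (-c) * Real.exp (-(t * x))) (Set.Ioi 0) := by
    have := integrableOn_rpow_mul_exp_neg_mul_rpow (s := -c) (p := 1) (b := t)
      (by linarith) one_pos ht
    simpa using this
  have h2 := Integrable.mul_prod h1 hk.norm
  refine h2.mono' ?_ ?_
  · refine AEStronglyMeasurable.mul (by fun_prop) (AEStronglyMeasurable.mul ?_ ?_)
    · refine Measurable.aestronglyMeasurable ?_
      fun_prop
    · exact hk.aestronglyMeasurable.comp_snd
  · have hae : ∀ᵐ z : ℝ × ℝ ∂((volume.restrict (Set.Ioi 0)).prod volume), z.1 ∈ Set.Ioi (0 : ℝ) :=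
      Measure.quasiMeasurePreserving_fst.ae (ae_restrict_mem measurableSet_Ioi)
    filter_upwards [hae] with z hz
    rw [norm_mul, norm_mul, Complex.norm_real, Real.norm_of_nonneg (Real.exp_pos _).le,
      Complex.norm_cpow_eq_rpow_re_of_pos hz]
    simp
    apply le_of_eq
    ring

/-- After Fubini the x-integral is t^(s-1)Γ(1-s). Its Gamma factor cancels the one in the kernel,
and with u = (1-s)/α there remains Γ(u)(t^α)^(-u), the Cahen-Mellin integrand. -/
theorem levyDensity_laplace {α c t : ℝ} (hα0 : 0 < α) (hα1 : α < 1) (hc : c < 1) (ht : 0 < t) :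
    IntegrableOn (fun x : ℝ => (Real.exp (-(t * x)) : ℂ) * levyDensity α c x) (Set.Ioi 0) ∧
      ∫ x in Set.Ioi (0 : ℝ), (Real.exp (-(t * x)) : ℂ) * levyDensity α c x =
        (Real.exp (-t ^ α) : ℂ) := by
  have hα' : (α : ℂ) ≠ 0 := by exact_mod_cast hα0.ne'
  have hI := integrable_laplace_kernel hc ht (verticalIntegrable_levyKernel hα0 hα1 hc)
  have heq : ∀ x : ℝ, (Real.exp (-(t * x)) : ℂ) * levyDensity α c x =
      ((1 / (2 * Real.pi) : ℝ) : ℂ) * ∫ y : ℝ, (Real.exp (-(t * x)) : ℂ) *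
      ((x : ℂ) ^ (-(c + y * Complex.I)) * levyKernel α (c + y * Complex.I)) := by
    intro x
    rw [integral_const_mul, levyDensity, mellinInv, Complex.real_smul]
    simp only [smul_eq_mul]
    ring
  simp_rw [heq]
  refine ⟨hI.integral_prod_left.const_mul _, ?_⟩
  rw [integral_const_mul, integral_integral_swap hI]
  have hin : ∀ y : ℝ, ∫ x in Set.Ioi (0 : ℝ), (Real.exp (-(t * x)) : ℂ) *
      ((x : ℂ) ^ (-(c + y * Complex.I)) * levyKernel α (c + y * Complex.I)) =
      (fun s : ℂ => (1 / t : ℂ) ^ (1 - s) * Complex.Gamma (1 - s) * levyKernel α s)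
        (c + y * Complex.I) := by
    intro y
    have hre : 0 < (1 - (c + y * Complex.I) : ℂ).re := by simpa using hc
    simp only
    rw [← Complex.integral_cpow_mul_exp_neg_mul_Ioi hre ht, ← integral_mul_const]
    refine setIntegral_congr_fun measurableSet_Ioi fun x _ => ?_
    rw [show (1 - (c + y * Complex.I) - 1 : ℂ) = -(c + y * Complex.I) by ring]
    push_cast
    ring
  simp_rw [hin]
  rw [integral_comp_vertical_scale hα0 c
    (fun s : ℂ => (1 / t : ℂ) ^ (1 - s) * Complex.Gamma (1 - s) * levyKernel α s)]
  have hr : 0 < (1 - c) / α := div_pos (by linarith) hα0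
  rw [← mellinInv_Gamma hr (Real.rpow_pos_of_pos ht α), mellinInv, Complex.real_smul,
    ← integral_const_mul]
  congr 1
  refine integral_congr_ae (Filter.Eventually.of_forall fun y => ?_)
  simp only
  set u : ℂ := ((1 - c) / α : ℝ) + y * Complex.I with hu
  have hure : u.re = (1 - c) / α := by simp [hu]
  have hΓ : Complex.Gamma (α * u) ≠ 0 := Complex.Gamma_ne_zero_of_re_pos (by
    rw [Complex.re_ofReal_mul, hure]; positivity)
  have h3 : 1 / (α : ℂ) - (1 - α * u) / α = u := by field_simp; ring
  rw [levyKernel, h3, sub_sub_cancel, smul_eq_mul]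
  have h4 : (1 / t : ℂ) ^ (α * u) = ((t ^ α : ℝ) : ℂ) ^ (-u) := by
    rw [← Complex.cpow_mul_ofReal_nonneg ht.le, one_div,
      Complex.inv_cpow _ _ (by rw [Complex.arg_ofReal_of_nonneg ht.le]; exact Real.pi_pos.ne),
      ← Complex.cpow_neg, mul_neg]
  rw [h4]
  field_simp

/-! ### Fox H-function representations -/

/-- The constant of Gauss's multiplication formula. -/
noncomputable def gaussConst (q : ℕ) : ℝ := √(q : ℝ) / √(2 * Real.pi) ^ (q - 1)

theorem gaussConst_pos {q : ℕ} (hq : 0 < q) : 0 < gaussConst q := by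
  have : (0 : ℝ) < q := by exact_mod_cast hq
  have := Real.pi_pos
  unfold gaussConst
  positivity

theorem prod_map_pairRow (i₀ i₁ : ℕ) (g : ℕ → ℝ) (A : ℝ) (f : ℂ × ℝ → ℂ) :
    ((pairRow i₀ i₁ g A).map f).prod = ∏ i ∈ Finset.Icc i₀ i₁, f ((g i : ℂ), A) := by
  rw [pairRow, List.map_map]
  rfl

theorem prod_map_row (i₀ i₁ : ℕ) (g : ℕ → ℝ) (f : ℂ → ℂ) :
    ((row i₀ i₁ g).map f).prod = ∏ i ∈ Finset.Icc i₀ i₁, f (g i : ℂ) := by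
  rw [row, List.map_map]
  rfl

theorem length_pairRow (i₀ i₁ : ℕ) (g : ℕ → ℝ) (A : ℝ) :
    (pairRow i₀ i₁ g A).length = i₁ + 1 - i₀ := by
  simp [pairRow]

theorem foxHKernel_zero_of_length {m : ℕ} {a b : List (ℂ × ℝ)} (hm : b.length = m) (s : ℂ) :
    foxHKernel m 0 a b s = (b.map fun u => Complex.Gamma (u.1 + u.2 * s)).prod /
      (a.map fun u => Complex.Gamma (u.1 + u.2 * s)).prod := by
  subst hm
  simp [foxHKernel]

theorem prod_Icc_pred_mul {M : Type*} [CommMonoid M] (f : ℕ → M) {q : ℕ} (hq : 0 < q) :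
    (∏ i ∈ Finset.Icc 1 (q - 1), f i) * f q = ∏ i ∈ Finset.Icc 1 q, f i := by
  obtain ⟨k, rfl⟩ : ∃ k, q = k + 1 := ⟨q - 1, by omega⟩
  rw [Finset.prod_Icc_succ_top (by omega)]
  rfl

theorem ofReal_rpow_div_cpow {p q : ℕ} (l : ℝ) (s : ℂ) :
    (((p : ℝ) ^ (p * l) / (q : ℝ) ^ q : ℝ) : ℂ) ^ s =
      (p : ℂ) ^ (p * (l * s)) / (q : ℂ) ^ (q * s) := by
  rw [div_eq_mul_inv, Complex.ofReal_mul,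
    Complex.mul_cpow_ofReal_nonneg (by positivity) (by positivity), Complex.ofReal_inv,
    Complex.inv_cpow _ _ (by
      rw [Complex.arg_ofReal_of_nonneg (by positivity)]; exact Real.pi_pos.ne),
    ← Real.rpow_natCast, ← Complex.cpow_mul_ofReal_nonneg (Nat.cast_nonneg p),
    ← Complex.cpow_mul_ofReal_nonneg (Nat.cast_nonneg q), ← div_eq_mul_inv]
  push_cast
  rw [mul_assoc]

/-- Gauss's formula for Γ(1+qs) and for Γ(1+α·qs) = Γ(1+p·ls). This identifies the Fox kernel with
the Gamma quotient at u = qs. -/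
theorem prod_Gamma_div_prod_Gamma_eq {p q : ℕ} (hp : 0 < p) (hq : 0 < q) {α l : ℝ}
    (h : α * q = p * l) (s : ℂ) :
    (∏ j ∈ Finset.Icc 1 q, Complex.Gamma (s + j / q)) /
        ∏ i ∈ Finset.Icc 1 p, Complex.Gamma (l * s + i / p) =
      ((gaussConst p / gaussConst q : ℝ) : ℂ) *
        (((p : ℝ) ^ (p * l) / (q : ℝ) ^ q : ℝ) : ℂ) ^ s * gammaRatio α (q * s) := by
  have hcp : ((gaussConst p : ℝ) : ℂ) ≠ 0 := by exact_mod_cast (gaussConst_pos hp).ne'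
  have hcq : ((gaussConst q : ℝ) : ℂ) ≠ 0 := by exact_mod_cast (gaussConst_pos hq).ne'
  have hp0 : (p : ℂ) ≠ 0 := by exact_mod_cast hp.ne'
  have hq0 : (q : ℂ) ≠ 0 := by exact_mod_cast hq.ne'
  have h1 : (p : ℂ) ^ (p * (l * s)) ≠ 0 := by
    rw [Complex.cpow_def_of_ne_zero hp0]; exact Complex.exp_ne_zero _
  have h2 : (q : ℂ) ^ (q * s) ≠ 0 := by
    rw [Complex.cpow_def_of_ne_zero hq0]; exact Complex.exp_ne_zero _
  have h' : (α : ℂ) * q = p * l := by exact_mod_cast h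
  have h3 : (α : ℂ) * (q * s) = p * (l * s) := by rw [← mul_assoc, h', mul_assoc]
  rw [ofReal_rpow_div_cpow, gammaRatio, Gamma_one_add_nat_mul q hq, h3,
    Gamma_one_add_nat_mul p hp]
  rw [← gaussConst, ← gaussConst]
  push_cast
  rw [mul_inv, mul_inv]
  field_simp

/-- Both integrals are the sum of the same residues. -/
theorem mellinInv_gammaRatio_eq {α r r' y : ℝ} (hα0 : 0 < α) (hα1 : α < 1) (hr : -1 < r)
    (hr' : -1 < r') (hy : 0 < y) :
    mellinInv r (gammaRatio α) y = mellinInv r' (gammaRatio α) y :=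
  (hasSum_mellinInv_gammaRatio hα0 hα1 hr hy).unique (hasSum_mellinInv_gammaRatio hα0 hα1 hr' hy)

/-- The substitution u = qs; C goes into the prefactor and A into the argument z. All three Fox
formulas are instances. -/
theorem levyDensity_eq_mellinInv_of_kernel {α c d C A : ℝ} {q : ℕ} {k : ℂ → ℂ} (hα0 : 0 < α)
    (hα1 : α < 1) (hc : c < 1) (hq : 0 < q) (hd : -1 < q * d) (hC : C ≠ 0) (hA : 0 < A)
    (hk : ∀ t : ℝ, k (d + t * Complex.I) =
      C * (A : ℂ) ^ (d + t * Complex.I) * gammaRatio α (q * (d + t * Complex.I))) :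
    Complex.VerticalIntegrable k d ∧ ∀ x : ℝ, 0 < x → ∀ z : ℝ, z = A / x ^ (α * q) →
      levyDensity α c x = (α * q / (C * x) : ℝ) * mellinInv d k z := by
  have hq0 : (0 : ℝ) < q := by exact_mod_cast hq
  have hqc : (q : ℂ) ≠ 0 := by exact_mod_cast hq.ne'
  have hA' : (A : ℂ) ≠ 0 := by exact_mod_cast hA.ne'
  have hscale : ∀ t : ℝ, (q : ℂ) * (d + t * Complex.I) =
      ((q * d : ℝ) : ℂ) + ((q * t : ℝ) : ℂ) * Complex.I := fun t => by push_cast; ring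
  constructor
  · have h1 : Complex.VerticalIntegrable (gammaRatio α) (q * d) :=
      verticalIntegrable_gammaRatio hα0 hα1 fun m h => by
        have : (0 : ℝ) ≤ m := Nat.cast_nonneg m
        linarith
    have h2 : Complex.VerticalIntegrable (fun s => gammaRatio α (q * s)) d := by
      refine (h1.comp_mul_left' hq0.ne').congr (Filter.Eventually.of_forall fun t => ?_)
      simp only [hscale]
    have h3 := (verticalIntegrable_cpow_mul h2 (inv_pos.2 hA)).const_mul (C : ℂ)
    refine h3.congr (Filter.Eventually.of_forall fun t => ?_)
    simp only
    rw [hk, Complex.ofReal_inv, Complex.inv_cpow _ _ (by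
      rw [Complex.arg_ofReal_of_nonneg hA.le]; exact Real.pi_pos.ne), Complex.cpow_neg, inv_inv,
      mul_assoc]
  · rintro x hx z rfl
    have hCc : (C : ℂ) ≠ 0 := by exact_mod_cast hC
    have hxc : (x : ℂ) ≠ 0 := by exact_mod_cast hx.ne'
    have hr : -1 < (1 - c) / α := by
      have := div_pos (sub_pos.2 hc) hα0
      linarith
    rw [levyDensity_eq_mellinInv_gammaRatio hα0 hc hx, mellinInv_gammaRatio_eq hα0 hα1 hr hd
      (Real.rpow_pos_of_pos hx _), mellinInv, mellinInv]
    have hint : ∀ t : ℝ, ((A / x ^ (α * q) : ℝ) : ℂ) ^ (-(d + t * Complex.I)) •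
        k (d + t * Complex.I) = C * (fun y : ℝ => ((x ^ (-α) : ℝ) : ℂ) ^
          (-(((q * d : ℝ) : ℂ) + y * Complex.I)) •
          gammaRatio α (((q * d : ℝ) : ℂ) + y * Complex.I)) (q * t) := by
      intro t
      simp only
      rw [← hscale, hk]
      have e1 : ((A / x ^ (α * q) : ℝ) : ℂ) ^ (-(d + t * Complex.I)) =
          ((A : ℂ) ^ (d + t * Complex.I))⁻¹ *
            ((x ^ (-α) : ℝ) : ℂ) ^ (-(q * (d + t * Complex.I))) := by
        rw [div_eq_mul_inv, ← Real.rpow_neg hx.le, Complex.ofReal_mul,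
          Complex.mul_cpow_ofReal_nonneg hA.le (by positivity), Complex.cpow_neg,
          ← Complex.cpow_mul_ofReal_nonneg hx.le, ← Complex.cpow_mul_ofReal_nonneg hx.le]
        push_cast
        ring_nf
      have hne : (A : ℂ) ^ (d + t * Complex.I) ≠ 0 := by
        rw [Complex.cpow_def_of_ne_zero hA']; exact Complex.exp_ne_zero _
      rw [e1]
      simp only [smul_eq_mul]
      field_simp
    have hm := Measure.integral_comp_mul_left (fun y : ℝ => ((x ^ (-α) : ℝ) : ℂ) ^
      (-(((q * d : ℝ) : ℂ) + y * Complex.I)) •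
      gammaRatio α (((q * d : ℝ) : ℂ) + y * Complex.I)) (q : ℝ)
    rw [integral_congr_ae (Filter.Eventually.of_forall hint), integral_const_mul, hm, abs_of_pos (inv_pos.2 hq0),
      Complex.real_smul, Complex.real_smul, Complex.real_smul]
    generalize (∫ y : ℝ, ((x ^ (-α) : ℝ) : ℂ) ^ (-(((q * d : ℝ) : ℂ) + y * Complex.I)) •
      gammaRatio α (((q * d : ℝ) : ℂ) + y * Complex.I)) = J
    push_cast
    field_simp

/-- The lower pair (1/q, 1), present since q ≥ 2, forces d > -1/q. The line Re u = qd then lies to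
the right of the first pole. -/
theorem neg_one_lt_of_isFoxHContour {q : ℕ} (hq : 2 ≤ q) {d : ℝ} {m : ℕ} {a b : List (ℂ × ℝ)}
    (hm : b.length = m) (hb : ∀ u ∈ pairRow 1 (q - 1) (fun j => (j : ℝ) / q) 1, u ∈ b)
    (h : IsFoxHContour m 0 a b d) : -1 < q * d := by
  have hmem : (((((1 : ℕ) : ℝ) / q : ℝ) : ℂ), (1 : ℝ)) ∈
      pairRow 1 (q - 1) (fun j => (j : ℝ) / q) 1 :=
    List.mem_map.2 ⟨1, by rw [List.mem_range'_1]; omega, rfl⟩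
  have := h.1 _ (by rw [List.take_of_length_le hm.le]; exact hb _ hmem)
  have hq0 : (0 : ℝ) < q := by positivity
  rw [Complex.ofReal_re, one_mul, div_add' _ _ _ hq0.ne'] at this
  have := (div_pos_iff_of_pos_right hq0).1 this
  push_cast at this
  linarith

theorem levyDensity_foxH_generic {p q : ℕ} (hp : 0 < p) (hpq : p < q) {α l c d : ℝ}
    (hα0 : 0 < α) (hα1 : α < 1) (hc : c < 1) (h : α * q = p * l) (hd : -1 < q * d) {k : ℂ → ℂ}
    (hk : ∀ s : ℂ, s.re = d → k s = (∏ j ∈ Finset.Icc 1 q, Complex.Gamma (s + j / q)) /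
        ∏ i ∈ Finset.Icc 1 p, Complex.Gamma (l * s + i / p)) :
    Complex.VerticalIntegrable k d ∧ ∀ x : ℝ, 0 < x →
      levyDensity α c x = (p * l / (gaussConst p / gaussConst q * x) : ℝ) *
        mellinInv d k ((p : ℝ) ^ (p * l) / (x ^ (p * l) * (q : ℝ) ^ q)) := by
  have hq : 0 < q := hp.trans hpq
  have hp' : (0 : ℝ) < p := by exact_mod_cast hp
  have hq' : (0 : ℝ) < q := by exact_mod_cast hq
  obtain ⟨h1, h2⟩ := levyDensity_eq_mellinInv_of_kernel (k := k) (c := c) hα0 hα1 hc hq hd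
    (div_pos (gaussConst_pos hp) (gaussConst_pos hq)).ne'
    (A := (p : ℝ) ^ (p * l) / (q : ℝ) ^ q) (by positivity) fun t => by
      rw [hk _ (by simp), prod_Gamma_div_prod_Gamma_eq hp hq h]
  refine ⟨h1, fun x hx => ?_⟩
  rw [h2 x hx _ rfl, h, div_div, mul_comm ((q : ℝ) ^ q)]

theorem sqrt_two_pi_pow_eq (n : ℕ) : √(2 * Real.pi) ^ n = (2 * Real.pi) ^ ((n : ℝ) / 2) := by
  rw [Real.sqrt_eq_rpow, ← Real.rpow_natCast, ← Real.rpow_mul (by positivity)]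
  congr 1; ring

theorem gaussConst_ratio {p q : ℕ} (hp : 0 < p) (hpq : p < q) {l x : ℝ} (hx : 0 < x) :
    p * l / (gaussConst p / gaussConst q * x) =
      l * √((p : ℝ) * q) / (x * (2 * Real.pi) ^ (((q : ℝ) - p) / 2)) := by
  have hp' : (0 : ℝ) < p := by exact_mod_cast hp
  have hq' : (0 : ℝ) < q := by exact_mod_cast hp.trans hpq
  have e : ((q : ℝ) - p) / 2 = ((q - p : ℕ) : ℝ) / 2 := by rw [Nat.cast_sub hpq.le]
  rw [e, ← sqrt_two_pi_pow_eq, gaussConst, gaussConst, Real.sqrt_mul hp'.le]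
  have hs : q - 1 = (q - p) + (p - 1) := by omega
  have h2 : 0 < √(2 * Real.pi) := Real.sqrt_pos.2 (mul_pos two_pos Real.pi_pos)
  have h3 : 0 < √(p : ℝ) := Real.sqrt_pos.2 hp'
  have h4 : (p : ℝ) = √(p : ℝ) * √(p : ℝ) := (Real.mul_self_sqrt hp'.le).symm
  rw [hs, pow_add]
  field_simp
  rw [sq, ← h4, mul_comm]

theorem levyDensity_foxH {p q : ℕ} (hp : 0 < p) (hpq : p < q) {α l c d : ℝ}
    (hα0 : 0 < α) (hα1 : α < 1) (hc : c < 1) (h : α * q = p * l)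
    (hd : IsFoxHContour q 0
      (((1 : ℂ), l) :: pairRow 1 (p - 1) (fun i => (i : ℝ) / p) l)
      (((1 : ℂ), (1 : ℝ)) :: pairRow 1 (q - 1) (fun j => (j : ℝ) / q) 1) d) :
    Complex.VerticalIntegrable (foxHKernel q 0
      (((1 : ℂ), l) :: pairRow 1 (p - 1) (fun i => (i : ℝ) / p) l)
      (((1 : ℂ), (1 : ℝ)) :: pairRow 1 (q - 1) (fun j => (j : ℝ) / q) 1)) d ∧
    ∀ x : ℝ, 0 < x →
      levyDensity α c x =
        ((l * √((p : ℝ) * q) / (x * (2 * Real.pi) ^ (((q : ℝ) - p) / 2)) : ℝ) : ℂ) *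
          foxH q 0
            (((1 : ℂ), l) :: pairRow 1 (p - 1) (fun i => (i : ℝ) / p) l)
            (((1 : ℂ), (1 : ℝ)) :: pairRow 1 (q - 1) (fun j => (j : ℝ) / q) 1) d
            ((p : ℝ) ^ (p * l) / (x ^ (p * l) * (q : ℝ) ^ q)) := by
  have hq : 0 < q := hp.trans hpq
  have hlen : (((1 : ℂ), (1 : ℝ)) :: pairRow 1 (q - 1) (fun j => (j : ℝ) / q) 1).length = q := by
    rw [List.length_cons, length_pairRow]; omega
  have hd' := neg_one_lt_of_isFoxHContour (by omega) hlen (fun u hu => List.mem_cons_of_mem _ hu) hd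
  obtain ⟨h1, h2⟩ := levyDensity_foxH_generic hp hpq hα0 hα1 hc h hd' (k := foxHKernel q 0
      (((1 : ℂ), l) :: pairRow 1 (p - 1) (fun i => (i : ℝ) / p) l)
      (((1 : ℂ), (1 : ℝ)) :: pairRow 1 (q - 1) (fun j => (j : ℝ) / q) 1)) fun s _ => by
    have hqc : (q : ℂ) ≠ 0 := by exact_mod_cast hq.ne'
    have hpc : (p : ℂ) ≠ 0 := by exact_mod_cast hp.ne'
    rw [foxHKernel_zero_of_length hlen, List.map_cons, List.prod_cons, List.map_cons,
      List.prod_cons, prod_map_pairRow, prod_map_pairRow, ← prod_Icc_pred_mul _ hq,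
      ← prod_Icc_pred_mul _ hp, div_self hqc, div_self hpc]
    push_cast
    simp only [one_mul, add_comm s, add_comm ((l : ℂ) * s)]
    rw [mul_comm (Complex.Gamma (1 + s)), mul_comm (Complex.Gamma (1 + l * s))]
  refine ⟨h1, fun x hx => ?_⟩
  rw [h2 x hx, gaussConst_ratio hp hpq hx, foxH]

/-- For l = 1 the factors j = q and i = p are both Γ(s+1). They cancel because d > -1 keeps s+1 in
the right half-plane. -/
theorem levyDensity_foxH_one {p q : ℕ} (hp : 0 < p) (hpq : p < q) {α c d : ℝ}
    (hα0 : 0 < α) (hα1 : α < 1) (hc : c < 1) (h : α * q = p)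
    (hd : IsFoxHContour (q - 1) 0
      (pairRow 1 (p - 1) (fun i => (i : ℝ) / p) 1)
      (pairRow 1 (q - 1) (fun j => (j : ℝ) / q) 1) d) :
    Complex.VerticalIntegrable (foxHKernel (q - 1) 0
      (pairRow 1 (p - 1) (fun i => (i : ℝ) / p) 1)
      (pairRow 1 (q - 1) (fun j => (j : ℝ) / q) 1)) d ∧
    ∀ x : ℝ, 0 < x →
      levyDensity α c x =
        ((√((p : ℝ) * q) / (x * (2 * Real.pi) ^ (((q : ℝ) - p) / 2)) : ℝ) : ℂ) *
          foxH (q - 1) 0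
            (pairRow 1 (p - 1) (fun i => (i : ℝ) / p) 1)
            (pairRow 1 (q - 1) (fun j => (j : ℝ) / q) 1) d
            ((p : ℝ) ^ p / (x ^ p * (q : ℝ) ^ q)) := by
  have hq : 0 < q := hp.trans hpq
  have hq' : (0 : ℝ) < q := by exact_mod_cast hq
  have hlen : (pairRow 1 (q - 1) (fun j => (j : ℝ) / q) 1).length = q - 1 := by
    rw [length_pairRow]; omega
  have hd' := neg_one_lt_of_isFoxHContour (by omega) hlen (fun u hu => hu) hd
  have hd1 : -1 < d := by
    have : (1 : ℝ) ≤ q := by exact_mod_cast hq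
    by_contra! hcon
    nlinarith
  obtain ⟨h1, h2⟩ := levyDensity_foxH_generic hp hpq hα0 hα1 hc (l := 1) (by rw [h, mul_one]) hd'
      (k := foxHKernel (q - 1) 0 (pairRow 1 (p - 1) (fun i => (i : ℝ) / p) 1)
      (pairRow 1 (q - 1) (fun j => (j : ℝ) / q) 1)) fun s hs => by
    have hqc : (q : ℂ) ≠ 0 := by exact_mod_cast hq.ne'
    have hpc : (p : ℂ) ≠ 0 := by exact_mod_cast hp.ne'
    have hΓ : Complex.Gamma (s + 1) ≠ 0 := Complex.Gamma_ne_zero_of_re_pos (by simp [hs]; linarith)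
    rw [foxHKernel_zero_of_length hlen, prod_map_pairRow, prod_map_pairRow,
      ← prod_Icc_pred_mul _ hq, ← prod_Icc_pred_mul _ hp, div_self hqc, div_self hpc,
      Complex.ofReal_one, one_mul, mul_div_mul_right _ _ hΓ]
    push_cast
    simp only [add_comm s, one_mul]
  refine ⟨h1, fun x hx => ?_⟩
  rw [h2 x hx, gaussConst_ratio hp hpq hx, foxH, one_mul, mul_one, Real.rpow_natCast,
    Real.rpow_natCast]

theorem gaussConst_ratio_nat {p q k : ℕ} (hp : 0 < p) (hk : 0 < k) {l x : ℝ} (hl : l = k)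
    (hx : 0 < x) :
    l * √((p : ℝ) * q) / (x * (2 * Real.pi) ^ (((q : ℝ) - p) / 2)) / gaussConst k =
      √((p : ℝ) * q * l) / (x * (2 * Real.pi) ^ (((q : ℝ) + 1 - p - l) / 2)) := by
  have hk' : (0 : ℝ) < k := by exact_mod_cast hk
  rw [hl]
  have e : (2 * Real.pi) ^ (((q : ℝ) + 1 - p - k) / 2) * √(2 * Real.pi) ^ (k - 1) =
      (2 * Real.pi) ^ (((q : ℝ) - p) / 2) := by
    rw [sqrt_two_pi_pow_eq, ← Real.rpow_add (by positivity), Nat.cast_sub hk]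
    congr 1; push_cast; ring
  have h2 : 0 < √(2 * Real.pi) := Real.sqrt_pos.2 (mul_pos two_pos Real.pi_pos)
  have hsk : (k : ℝ) = √(k : ℝ) ^ 2 := (Real.sq_sqrt hk'.le).symm
  have hsk0 : 0 < √(k : ℝ) := Real.sqrt_pos.2 hk'
  rw [← e, gaussConst, Real.sqrt_mul (by positivity) (k : ℝ)]
  have h5 : 0 < (2 * Real.pi) ^ (((q : ℝ) + 1 - p - k) / 2) :=
    Real.rpow_pos_of_pos (by positivity) _
  field_simp
  rw [← hsk, mul_comm]

/-- The factor i = p of the denominator is Γ(1+ks). Gauss's formula splits it, and its own last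
factor Γ(s+1) cancels against j = q. -/
theorem foxHKernel_nat_eq {p q k : ℕ} (hp : 0 < p) (hq : 0 < q) (hk : 0 < k) {α l : ℝ}
    (h : α * q = p * l) (hl : l = k) {s : ℂ} (hs : -1 < s.re) :
    foxHKernel (q - 1) 0
      (pairRow 1 (k - 1) (fun i => (i : ℝ) / l) 1 ++ pairRow 1 (p - 1) (fun i => (i : ℝ) / p) l)
      (pairRow 1 (q - 1) (fun j => (j : ℝ) / q) 1) s =
    ((gaussConst k * (gaussConst p / gaussConst q) : ℝ) : ℂ) *
      (((p : ℝ) ^ (p * l) / (q : ℝ) ^ q * (k : ℝ) ^ (k : ℝ) : ℝ) : ℂ) ^ s *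
        gammaRatio α (q * s) := by
  have hlen : (pairRow 1 (q - 1) (fun j => (j : ℝ) / q) 1).length = q - 1 := by
    rw [length_pairRow]; omega
  have hqc : (q : ℂ) ≠ 0 := by exact_mod_cast hq.ne'
  have hpc : (p : ℂ) ≠ 0 := by exact_mod_cast hp.ne'
  have hkc : (k : ℂ) ≠ 0 := by exact_mod_cast hk.ne'
  have hck : ((gaussConst k : ℝ) : ℂ) ≠ 0 := by exact_mod_cast (gaussConst_pos hk).ne'
  have hΓ : Complex.Gamma (s + 1) ≠ 0 := Complex.Gamma_ne_zero_of_re_pos (by simp; linarith)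
  have hX : (k : ℂ) ^ (k * s) ≠ 0 := by
    rw [Complex.cpow_def_of_ne_zero hkc]; exact Complex.exp_ne_zero _
  have key := prod_Gamma_div_prod_Gamma_eq hp hq h s
  have hlk : (l : ℂ) = k := by rw [hl]; simp
  rw [← prod_Icc_pred_mul _ hq, ← prod_Icc_pred_mul _ hp, div_self hqc, div_self hpc, hlk,
    add_comm ((k : ℂ) * s) 1, Gamma_one_add_nat_mul k hk, ← prod_Icc_pred_mul _ hk, div_self hkc,
    ← gaussConst] at key
  have hpow : (((p : ℝ) ^ (p * l) / (q : ℝ) ^ q * (k : ℝ) ^ (k : ℝ) : ℝ) : ℂ) ^ s =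
      (((p : ℝ) ^ (p * l) / (q : ℝ) ^ q : ℝ) : ℂ) ^ s * (k : ℂ) ^ (k * s) := by
    rw [Complex.ofReal_mul, Complex.mul_cpow_ofReal_nonneg (by positivity) (by positivity),
      ← Complex.cpow_mul_ofReal_nonneg (Nat.cast_nonneg k)]
    simp
  rw [hpow, Complex.ofReal_mul (gaussConst k), show ((gaussConst k : ℝ) : ℂ) *
    ((gaussConst p / gaussConst q : ℝ) : ℂ) * ((((p : ℝ) ^ (p * l) / (q : ℝ) ^ q : ℝ) : ℂ) ^ s *
    (k : ℂ) ^ (k * s)) * gammaRatio α (q * s) = (gaussConst k : ℝ) * (k : ℂ) ^ (k * s) *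
    (((gaussConst p / gaussConst q : ℝ) : ℂ) * (((p : ℝ) ^ (p * l) / (q : ℝ) ^ q : ℝ) : ℂ) ^ s *
      gammaRatio α (q * s)) by ring, ← key, foxHKernel_zero_of_length hlen, List.map_append,
    List.prod_append, prod_map_pairRow, prod_map_pairRow, prod_map_pairRow]
  simp only [Complex.ofReal_div, Complex.ofReal_natCast, Complex.ofReal_one, one_mul, hlk,
    add_comm s, add_comm ((k : ℂ) * s)]
  rw [add_comm s] at hΓ
  set W := ∏ i ∈ Finset.Icc 1 (k - 1), Complex.Gamma (i / k + s)
  set Y := ∏ i ∈ Finset.Icc 1 (p - 1), Complex.Gamma (i / p + k * s)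
  set X := ∏ i ∈ Finset.Icc 1 (q - 1), Complex.Gamma (i / q + s)
  simp only [div_eq_mul_inv, mul_inv]
  field_simp

theorem levyDensity_foxH_nat {p q k : ℕ} (hp : 0 < p) (hpq : p < q) (hk : 0 < k) {α l c d : ℝ}
    (hα0 : 0 < α) (hα1 : α < 1) (hc : c < 1) (h : α * q = p * l) (hl : l = k)
    (hd : IsFoxHContour (q - 1) 0
      (pairRow 1 (k - 1) (fun i => (i : ℝ) / l) 1 ++ pairRow 1 (p - 1) (fun i => (i : ℝ) / p) l)
      (pairRow 1 (q - 1) (fun j => (j : ℝ) / q) 1) d) :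
    Complex.VerticalIntegrable (foxHKernel (q - 1) 0
      (pairRow 1 (k - 1) (fun i => (i : ℝ) / l) 1 ++ pairRow 1 (p - 1) (fun i => (i : ℝ) / p) l)
      (pairRow 1 (q - 1) (fun j => (j : ℝ) / q) 1)) d ∧
    ∀ x : ℝ, 0 < x →
      levyDensity α c x =
        ((√((p : ℝ) * q * l) / (x * (2 * Real.pi) ^ (((q : ℝ) + 1 - p - l) / 2)) : ℝ) : ℂ) *
          foxH (q - 1) 0
            (pairRow 1 (k - 1) (fun i => (i : ℝ) / l) 1 ++
              pairRow 1 (p - 1) (fun i => (i : ℝ) / p) l)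
            (pairRow 1 (q - 1) (fun j => (j : ℝ) / q) 1) d
            ((p : ℝ) ^ (p * l) * l ^ l / (x ^ (p * l) * (q : ℝ) ^ q)) := by
  have hq : 0 < q := hp.trans hpq
  have hp' : (0 : ℝ) < p := by exact_mod_cast hp
  have hq' : (0 : ℝ) < q := by exact_mod_cast hq
  have hk' : (0 : ℝ) < k := by exact_mod_cast hk
  have hlen : (pairRow 1 (q - 1) (fun j => (j : ℝ) / q) 1).length = q - 1 := by
    rw [length_pairRow]; omega
  have hd' := neg_one_lt_of_isFoxHContour (by omega) hlen (fun u hu => hu) hd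
  have hd1 : -1 < d := by
    have : (1 : ℝ) ≤ q := by exact_mod_cast hq
    by_contra! hcon
    nlinarith
  obtain ⟨h1, h2⟩ := levyDensity_eq_mellinInv_of_kernel (c := c)
    (k := foxHKernel (q - 1) 0 (pairRow 1 (k - 1) (fun i => (i : ℝ) / l) 1 ++
      pairRow 1 (p - 1) (fun i => (i : ℝ) / p) l) (pairRow 1 (q - 1) (fun j => (j : ℝ) / q) 1))
    hα0 hα1 hc hq hd'
    (C := gaussConst k * (gaussConst p / gaussConst q))
    (mul_pos (gaussConst_pos hk) (div_pos (gaussConst_pos hp) (gaussConst_pos hq))).ne'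
    (A := (p : ℝ) ^ (p * l) / (q : ℝ) ^ q * (k : ℝ) ^ (k : ℝ)) (by positivity) fun t => by
      exact foxHKernel_nat_eq hp hq hk h hl (by simpa using hd1)
  refine ⟨h1, fun x hx => ?_⟩
  rw [h2 x hx _ rfl, foxH, h]
  congr 2
  · rw [mul_assoc, mul_comm (gaussConst k), ← div_div, gaussConst_ratio hp hpq hx,
      gaussConst_ratio_nat hp hk hl hx]
  · rw [hl]
    field_simp

/-! ### Gauss's formula at the poles -/

open Filter Topology in
theorem tendsto_mul_Gamma_sub_nat (n : ℕ) :
    Tendsto (fun w : ℂ => w * Complex.Gamma (w - n)) (𝓝[≠] 0) (𝓝 ((-1) ^ n / n.factorial)) := by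
  have hprod : ∏ j ∈ Finset.range n, ((0 : ℂ) - n + j) = (-1) ^ n * n.factorial := by
    rw [← prod_range_sub_eq]
    exact Finset.prod_congr rfl fun j _ => by ring
  have hfac : ((n.factorial : ℕ) : ℂ) ≠ 0 := by exact_mod_cast n.factorial_ne_zero
  have h1 : ContinuousAt (fun w : ℂ => Complex.Gamma (w + 1) /
      ∏ j ∈ Finset.range n, (w - n + j)) 0 := by
    refine ContinuousAt.div ?_ (by fun_prop) ?_
    · refine ContinuousAt.comp (f := fun w : ℂ => w + 1) ?_ (by fun_prop)
      rw [zero_add]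
      exact Complex.continuousAt_Gamma_one
    · rw [hprod]
      exact mul_ne_zero (pow_ne_zero _ (by norm_num)) hfac
  have hval : Complex.Gamma (0 + 1) / ∏ j ∈ Finset.range n, ((0 : ℂ) - n + j) =
      (-1) ^ n / n.factorial := by
    rw [hprod, zero_add, Complex.Gamma_one, ← div_div, one_div, ← inv_pow]
    norm_num
  have h2 := h1.tendsto
  rw [hval] at h2
  refine (h2.mono_left nhdsWithin_le_nhds).congr' ?_
  filter_upwards [self_mem_nhdsWithin] with w hw
  have hw : w ≠ 0 := hw
  rw [Gamma_eq_Gamma_add_nat_div (w - n) (n + 1), Finset.prod_range_succ]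
  push_cast
  rw [show w - n + (n + 1) = w + 1 by ring, sub_add_cancel]
  field_simp

/-- A pole would make q divide i-j, although 0 < |i-j| < q. So only one factor of Gauss's product is
singular at a time. -/
theorem nat_sub_div_sub_ne {q i j : ℕ} (hi : i ∈ Finset.Icc 1 q) (hj : j ∈ Finset.Icc 1 q)
    (hij : i ≠ j) (n m : ℕ) : (((((i : ℝ) - j) / q : ℝ) : ℂ) + ((-1 : ℝ) : ℂ) * n) ≠ -m := by
  rw [Finset.mem_Icc] at hi hj
  intro h
  have hq : (q : ℝ) ≠ 0 := by
    have : 0 < q := by omega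
    exact_mod_cast this.ne'
  have h1 : ((i : ℝ) - j) / q + (-1) * n = -m := by exact_mod_cast h
  field_simp at h1
  have h2 : (i : ℤ) - j = q * (n - m) := by
    have : (i : ℝ) - j = q * (n - m) := by linarith
    exact_mod_cast this
  have h3 : |(i : ℤ) - j| < q := by rw [abs_lt]; omega
  have h4 := Int.eq_zero_of_abs_lt_dvd ⟨_, h2⟩ h3
  omega

open Filter Topology in
/-- The residue form of Gauss's multiplication formula. -/
theorem neg_one_pow_div_factorial_eq {q n j m : ℕ} (hj : j ∈ Finset.Icc 1 q)
    (hm : m + 1 = q * n + j) :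
    ((-1) ^ m / m.factorial : ℂ) = ((q : ℂ) ^ (m + 1))⁻¹ * gaussConst q *
      (q * ((-1) ^ n / n.factorial)) * ∏ i ∈ (Finset.Icc 1 q).erase j,
        Complex.Gamma (((((i : ℝ) - j) / q : ℝ) : ℂ) + ((-1 : ℝ) : ℂ) * n) := by
  have hq : 0 < q := by rw [Finset.mem_Icc] at hj; omega
  have hqc : (q : ℂ) ≠ 0 := by exact_mod_cast hq.ne'
  have hm' : (m : ℂ) + 1 = q * n + j := by exact_mod_cast hm
  -- Gauss's formula for Γ(w-m) is multiplied by w and w tends to 0. The left side gives the residue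
  -- at -m, the j-th factor Γ(w/q-n) gives q times the residue at -n, and the other factors are
  -- continuous.
  have hL := tendsto_mul_Gamma_sub_nat m
  have hscale : Tendsto (fun w : ℂ => w / q) (𝓝[≠] 0) (𝓝[≠] 0) := by
    refine tendsto_nhdsWithin_iff.2 ⟨?_, ?_⟩
    · have : Tendsto (fun w : ℂ => w / q) (𝓝 0) (𝓝 (0 / q)) := tendsto_id.div_const _
      rw [zero_div] at this
      exact this.mono_left nhdsWithin_le_nhds
    · filter_upwards [self_mem_nhdsWithin] with w hw
      exact div_ne_zero hw hqc
  have h1 := ((tendsto_mul_Gamma_sub_nat n).comp hscale).const_mul (q : ℂ)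
  have h2 : Tendsto (fun w : ℂ => (q : ℂ) ^ (w - (m + 1))) (𝓝[≠] 0)
      (𝓝 (((q : ℂ) ^ (m + 1))⁻¹)) := by
    have : ContinuousAt (fun w : ℂ => (q : ℂ) ^ (w - (m + 1))) 0 :=
      ContinuousAt.const_cpow (by fun_prop) (Or.inl hqc)
    have h := this.tendsto
    rw [zero_sub, Complex.cpow_neg, show (m : ℂ) + 1 = ((m + 1 : ℕ) : ℂ) by push_cast; rfl,
      Complex.cpow_natCast] at h
    push_cast at h
    exact h.mono_left nhdsWithin_le_nhds
  have h3 : Tendsto (fun w : ℂ => ∏ i ∈ (Finset.Icc 1 q).erase j,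
      Complex.Gamma (w / q + (((((i : ℝ) - j) / q : ℝ) : ℂ) + ((-1 : ℝ) : ℂ) * n))) (𝓝[≠] 0)
      (𝓝 (∏ i ∈ (Finset.Icc 1 q).erase j,
        Complex.Gamma (((((i : ℝ) - j) / q : ℝ) : ℂ) + ((-1 : ℝ) : ℂ) * n))) := by
    refine tendsto_finsetProd _ fun i hi => ?_
    rw [Finset.mem_erase] at hi
    have hc : ContinuousAt (fun w : ℂ =>
        Complex.Gamma (w / q + (((((i : ℝ) - j) / q : ℝ) : ℂ) + ((-1 : ℝ) : ℂ) * n))) 0 := by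
      refine ContinuousAt.comp (f := fun w : ℂ => w / q + (((((i : ℝ) - j) / q : ℝ) : ℂ) +
        ((-1 : ℝ) : ℂ) * n)) ?_ (by fun_prop)
      rw [zero_div, zero_add]
      exact Complex.continuousAt_Gamma _ (nat_sub_div_sub_ne hi.2 hj hi.1 n)
    have h := hc.tendsto
    rw [zero_div, zero_add] at h
    exact h.mono_left nhdsWithin_le_nhds
  refine tendsto_nhds_unique hL (((h2.mul_const (gaussConst q : ℂ)).mul h1 |>.mul h3).congr ?_)
  intro w
  have hg := Gamma_one_add_nat_mul q hq ((w - (m + 1)) / q)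
  have e0 : (1 : ℂ) + q * ((w - (m + 1)) / q) = w - m := by field_simp; ring
  rw [e0, mul_div_cancel₀ _ hqc, ← gaussConst, ← Finset.mul_prod_erase _ _ hj] at hg
  rw [hg]
  have e1 : (w - (m + 1)) / q + j / q = w / q - n := by
    rw [hm']; field_simp; ring
  have e2 : ∀ i : ℕ, (w - (m + 1)) / q + i / q =
      w / q + (((((i : ℝ) - j) / q : ℝ) : ℂ) + ((-1 : ℝ) : ℂ) * n) := by
    intro i
    rw [hm']; push_cast; field_simp; ring
  rw [e1]
  simp_rw [e2]
  simp only [Function.comp_apply]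
  field_simp

/-! ### The residue series split modulo q -/

/-- The `n`-th term of the `j`-th residue class of the series of the Lévy density. -/
noncomputable def levyTerm (p q : ℕ) (l z : ℝ) (j n : ℕ) : ℂ :=
  (∏ i ∈ (Finset.Icc 1 q).erase j,
      Complex.Gamma (((((i : ℝ) - j) / q : ℝ) : ℂ) + ((-1 : ℝ) : ℂ) * n)) /
    ((∏ i ∈ Finset.Icc 1 p,
      Complex.Gamma ((((i : ℝ) / p - l * j / q : ℝ) : ℂ) + ((-l : ℝ) : ℂ) * n)) *
        (n.factorial : ℂ)) * ((-z : ℝ) : ℂ) ^ n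

theorem levyArg_rpow {p q : ℕ} (hp : 0 < p) (hq : 0 < q) (l : ℝ) {x : ℝ} (hx : 0 < x) (r : ℝ) :
    ((p : ℝ) ^ (p * l) / (x ^ (p * l) * (q : ℝ) ^ q)) ^ r =
      (p : ℝ) ^ (r * l * p) / (x ^ (r * l * p) * (q : ℝ) ^ (q * r)) := by
  have hp' : (0 : ℝ) < p := by exact_mod_cast hp
  have hq' : (0 : ℝ) < q := by exact_mod_cast hq
  rw [Real.div_rpow (by positivity) (by positivity), Real.mul_rpow (by positivity) (by positivity),
    ← Real.rpow_mul hp'.le, ← Real.rpow_mul hx.le, ← Real.rpow_natCast, ← Real.rpow_mul hq'.le]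
  ring_nf

theorem levyArg_rpow_mul_pow {p q n j m : ℕ} (hp : 0 < p) (hq : 0 < q)
    (hm : m + 1 = q * n + j) {α l x : ℝ} (h : α * q = p * l) (hx : 0 < x) :
    ((p : ℝ) ^ (p * l) / (x ^ (p * l) * (q : ℝ) ^ q)) ^ ((j : ℝ) / q) *
      ((p : ℝ) ^ (p * l) / (x ^ (p * l) * (q : ℝ) ^ q)) ^ n =
      ((q : ℝ) ^ (m + 1))⁻¹ * (x ^ (-α)) ^ (m + 1) *
        ((p : ℝ) ^ (p * (-(l * (m + 1) / q))))⁻¹ := by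
  have hp' : (0 : ℝ) < p := by exact_mod_cast hp
  have hq' : (0 : ℝ) < q := by exact_mod_cast hq
  have hm' : (m : ℝ) + 1 = q * n + j := by exact_mod_cast hm
  have hα : α = p * l / q := by field_simp; linarith
  rw [← Real.rpow_natCast _ n, ← Real.rpow_add (by positivity), levyArg_rpow hp hq l hx,
    ← Real.rpow_natCast (x ^ (-α)), ← Real.rpow_mul hx.le, ← Real.rpow_neg hp'.le, hα]
  have e1 : ((j : ℝ) / q + n) * l * p = p * l * (m + 1) / q := by rw [hm']; field_simp; ring
  have e2 : (q : ℝ) * ((j : ℝ) / q + n) = ((m + 1 : ℕ) : ℝ) := by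
    push_cast; rw [hm']; field_simp; ring
  have e3 : -((p : ℝ) * l / q) * ((m + 1 : ℕ) : ℝ) = -(p * l * (m + 1) / q) := by
    push_cast; ring
  have e4 : -((p : ℝ) * (-(l * (m + 1) / q))) = p * l * (m + 1) / q := by ring
  rw [e1, e2, e3, e4, Real.rpow_natCast, Real.rpow_neg hx.le]
  field_simp

theorem Gamma_one_sub_mul_succ_eq {p q n j m : ℕ} (hp : 0 < p) (hq : 0 < q)
    (hm : m + 1 = q * n + j) {α l : ℝ} (h : α * q = p * l) :
    Complex.Gamma (1 - α * (m + 1)) = (((p : ℝ) ^ (p * (-(l * (m + 1) / q))) : ℝ) : ℂ) *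
      gaussConst p * ∏ i ∈ Finset.Icc 1 p,
        Complex.Gamma ((((i : ℝ) / p - l * j / q : ℝ) : ℂ) + ((-l : ℝ) : ℂ) * n) := by
  have hqc : (q : ℂ) ≠ 0 := by exact_mod_cast hq.ne'
  have hpc : (p : ℂ) ≠ 0 := by exact_mod_cast hp.ne'
  have hp' : (0 : ℝ) < p := by exact_mod_cast hp
  have hmc : (m : ℂ) + 1 = q * n + j := by exact_mod_cast hm
  have hα : (α : ℂ) = p * l / q := by
    rw [eq_div_iff hqc]; exact_mod_cast h
  have e0 : (1 : ℂ) - α * (m + 1) = 1 + p * ((-(l * (m + 1) / q) : ℝ) : ℂ) := by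
    rw [hα]; push_cast; field_simp; ring
  rw [e0, Gamma_one_add_nat_mul p hp, ← gaussConst, Complex.ofReal_cpow hp'.le]
  push_cast
  congr 1
  refine Finset.prod_congr rfl fun i _ => ?_
  congr 1
  rw [hmc]; field_simp; ring

/-- Gauss's formula acts on 1/m! in its residue form and on 1/Γ(1-α(m+1)) directly. The powers of p,
q and x so produced combine to z^(j/q+n). -/
theorem gammaRatioResidue_eq_levyTerm {p q n j m : ℕ} (hp : 0 < p) (hj : j ∈ Finset.Icc 1 q)
    (hm : m + 1 = q * n + j) {α l x z : ℝ} (h : α * q = p * l) (hx : 0 < x)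
    (hz : z = (p : ℝ) ^ (p * l) / (x ^ (p * l) * (q : ℝ) ^ q)) :
    gammaRatioResidue α (x ^ (-α)) m = (q * (gaussConst q / gaussConst p) : ℝ) *
      (((z ^ ((j : ℝ) / q) : ℝ) : ℂ) * levyTerm p q l z j n) := by
  have hq : 0 < q := by rw [Finset.mem_Icc] at hj; omega
  have hpow := levyArg_rpow_mul_pow hp hq hm h hx
  rw [← hz] at hpow
  rw [gammaRatioResidue, neg_one_pow_div_factorial_eq hj hm,
    Gamma_one_sub_mul_succ_eq hp hq hm h, levyTerm]
  generalize (∏ i ∈ Finset.Icc 1 p,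
    Complex.Gamma ((((i : ℝ) / p - l * j / q : ℝ) : ℂ) + ((-l : ℝ) : ℂ) * n)) = P
  generalize (∏ i ∈ (Finset.Icc 1 q).erase j,
    Complex.Gamma (((((i : ℝ) - j) / q : ℝ) : ℂ) + ((-1 : ℝ) : ℂ) * n)) = Q
  generalize z ^ ((j : ℝ) / q) = Z at hpow ⊢
  generalize (p : ℝ) ^ (p * (-(l * (m + 1) / q))) = X at hpow ⊢
  generalize x ^ (-α) = Y at hpow ⊢
  have hpow' := congrArg (fun r : ℝ => (r : ℂ)) hpow
  push_cast at hpow' ⊢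
  rw [neg_pow]
  linear_combination (-(q * ((gaussConst q : ℂ) / gaussConst p) *
    (Q / (P * n.factorial) * (-1) ^ n))) * hpow'

open Filter Topology in
theorem HasSum.eq_sum_tsum_residue_class {f : ℕ → ℂ} {S : ℂ} (hf : HasSum f S) {q : ℕ}
    (hq : 0 < q) : S = ∑ j ∈ Finset.range q, ∑' n : ℕ, f (q * n + j) := by
  have h1 := hf.tendsto_sum_nat.comp (tendsto_id.const_mul_atTop' hq)
  have h2 : Tendsto (fun m : ℕ => ∑ j ∈ Finset.range q, ∑ n ∈ Finset.range m, f (q * n + j)) atTop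
      (𝓝 (∑ j ∈ Finset.range q, ∑' n : ℕ, f (q * n + j))) :=
    tendsto_finsetSum _ fun j _ => (hf.summable.comp_injective
      (i := fun n : ℕ => q * n + j) fun a b hab => by
        simpa [hq.ne'] using hab).hasSum.tendsto_sum_nat
  refine tendsto_nhds_unique h1 (h2.congr fun m => ?_)
  simp only [Function.comp_apply, id]
  rw [sum_range_mul_eq]

/-- The expansion behind all three series formulas. Each class is a subfamily of one summable
family, so its summability is inherited. -/
theorem levyDensity_eq_sum_levyTerm {p q : ℕ} (hp : 0 < p) (hpq : p < q) {α l c x : ℝ}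
    (hα0 : 0 < α) (hα1 : α < 1) (hc : c < 1) (h : α * q = p * l) (hx : 0 < x) {z : ℝ}
    (hz : z = (p : ℝ) ^ (p * l) / (x ^ (p * l) * (q : ℝ) ^ q)) :
    (∀ j ∈ Finset.Icc 1 q, Summable (levyTerm p q l z j)) ∧
    levyDensity α c x =
      ((l * √((p : ℝ) * q) / (x * (2 * Real.pi) ^ (((q : ℝ) - p) / 2)) : ℝ) : ℂ) *
        ∑ j ∈ Finset.Icc 1 q, ((z ^ ((j : ℝ) / q) : ℝ) : ℂ) * ∑' n, levyTerm p q l z j n := by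
  have hq : 0 < q := hp.trans hpq
  have hp' : (0 : ℝ) < p := by exact_mod_cast hp
  have hq' : (0 : ℝ) < q := by exact_mod_cast hq
  have hz0 : 0 < z := by rw [hz]; positivity
  have hr : -1 < (1 - c) / α := by
    have := div_pos (sub_pos.2 hc) hα0
    linarith
  have hs := hasSum_mellinInv_gammaRatio hα0 hα1 hr (Real.rpow_pos_of_pos hx (-α))
  have hcq := gaussConst_pos hq
  have hcp := gaussConst_pos hp
  -- The residue of index m sits at u = -(m+1), so the remainder j of m corresponds to the class
  -- j+1.
  have hterm : ∀ j n, j ∈ Finset.range q → gammaRatioResidue α (x ^ (-α)) (q * n + j) =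
      (q * (gaussConst q / gaussConst p) : ℝ) * (((z ^ (((j + 1 : ℕ) : ℝ) / q) : ℝ) : ℂ) *
        levyTerm p q l z (j + 1) n) := by
    intro j n hj
    exact gammaRatioResidue_eq_levyTerm hp (by simp at hj ⊢; omega) (by ring) h hx hz
  constructor
  · intro j hj
    obtain ⟨i, rfl⟩ : ∃ i, j = i + 1 := ⟨j - 1, by rw [Finset.mem_Icc] at hj; omega⟩
    have hi : i ∈ Finset.range q := by simp at hj ⊢; omega
    have h1 := hs.summable.comp_injective (i := fun n : ℕ => q * n + i) fun a b hab => by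
      simpa [hq.ne'] using hab
    have h2 : (gammaRatioResidue α (x ^ (-α))) ∘ (fun n : ℕ => q * n + i) =
        fun n => ((q * (gaussConst q / gaussConst p) : ℝ) : ℂ) *
          (((z ^ (((i + 1 : ℕ) : ℝ) / q) : ℝ) : ℂ) * levyTerm p q l z (i + 1) n) :=
      funext fun n => hterm i n hi
    rw [h2, summable_mul_left_iff, summable_mul_left_iff] at h1
    · exact h1
    · exact_mod_cast (Real.rpow_pos_of_pos hz0 _).ne'
    · have : 0 < q * (gaussConst q / gaussConst p) := by positivity
      exact_mod_cast this.ne'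
  · rw [levyDensity_eq_mellinInv_gammaRatio hα0 hc hx, hs.eq_sum_tsum_residue_class hq,
      ← gaussConst_ratio hp hpq hx, Finset.sum_congr rfl fun j hj => by
        rw [tsum_congr fun n => hterm j n hj, tsum_mul_left, tsum_mul_left], ← Finset.mul_sum,
      ← mul_assoc, ← Complex.ofReal_mul]
    congr 1
    · congr 1
      rw [← h]
      field_simp
    · have := Finset.sum_Ico_eq_sum_range (fun j : ℕ => ((z ^ ((j : ℝ) / q) : ℝ) : ℂ) *
        ∑' n, levyTerm p q l z j n) 1 (q + 1)
      simp only [add_tsub_cancel_right, add_comm 1] at this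
      exact this.symm

/-! ### Matching with Wright and hypergeometric parameters -/

/-- For i > j the argument is (i-j)/q, and for i ≤ j it is ((i-1)-j)/q. Thus i = 2, ..., q-1 runs
through 1, ..., q-1 without j, and the extra factor is the index q. -/
theorem prod_levyJump_mul {M : Type*} [CommMonoid M] {j q : ℕ} (hj : j ∈ Finset.Icc 1 (q - 1))
    (F : ℝ → M) :
    (∏ i ∈ Finset.Icc 2 (q - 1), F ((i : ℝ) / q - levyJump j q i)) * F (1 - (j : ℝ) / q) =
      ∏ i ∈ (Finset.Icc 1 q).erase j, F (((i : ℝ) - j) / q) := by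
  rw [Finset.mem_Icc] at hj
  have hq0 : (q : ℝ) ≠ 0 := by
    have : 0 < q := by omega
    exact_mod_cast this.ne'
  have hqm : q ∈ (Finset.Icc 1 q).erase j := by simp; omega
  rw [← Finset.mul_prod_erase _ _ hqm, mul_comm]
  congr 1
  · congr 1; field_simp
  · refine Finset.prod_nbij' (fun i => if j < i then i else i - 1)
      (fun i => if j < i then i else i + 1) ?_ ?_ ?_ ?_ ?_
    · intro i hi
      simp only [Finset.mem_erase, Finset.mem_Icc] at hi ⊢
      split_ifs <;> omega
    · intro i hi
      simp only [Finset.mem_erase, Finset.mem_Icc] at hi ⊢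
      split_ifs <;> omega
    · intro i hi
      simp only [Finset.mem_Icc] at hi
      split_ifs <;> omega
    · intro i hi
      simp only [Finset.mem_erase, Finset.mem_Icc] at hi
      split_ifs <;> omega
    · intro i hi
      simp only [Finset.mem_Icc] at hi
      rw [levyJump]
      split_ifs with h
      · rw [sub_div]
      · rw [Nat.cast_sub (by omega)]
        congr 1
        push_cast
        ring

theorem levyJump_self {j q : ℕ} (hj : j ∈ Finset.Icc 1 (q - 1)) :
    levyJump j q q = (j : ℝ) / q := by
  rw [Finset.mem_Icc] at hj
  rw [levyJump, if_pos (by omega)]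

theorem wrightTerm_eq_levyTerm {p q j : ℕ} (hp : 0 < p) (hj : j ∈ Finset.Icc 1 (q - 1))
    (l z : ℝ) : wrightTerm
      ((((1 - levyJump j q q : ℝ) : ℂ), (-1 : ℝ)) ::
        pairRow 2 (q - 1) (fun i => (i : ℝ) / q - levyJump j q i) (-1))
      ((((((p : ℝ) * q - j * p * l) / (p * q) : ℝ) : ℂ), -l) ::
        pairRow 1 (p - 1) (fun i => ((i : ℝ) * q - j * p * l) / (p * q)) (-l))
      ((-z : ℝ) : ℂ) = levyTerm p q l z j := by
  funext n
  have hq0 : (q : ℝ) ≠ 0 := by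
    have : 0 < q := by rw [Finset.mem_Icc] at hj; omega
    exact_mod_cast this.ne'
  have hp0 : (p : ℝ) ≠ 0 := by exact_mod_cast hp.ne'
  rw [wrightTerm, levyTerm, List.map_cons, List.prod_cons, List.map_cons, List.prod_cons,
    prod_map_pairRow, prod_map_pairRow, levyJump_self hj,
    ← prod_levyJump_mul hj fun r => Complex.Gamma ((r : ℂ) + ((-1 : ℝ) : ℂ) * n),
    ← prod_Icc_pred_mul _ hp, mul_comm (Complex.Gamma (((1 - (j : ℝ) / q : ℝ) : ℂ) + _))]
  have e : ∀ i : ℕ, ((i : ℝ) * q - j * p * l) / (p * q) = (i : ℝ) / p - l * j / q := by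
    intro i; field_simp
  simp only [e]
  rw [mul_comm (Complex.Gamma ((((p : ℝ) / p - l * j / q : ℝ) : ℂ) + _))]

theorem wrightTerm_eq_levyTerm_last {p q : ℕ} (hp : 0 < p) (hq : 0 < q) (l z : ℝ) : wrightTerm
      (pairRow 1 (q - 1) (fun i => -(((q : ℝ) - i) / q)) (-1))
      ((((1 - l : ℝ) : ℂ), -l) ::
        pairRow 1 (p - 1) (fun i => ((i : ℝ) * q - p * l * q) / (p * q)) (-l))
      ((-z : ℝ) : ℂ) = levyTerm p q l z q := by
  funext n
  have hq0 : (q : ℝ) ≠ 0 := by exact_mod_cast hq.ne'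
  have hp0 : (p : ℝ) ≠ 0 := by exact_mod_cast hp.ne'
  have he : (Finset.Icc 1 q).erase q = Finset.Icc 1 (q - 1) := by ext i; simp; omega
  rw [wrightTerm, levyTerm, List.map_cons, List.prod_cons,
    prod_map_pairRow, prod_map_pairRow, he, ← prod_Icc_pred_mul _ hp]
  have e1 : ∀ i : ℕ, ((i : ℝ) * q - p * l * q) / (p * q) = (i : ℝ) / p - l * q / q := by
    intro i; field_simp
  have e2 : ∀ i : ℕ, -(((q : ℝ) - i) / q) = ((i : ℝ) - q) / q := by intro i; ring
  have e3 : (1 : ℝ) - l = (p : ℝ) / p - l * q / q := by field_simp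
  simp only [e1, e2, e3]
  rw [mul_comm (Complex.Gamma ((((p : ℝ) / p - l * q / q : ℝ) : ℂ) + _))]

/-- The class of multiples of `q` contributes nothing when `l` is a positive integer. -/
theorem levyTerm_last_eq_zero {p q k : ℕ} (hp : 0 < p) (hq : 0 < q) (hk : 0 < k) (z : ℝ) (n : ℕ) :
    levyTerm p q k z q n = 0 := by
  have hq0 : (q : ℝ) ≠ 0 := by exact_mod_cast hq.ne'
  have hp0 : (p : ℝ) ≠ 0 := by exact_mod_cast hp.ne'
  -- The denominator factor i = p is Γ(1-k-kn), at a pole. Its value 0 makes the quotient 0, in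
  -- agreement with 1/Γ = 0.
  have h : Complex.Gamma ((((p : ℝ) / p - k * q / q : ℝ) : ℂ) + ((-(k : ℝ) : ℝ) : ℂ) * n) = 0 := by
    rw [Complex.Gamma_eq_zero_iff]
    refine ⟨k - 1 + k * n, ?_⟩
    rw [div_self hp0, mul_div_assoc, div_self hq0, Nat.cast_add, Nat.cast_sub hk]
    push_cast
    ring
  rw [levyTerm, ← prod_Icc_pred_mul _ hp, h]
  simp

theorem sum_Icc_eq_of_last {q : ℕ} (hq : 0 < q) (f : ℕ → ℂ) (h : f q = 0) :
    ∑ j ∈ Finset.Icc 1 q, f j = ∑ j ∈ Finset.Icc 1 (q - 1), f j := by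
  obtain ⟨k, rfl⟩ : ∃ k, q = k + 1 := ⟨q - 1, by omega⟩
  rw [Finset.sum_Icc_succ_top (by omega), h, add_zero, Nat.add_sub_cancel]

theorem ascPochhammer_eval_eq_prod_range_add (n : ℕ) (a : ℂ) :
    (ascPochhammer ℂ n).eval a = ∏ j ∈ Finset.range n, (a + j) := by
  induction n with
  | zero => simp
  | succ n ih => rw [ascPochhammer_succ_eval, ih, Finset.prod_range_succ]

/-- Valid for every a: if a-n is a pole, then either a is a pole too or the Pochhammer factor
vanishes, and both sides are 0. -/
theorem Gamma_sub_nat_eq_div_ascPochhammer (a : ℂ) (n : ℕ) :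
    Complex.Gamma (a - n) = Complex.Gamma a / ((-1) ^ n * (ascPochhammer ℂ n).eval (1 - a)) := by
  rw [Gamma_eq_Gamma_add_nat_div (a - n) n, sub_add_cancel, ascPochhammer_eval_eq_prod_range_add,
    ← Finset.prod_range_reflect]
  congr 1
  have hc : (-1 : ℂ) ^ n = ∏ _i ∈ Finset.range n, (-1 : ℂ) := by simp
  rw [hc, ← Finset.prod_mul_distrib]
  refine Finset.prod_congr rfl fun j hj => ?_
  have hj := Finset.mem_range.1 hj
  rw [show n - 1 - j = n - (1 + j) by omega, Nat.cast_sub (by omega)]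
  push_cast
  ring

theorem Gamma_one_sub_div_sub_nat_ne_zero {q j : ℕ} (hj : j ∈ Finset.Icc 1 (q - 1)) (n : ℕ) :
    Complex.Gamma (((1 - (j : ℝ) / q : ℝ) : ℂ) + ((-1 : ℝ) : ℂ) * n) ≠ 0 := by
  rw [Finset.mem_Icc] at hj
  have hq0 : (q : ℝ) ≠ 0 := by
    have : 0 < q := by omega
    exact_mod_cast this.ne'
  have e : (1 : ℝ) - (j : ℝ) / q = ((q : ℝ) - j) / q := by field_simp
  rw [e]
  exact Complex.Gamma_ne_zero (nat_sub_div_sub_ne (by simp; omega) (by simp; omega) (by omega) n)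

/-- For l = 1 the numerator factor i = q and the denominator factor i = p are both Γ(1-j/q-n), which
is nonzero and cancels. Every other Γ(r-n) becomes Γ(r) over a signed Pochhammer symbol, so upper
and lower parameters trade places. -/
theorem levyTerm_one_eq_hypergeomTerm {p q j : ℕ} (hp : 0 < p) (hpq : p < q)
    (hj : j ∈ Finset.Icc 1 (q - 1)) (z : ℝ) (n : ℕ) :
    levyTerm p q 1 z j n =
      ((∏ i ∈ Finset.Icc 2 (q - 1), Complex.Gamma (((i : ℝ) / q - levyJump j q i : ℝ) : ℂ)) /
        ∏ i ∈ Finset.Icc 1 (p - 1), Complex.Gamma ((((i : ℝ) * q - j * p) / (p * q) : ℝ) : ℂ)) *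
      hypergeomTerm (row 1 (p - 1) (fun i => 1 - ((i : ℝ) * q - j * p) / (p * q)))
        (row 2 (q - 1) (fun i => 1 - (i : ℝ) / q + levyJump j q i))
        (((-1) ^ (q - p) * z : ℝ) : ℂ) n := by
  have hq0 : (q : ℝ) ≠ 0 := by exact_mod_cast (hp.trans hpq).ne'
  have hp0 : (p : ℝ) ≠ 0 := by exact_mod_cast hp.ne'
  have e : ∀ i : ℕ, (i : ℝ) / p - 1 * j / q = ((i : ℝ) * q - j * p) / (p * q) := by
    intro i; field_simp
  have hΓ := Gamma_one_sub_div_sub_nat_ne_zero hj n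
  rw [levyTerm, ← prod_levyJump_mul hj fun r => Complex.Gamma ((r : ℂ) + ((-1 : ℝ) : ℂ) * n),
    ← prod_Icc_pred_mul _ hp, hypergeomTerm, prod_map_row, prod_map_row]
  rw [show (p : ℝ) / p - 1 * j / q = 1 - (j : ℝ) / q by rw [div_self hp0, one_mul]]
  simp only [e]
  generalize Complex.Gamma (((1 - (j : ℝ) / q : ℝ) : ℂ) + ((-1 : ℝ) : ℂ) * n) = G at hΓ ⊢
  have hG : ∀ r : ℝ, Complex.Gamma ((r : ℂ) + ((-1 : ℝ) : ℂ) * n) =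
      Complex.Gamma r / ((-1) ^ n * (ascPochhammer ℂ n).eval ((1 - r : ℝ) : ℂ)) := by
    intro r
    rw [show (r : ℂ) + ((-1 : ℝ) : ℂ) * n = r - n by push_cast; ring,
      Gamma_sub_nat_eq_div_ascPochhammer]
    push_cast
    rfl
  simp only [hG, Finset.prod_div_distrib, Finset.prod_mul_distrib, Finset.prod_const,
    Nat.card_Icc]
  have e2 : ∀ i : ℕ, (1 : ℝ) - ((i : ℝ) / q - levyJump j q i) =
    1 - (i : ℝ) / q + levyJump j q i := fun i => by ring
  simp only [e2]
  -- One sign comes from (-z)^n, p-1 from the denominator and q-2 from the numerator; p-(q-2) has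
  -- the parity of q-p.
  have hsign : (-1 : ℂ) ^ n * ((-1) ^ n) ^ (p - 1 + 1 - 1) / ((-1) ^ n) ^ (q - 1 + 1 - 2) =
      ((-1) ^ (q - p)) ^ n := by
    rw [div_eq_iff (by simp), ← pow_succ', ← pow_mul, ← pow_mul, ← pow_mul, ← pow_add]
    have : (q - p) * n + n * (q - 1 + 1 - 2) = n * (p - 1 + 1 - 1 + 1) + 2 * (n * (q - p - 1)) := by
      have h3 : q - p + (q - 1 + 1 - 2) = p - 1 + 1 - 1 + 1 + 2 * (q - p - 1) := by omega
      calc _ = (q - p + (q - 1 + 1 - 2)) * n := by ring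
        _ = _ := by rw [h3]; ring
    rw [this, pow_add, pow_mul _ 2, neg_one_sq, one_pow, mul_one]
  have z1 : ((-z : ℝ) : ℂ) ^ n = (-1) ^ n * (z : ℂ) ^ n := by rw [Complex.ofReal_neg, neg_pow]
  have z2 : (((-1) ^ (q - p) * z : ℝ) : ℂ) ^ n = ((-1) ^ (q - p)) ^ n * (z : ℂ) ^ n := by
    push_cast
    rw [mul_pow]
  have he : (-1 : ℂ) ^ n ≠ 0 := by simp
  rw [z1, z2, ← hsign]
  generalize (-1 : ℂ) ^ n = e at he ⊢
  simp only [div_eq_mul_inv, mul_inv, inv_inv]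
  field_simp

open Filter Topology in
theorem tendsto_add_natCast_div (a : ℝ) :
    Tendsto (fun n : ℕ => (a + n) / ((n : ℝ) + 1)) atTop (𝓝 1) := by
  have h := ((tendsto_one_div_add_atTop_nhds_zero_nat (𝕜 := ℝ)).const_mul (a - 1)).const_add 1
  rw [mul_zero, add_zero] at h
  refine h.congr fun n => ?_
  have : (n : ℝ) + 1 ≠ 0 := by positivity
  field_simp
  ring

open Filter Topology in
/-- A hypergeometric series with positive parameters and no more upper than lower ones. -/
theorem summable_hypergeomTerm_row {a b c d : ℕ} {f g : ℕ → ℝ} (hf : ∀ i ∈ Finset.Icc a b, 0 < f i)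
    (hg : ∀ i ∈ Finset.Icc c d, 0 < g i) (hcard : b + 1 - a ≤ d + 1 - c) {z : ℝ} (hz : z ≠ 0) :
    Summable (hypergeomTerm (row a b f) (row c d g) z) := by
  set t : ℕ → ℝ := fun n => (∏ i ∈ Finset.Icc a b, (ascPochhammer ℝ n).eval (f i)) /
    ((∏ i ∈ Finset.Icc c d, (ascPochhammer ℝ n).eval (g i)) * n.factorial) * z ^ n with ht
  have hcast : hypergeomTerm (row a b f) (row c d g) z = fun n => (t n : ℂ) := by
    funext n
    rw [hypergeomTerm, prod_map_row, prod_map_row, ht]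
    push_cast
    have : ∀ r : ℝ, (ascPochhammer ℂ n).eval (r : ℂ) = (((ascPochhammer ℝ n).eval r : ℝ) : ℂ) :=
      fun r => by
        rw [ascPochhammer_eval₂ Complex.ofRealHom n]
        exact Polynomial.eval₂_at_apply Complex.ofRealHom r
    simp only [this]
  rw [hcast]
  have hfp : ∀ n, 0 < ∏ i ∈ Finset.Icc a b, (ascPochhammer ℝ n).eval (f i) := fun n =>
    Finset.prod_pos fun i hi => ascPochhammer_pos n _ (hf i hi)
  have hgp : ∀ n, 0 < ∏ i ∈ Finset.Icc c d, (ascPochhammer ℝ n).eval (g i) := fun n =>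
    Finset.prod_pos fun i hi => ascPochhammer_pos n _ (hg i hi)
  have htn : ∀ n, t n ≠ 0 := fun n => by
    have h1 := (hfp n).ne'
    have h2 := (hgp n).ne'
    have h3 : (n.factorial : ℝ) ≠ 0 := by exact_mod_cast n.factorial_ne_zero
    simp only [ht]
    positivity
  have hsum : Summable t := by
    refine summable_of_ratio_test_tendsto_lt_one zero_lt_one (Eventually.of_forall htn) ?_
    have h1 : Tendsto (fun n : ℕ => ∏ i ∈ Finset.Icc a b, ((f i + n) / ((n : ℝ) + 1))) atTop
        (𝓝 1) := by
      simpa using tendsto_finsetProd (Finset.Icc a b) fun i _ => tendsto_add_natCast_div (f i)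
    have h2 : Tendsto (fun n : ℕ => ∏ i ∈ Finset.Icc c d, ((g i + n) / ((n : ℝ) + 1))) atTop
        (𝓝 1) := by
      simpa using tendsto_finsetProd (Finset.Icc c d) fun i _ => tendsto_add_natCast_div (g i)
    -- The exponent counts lower parameters plus one for n!, minus upper parameters. It is positive
    -- by `hcard` and sends the term ratio to 0 for every z.
    have h3 : Tendsto (fun n : ℕ => (1 / ((n : ℝ) + 1)) ^ (d + 1 - c + 1 - (b + 1 - a))) atTop
        (𝓝 0) := by
      have := (tendsto_one_div_add_atTop_nhds_zero_nat (𝕜 := ℝ)).pow (d + 1 - c + 1 - (b + 1 - a))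
      rwa [zero_pow (by omega)] at this
    have h4 := ((h1.div h2 one_ne_zero).mul h3).mul_const z |>.norm
    rw [mul_zero, zero_mul, norm_zero] at h4
    refine h4.congr fun n => ?_
    rw [← norm_div]
    congr 1
    simp only [Pi.div_apply, ht, ascPochhammer_succ_eval, Finset.prod_mul_distrib,
      Finset.prod_div_distrib, Finset.prod_const, Nat.card_Icc, Nat.factorial_succ]
    have h5 := (hfp n).ne'
    have h6 := (hgp n).ne'
    have h7 : (n.factorial : ℝ) ≠ 0 := by exact_mod_cast n.factorial_ne_zero
    have h8 : (n : ℝ) + 1 ≠ 0 := by positivity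
    have h9 : ∏ i ∈ Finset.Icc c d, (g i + (n : ℝ)) ≠ 0 :=
      (Finset.prod_pos fun i hi => add_pos_of_pos_of_nonneg (hg i hi) (Nat.cast_nonneg n)).ne'
    have h10 : ((n : ℝ) + 1) ^ (d + 1 - c + 1) =
        (n + 1) ^ (d + 1 - c + 1 - (b + 1 - a)) * (n + 1) ^ (b + 1 - a) := by
      rw [← pow_add]; congr 1; omega
    rw [pow_succ] at h10
    push_cast
    rw [div_pow, one_pow, pow_succ z]
    field_simp
    linear_combination (∏ i ∈ Finset.Icc a b, (f i + (n : ℝ))) * h10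
  exact_mod_cast hsum

/-- The denominator factor i = p is Γ(1-k(j/q+n)). Gauss's formula opens it, its last factor cancels
the numerator factor i = q, and the power k^(k(j/q+n)) turns z into z·k^k. -/
theorem levyTerm_nat_eq_wrightTerm {p q j k : ℕ} (hp : 0 < p) (hk : 0 < k)
    (hj : j ∈ Finset.Icc 1 (q - 1)) {l : ℝ} (hl : l = k) (z : ℝ) (n : ℕ) :
    levyTerm p q l z j n = (((k : ℝ) ^ ((k : ℝ) * (j / q)) / gaussConst k : ℝ) : ℂ) * wrightTerm
      (pairRow 2 (q - 1) (fun i => (i : ℝ) / q - levyJump j q i) (-1))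
      (pairRow 1 (k - 1) (fun i => ((i : ℝ) * q - j * l) / (l * q)) (-1) ++
        pairRow 1 (p - 1) (fun i => ((i : ℝ) * q - j * p * l) / (p * q)) (-l))
      ((-(z * (k : ℝ) ^ (k : ℝ)) : ℝ) : ℂ) n := by
  have hq : 0 < q := by rw [Finset.mem_Icc] at hj; omega
  have hq0 : (q : ℝ) ≠ 0 := by exact_mod_cast hq.ne'
  have hqc : (q : ℂ) ≠ 0 := by exact_mod_cast hq.ne'
  have hp0 : (p : ℝ) ≠ 0 := by exact_mod_cast hp.ne'
  have hk0 : (k : ℝ) ≠ 0 := by exact_mod_cast hk.ne'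
  have hkc : (k : ℂ) ≠ 0 := by exact_mod_cast hk.ne'
  have hk' : (0 : ℝ) < k := by exact_mod_cast hk
  have hΓ := Gamma_one_sub_div_sub_nat_ne_zero hj n
  have hck : ((gaussConst k : ℝ) : ℂ) ≠ 0 := by exact_mod_cast (gaussConst_pos hk).ne'
  rw [levyTerm, ← prod_levyJump_mul hj fun r => Complex.Gamma ((r : ℂ) + ((-1 : ℝ) : ℂ) * n),
    ← prod_Icc_pred_mul _ hp, wrightTerm, List.map_append, List.prod_append, prod_map_pairRow,
    prod_map_pairRow, prod_map_pairRow]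
  have e1 : ∀ i : ℕ, ((i : ℝ) * q - j * p * l) / (p * q) = (i : ℝ) / p - l * j / q := by
    intro i; field_simp
  have e2 : ∀ i : ℕ, ((i : ℝ) * q - j * l) / (l * q) = (i : ℝ) / k - j / q := by
    intro i; rw [hl]; field_simp
  simp only [e1, e2]
  have hlast : Complex.Gamma ((((p : ℝ) / p - l * j / q : ℝ) : ℂ) + ((-l : ℝ) : ℂ) * n) =
      (((k : ℝ) ^ ((k : ℝ) * (j / q)) * ((k : ℝ) ^ (k : ℝ)) ^ n : ℝ) : ℂ)⁻¹ * gaussConst k *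
      ((∏ i ∈ Finset.Icc 1 (k - 1),
        Complex.Gamma ((((i : ℝ) / k - j / q : ℝ) : ℂ) + ((-1 : ℝ) : ℂ) * n)) *
        Complex.Gamma (((1 - (j : ℝ) / q : ℝ) : ℂ) + ((-1 : ℝ) : ℂ) * n)) := by
    have hg := Gamma_one_add_nat_mul k hk (((-(j / q) - n : ℝ) : ℝ) : ℂ)
    rw [← gaussConst, ← prod_Icc_pred_mul _ hk, div_self hkc] at hg
    have a1 : (((p : ℝ) / p - l * j / q : ℝ) : ℂ) + ((-l : ℝ) : ℂ) * n =
        1 + k * (((-(j / q) - n : ℝ) : ℝ) : ℂ) := by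
      rw [div_self hp0, hl]; push_cast; ring
    have a2 : ∀ i : ℕ, (((-(j / q) - n : ℝ) : ℝ) : ℂ) + i / k =
        (((i : ℝ) / k - j / q : ℝ) : ℂ) + ((-1 : ℝ) : ℂ) * n := by
      intro i; push_cast; ring
    have a3 : (((-(j / q) - n : ℝ) : ℝ) : ℂ) + 1 =
        ((1 - (j : ℝ) / q : ℝ) : ℂ) + ((-1 : ℝ) : ℂ) * n := by
      push_cast; ring
    have a4 : (k : ℂ) ^ ((k : ℂ) * (((-(j / q) - n : ℝ) : ℝ) : ℂ)) =
        (((k : ℝ) ^ ((k : ℝ) * (j / q)) * ((k : ℝ) ^ (k : ℝ)) ^ n : ℝ) : ℂ)⁻¹ := by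
      rw [← Complex.ofReal_natCast, ← Complex.ofReal_mul, ← Complex.ofReal_cpow hk'.le,
        ← Complex.ofReal_inv, ← Real.rpow_mul_natCast hk'.le, ← Real.rpow_add hk',
        ← Real.rpow_neg hk'.le]
      congr 2
      ring
    rw [a1, hg, a4, a3]
    simp only [a2]
  rw [hlast]
  generalize Complex.Gamma (((1 - (j : ℝ) / q : ℝ) : ℂ) + ((-1 : ℝ) : ℂ) * n) = G at hΓ ⊢
  have hX : (k : ℝ) ^ ((k : ℝ) * (j / q)) ≠ 0 := (Real.rpow_pos_of_pos hk' _).ne'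
  have hY : (k : ℝ) ^ (k : ℝ) ≠ 0 := (Real.rpow_pos_of_pos hk' _).ne'
  generalize (k : ℝ) ^ ((k : ℝ) * (j / q)) = X at hX ⊢
  generalize (k : ℝ) ^ (k : ℝ) = Y at hY ⊢
  have hXc : (X : ℂ) ≠ 0 := by exact_mod_cast hX
  have hYc : (Y : ℂ) ≠ 0 := by exact_mod_cast hY
  rw [show -(z * Y) = -z * Y by ring, Complex.ofReal_mul (-z), mul_pow, Complex.ofReal_mul X,
    Complex.ofReal_pow, Complex.ofReal_div]
  simp only [div_eq_mul_inv, mul_inv, inv_inv]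
  field_simp

theorem levyArg_rpow_div {p q : ℕ} (hp : 0 < p) (hq : 0 < q) (l : ℝ) {x : ℝ} (hx : 0 < x) (j : ℕ) :
    ((p : ℝ) ^ (p * l) / (x ^ (p * l) * (q : ℝ) ^ q)) ^ ((j : ℝ) / q) =
      (p : ℝ) ^ (j * l * (p / q)) / (x ^ (j * l * (p / q)) * (q : ℝ) ^ j) := by
  have hq' : (q : ℝ) ≠ 0 := by exact_mod_cast hq.ne'
  rw [levyArg_rpow hp hq l hx, mul_div_cancel₀ (j : ℝ) hq', Real.rpow_natCast,
    show (j : ℝ) / q * l * p = j * l * (p / q) by ring]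


/-! ### Series representations of the density -/

theorem levyDensity_eq_wrightPsi {p q : ℕ} (hp : 0 < p) (hpq : p < q) {α l c : ℝ} (hα0 : 0 < α)
    (hα1 : α < 1) (hc : c < 1) (h : α * q = p * l) {x : ℝ} (hx : 0 < x) :
    Summable (wrightTerm
      (pairRow 1 (q - 1) (fun i => -(((q : ℝ) - i) / q)) (-1))
      ((((1 - l : ℝ) : ℂ), -l) ::
        pairRow 1 (p - 1) (fun i => ((i : ℝ) * q - p * l * q) / (p * q)) (-l))
      ((-((p : ℝ) ^ (p * l) / (x ^ (p * l) * (q : ℝ) ^ q)) : ℝ) : ℂ)) ∧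
    (∀ j ∈ Finset.Icc 1 (q - 1), Summable (wrightTerm
      ((((1 - levyJump j q q : ℝ) : ℂ), (-1 : ℝ)) ::
        pairRow 2 (q - 1) (fun i => (i : ℝ) / q - levyJump j q i) (-1))
      ((((((p : ℝ) * q - j * p * l) / (p * q) : ℝ) : ℂ), -l) ::
        pairRow 1 (p - 1) (fun i => ((i : ℝ) * q - j * p * l) / (p * q)) (-l))
      ((-((p : ℝ) ^ (p * l) / (x ^ (p * l) * (q : ℝ) ^ q)) : ℝ) : ℂ))) ∧
    levyDensity α c x =
      ((l * √((p : ℝ) * q) / (x * (2 * Real.pi) ^ (((q : ℝ) - p) / 2)) : ℝ) : ℂ) *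
          (((p : ℝ) ^ (l * p) / (x ^ (l * p) * (q : ℝ) ^ q) : ℝ) : ℂ) *
          wrightPsi
            (pairRow 1 (q - 1) (fun i => -(((q : ℝ) - i) / q)) (-1))
            ((((1 - l : ℝ) : ℂ), -l) ::
              pairRow 1 (p - 1) (fun i => ((i : ℝ) * q - p * l * q) / (p * q)) (-l))
            ((-((p : ℝ) ^ (p * l) / (x ^ (p * l) * (q : ℝ) ^ q)) : ℝ) : ℂ) +
        ((l * √((p : ℝ) * q) / (x * (2 * Real.pi) ^ (((q : ℝ) - p) / 2)) : ℝ) : ℂ) *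
          ∑ j ∈ Finset.Icc 1 (q - 1),
            (((p : ℝ) ^ (j * l * (p / q)) / (x ^ (j * l * (p / q)) * (q : ℝ) ^ j) : ℝ) : ℂ) *
              wrightPsi
                ((((1 - levyJump j q q : ℝ) : ℂ), (-1 : ℝ)) ::
                  pairRow 2 (q - 1) (fun i => (i : ℝ) / q - levyJump j q i) (-1))
                ((((((p : ℝ) * q - j * p * l) / (p * q) : ℝ) : ℂ), -l) ::
                  pairRow 1 (p - 1) (fun i => ((i : ℝ) * q - j * p * l) / (p * q)) (-l))
                ((-((p : ℝ) ^ (p * l) / (x ^ (p * l) * (q : ℝ) ^ q)) : ℝ) : ℂ) := by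
  have hq : 0 < q := hp.trans hpq
  have hq0 : (q : ℝ) ≠ 0 := by exact_mod_cast hq.ne'
  obtain ⟨hs, he⟩ := levyDensity_eq_sum_levyTerm hp hpq hα0 hα1 hc h hx rfl
  refine ⟨?_, fun j hj => ?_, ?_⟩
  · rw [wrightTerm_eq_levyTerm_last hp hq]
    exact hs q (by simp; omega)
  · rw [wrightTerm_eq_levyTerm hp hj]
    refine hs j ?_
    rw [Finset.mem_Icc] at hj ⊢
    omega
  · have hlast : ∀ f : ℕ → ℂ, ∑ j ∈ Finset.Icc 1 q, f j =
        f q + ∑ j ∈ Finset.Icc 1 (q - 1), f j := by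
      obtain ⟨k, rfl⟩ : ∃ k, q = k + 1 := ⟨q - 1, by omega⟩
      intro f
      rw [Finset.sum_Icc_succ_top (by omega), Nat.add_sub_cancel, add_comm]
    rw [he, hlast, mul_add, div_self hq0, Real.rpow_one, mul_assoc, wrightPsi,
      wrightTerm_eq_levyTerm_last hp hq, mul_comm l p]
    congr 2
    refine Finset.sum_congr rfl fun j hj => ?_
    rw [wrightPsi, wrightTerm_eq_levyTerm hp hj, levyArg_rpow_div hp hq l hx]

theorem levyDensity_eq_hypergeomF {p q : ℕ} (hp : 0 < p) (hpq : p < q) {α c : ℝ} (hα0 : 0 < α)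
    (hα1 : α < 1) (hc : c < 1) (h : α * q = p) {x : ℝ} (hx : 0 < x) :
    (∀ j ∈ Finset.Icc 1 (q - 1), Summable (hypergeomTerm
      (row 1 (p - 1) (fun i => 1 - ((i : ℝ) * q - j * p) / (p * q)))
      (row 2 (q - 1) (fun i => 1 - (i : ℝ) / q + levyJump j q i))
      (((-1) ^ (q - p) * ((p : ℝ) ^ p / (x ^ p * (q : ℝ) ^ q)) : ℝ) : ℂ))) ∧
    levyDensity α c x =
      ((√((p : ℝ) * q) / (x * (2 * Real.pi) ^ (((q : ℝ) - p) / 2)) : ℝ) : ℂ) *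
        ∑ j ∈ Finset.Icc 1 (q - 1),
          (((p : ℝ) ^ (j * ((p : ℝ) / q)) / (x ^ (j * ((p : ℝ) / q)) * (q : ℝ) ^ j) : ℝ) : ℂ) *
            ((∏ i ∈ Finset.Icc 2 (q - 1),
                Complex.Gamma (((i : ℝ) / q - levyJump j q i : ℝ) : ℂ)) /
              ∏ i ∈ Finset.Icc 1 (p - 1),
                Complex.Gamma ((((i : ℝ) * q - j * p) / (p * q) : ℝ) : ℂ)) *
            hypergeomF
              (row 1 (p - 1) (fun i => 1 - ((i : ℝ) * q - j * p) / (p * q)))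
              (row 2 (q - 1) (fun i => 1 - (i : ℝ) / q + levyJump j q i))
              (((-1) ^ (q - p) * ((p : ℝ) ^ p / (x ^ p * (q : ℝ) ^ q)) : ℝ) : ℂ) := by
  have hq : 0 < q := hp.trans hpq
  have hp' : (0 : ℝ) < p := by exact_mod_cast hp
  have hq' : (0 : ℝ) < q := by exact_mod_cast hq
  have hz : (p : ℝ) ^ p / (x ^ p * (q : ℝ) ^ q) =
      (p : ℝ) ^ (p * (1 : ℝ)) / (x ^ (p * (1 : ℝ)) * (q : ℝ) ^ q) := by
    rw [mul_one, Real.rpow_natCast, Real.rpow_natCast]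
  obtain ⟨-, he⟩ := levyDensity_eq_sum_levyTerm hp hpq hα0 hα1 hc (by rw [h, mul_one]) hx hz
  -- Summability is not inherited from the residue series: p and q need not be coprime, and the
  -- Gamma prefactor vanishes when iq = jp for some i. The ratio test is used instead.
  refine ⟨fun j hj => summable_hypergeomTerm_row (fun i hi => ?_) (fun i hi => ?_) (by omega) ?_, ?_⟩
  · rw [Finset.mem_Icc] at hi hj
    have h1 : (i : ℝ) < p := by exact_mod_cast (by omega : i < p)
    have h2 : (0 : ℝ) ≤ j := Nat.cast_nonneg j
    rw [sub_pos, div_lt_one (by positivity)]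
    nlinarith [mul_nonneg h2 hp'.le]
  · rw [Finset.mem_Icc] at hi hj
    have h1 : (i : ℝ) < q := by exact_mod_cast (by omega : i < q)
    have h2 : (i : ℝ) / q < 1 := by rwa [div_lt_one hq']
    have h3 : 0 ≤ levyJump j q i := by rw [levyJump]; split_ifs <;> positivity
    linarith
  · have : (0 : ℝ) < (p : ℝ) ^ p / (x ^ p * (q : ℝ) ^ q) := by positivity
    exact mul_ne_zero (pow_ne_zero _ (by norm_num)) this.ne'
  · rw [he, one_mul, sum_Icc_eq_of_last hq]
    · congr 1
      refine Finset.sum_congr rfl fun j hj => ?_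
      rw [mul_assoc, hypergeomF, ← tsum_mul_left]
      simp only [levyTerm_one_eq_hypergeomTerm hp hpq hj]
      rw [tsum_mul_left, tsum_mul_left, hz, levyArg_rpow_div hp hq 1 hx, mul_one (j : ℝ)]
    · have := fun z n => levyTerm_last_eq_zero hp hq zero_lt_one z n
      rw [Nat.cast_one] at this
      simp [this]

theorem levyDensity_eq_wrightPsi_nat {p q k : ℕ} (hp : 0 < p) (hpq : p < q) (hk : 0 < k)
    {α l c : ℝ} (hα0 : 0 < α) (hα1 : α < 1) (hc : c < 1) (h : α * q = p * l) (hl : l = k)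
    {x : ℝ} (hx : 0 < x) :
    (∀ j ∈ Finset.Icc 1 (q - 1), Summable (wrightTerm
      (pairRow 2 (q - 1) (fun i => (i : ℝ) / q - levyJump j q i) (-1))
      (pairRow 1 (k - 1) (fun i => ((i : ℝ) * q - j * l) / (l * q)) (-1) ++
        pairRow 1 (p - 1) (fun i => ((i : ℝ) * q - j * p * l) / (p * q)) (-l))
      ((-((p : ℝ) ^ (p * l) * l ^ l / (x ^ (p * l) * (q : ℝ) ^ q)) : ℝ) : ℂ))) ∧
    levyDensity α c x =
      ((√((p : ℝ) * q * l) / (x * (2 * Real.pi) ^ (((q : ℝ) + 1 - l - p) / 2)) : ℝ) : ℂ) *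
        ∑ j ∈ Finset.Icc 1 (q - 1),
          (((p : ℝ) ^ (j * l * (p / q)) * l ^ (j * (l / q)) /
              (x ^ (j * l * (p / q)) * (q : ℝ) ^ j) : ℝ) : ℂ) *
            wrightPsi
              (pairRow 2 (q - 1) (fun i => (i : ℝ) / q - levyJump j q i) (-1))
              (pairRow 1 (k - 1) (fun i => ((i : ℝ) * q - j * l) / (l * q)) (-1) ++
                pairRow 1 (p - 1) (fun i => ((i : ℝ) * q - j * p * l) / (p * q)) (-l))
              ((-((p : ℝ) ^ (p * l) * l ^ l / (x ^ (p * l) * (q : ℝ) ^ q)) : ℝ) : ℂ) := by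
  have hq : 0 < q := hp.trans hpq
  have hk' : (0 : ℝ) < k := by exact_mod_cast hk
  have hq' : (0 : ℝ) < q := by exact_mod_cast hq
  obtain ⟨hs, he⟩ := levyDensity_eq_sum_levyTerm hp hpq hα0 hα1 hc h hx rfl
  have hz : (p : ℝ) ^ (p * l) * l ^ l / (x ^ (p * l) * (q : ℝ) ^ q) =
      (p : ℝ) ^ (p * l) / (x ^ (p * l) * (q : ℝ) ^ q) * (k : ℝ) ^ (k : ℝ) := by
    rw [hl]; ring
  have hg : gaussConst k ≠ 0 := (gaussConst_pos hk).ne'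
  refine ⟨fun j hj => ?_, ?_⟩
  -- The factor relating the two kinds of terms is nonzero, so here summability does transfer.
  · have hne : (((k : ℝ) ^ ((k : ℝ) * (j / q)) / gaussConst k : ℝ) : ℂ) ≠ 0 := by
      exact_mod_cast div_ne_zero (Real.rpow_pos_of_pos hk' _).ne' hg
    rw [← summable_mul_left_iff hne, hz]
    refine (hs j ?_).congr fun n => levyTerm_nat_eq_wrightTerm hp hk hj hl _ n
    rw [Finset.mem_Icc] at hj ⊢
    omega
  · rw [he, sum_Icc_eq_of_last hq, show (q : ℝ) + 1 - l - p = q + 1 - p - l by ring,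
      ← gaussConst_ratio_nat hp hk hl hx, Complex.ofReal_div _ (gaussConst k), mul_comm_div,
      Finset.sum_div]
    · congr 1
      refine Finset.sum_congr rfl fun j hj => ?_
      rw [wrightPsi, hz]
      simp only [levyTerm_nat_eq_wrightTerm hp hk hj hl]
      rw [tsum_mul_left, ← mul_assoc, mul_div_right_comm, ← Complex.ofReal_mul,
        ← Complex.ofReal_div, levyArg_rpow_div hp hq l hx, hl]
      congr 2
      rw [show (k : ℝ) * (j / q) = j * (k / q) by ring]
      ring
    · rw [hl]
      simp [levyTerm_last_eq_zero hp hq hk]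

/-! ### The main theorem -/

theorem mainTheorem1 (p q l₁ l₂ : ℕ) (hp : 0 < p) (hpq : p < q) (hl₁ : 0 < l₁) (hl₂ : 0 < l₂)
    (α l : ℝ) (hα : α = ((p : ℝ) / q) ^ ((l₂ : ℝ) / l₁))
    (hl : l = ((p : ℝ) / q) ^ ((l₂ : ℝ) / l₁ - 1))
    (c : ℝ) (hc : 0 < c) (hcα : c < α) :
    -- the Mellin--Barnes integral converges and has the Laplace transform `exp (-t ^ α)`
    (Complex.VerticalIntegrable (levyKernel α) c ∧
      ∀ t : ℝ, 0 < t →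
        IntegrableOn (fun x : ℝ => (Real.exp (-(t * x)) : ℂ) * levyDensity α c x) (Set.Ioi 0) ∧
        ∫ x in Set.Ioi (0 : ℝ), (Real.exp (-(t * x)) : ℂ) * levyDensity α c x =
          (Real.exp (-t ^ α) : ℂ)) ∧
    -- `l` is not a positive integer
    ((¬ ∃ k : ℕ, 0 < k ∧ l = k) → l₁ ≠ l₂ →
      (∀ d : ℝ,
        IsFoxHContour q 0
            (((1 : ℂ), l) :: pairRow 1 (p - 1) (fun i => (i : ℝ) / p) l)
            (((1 : ℂ), (1 : ℝ)) :: pairRow 1 (q - 1) (fun j => (j : ℝ) / q) 1) d →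
          Complex.VerticalIntegrable (foxHKernel q 0
            (((1 : ℂ), l) :: pairRow 1 (p - 1) (fun i => (i : ℝ) / p) l)
            (((1 : ℂ), (1 : ℝ)) :: pairRow 1 (q - 1) (fun j => (j : ℝ) / q) 1)) d ∧
          ∀ x : ℝ, 0 < x →
            levyDensity α c x =
              ((l * √((p : ℝ) * q) / (x * (2 * Real.pi) ^ (((q : ℝ) - p) / 2)) : ℝ) : ℂ) *
                foxH q 0
                  (((1 : ℂ), l) :: pairRow 1 (p - 1) (fun i => (i : ℝ) / p) l)
                  (((1 : ℂ), (1 : ℝ)) :: pairRow 1 (q - 1) (fun j => (j : ℝ) / q) 1) d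
                  ((p : ℝ) ^ (p * l) / (x ^ (p * l) * (q : ℝ) ^ q))) ∧
      ∀ x : ℝ, 0 < x →
        Summable (wrightTerm
          (pairRow 1 (q - 1) (fun i => -(((q : ℝ) - i) / q)) (-1))
          ((((1 - l : ℝ) : ℂ), -l) ::
            pairRow 1 (p - 1) (fun i => ((i : ℝ) * q - p * l * q) / (p * q)) (-l))
          ((-((p : ℝ) ^ (p * l) / (x ^ (p * l) * (q : ℝ) ^ q)) : ℝ) : ℂ)) ∧
        (∀ j ∈ Finset.Icc 1 (q - 1), Summable (wrightTerm
          ((((1 - levyJump j q q : ℝ) : ℂ), (-1 : ℝ)) ::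
            pairRow 2 (q - 1) (fun i => (i : ℝ) / q - levyJump j q i) (-1))
          ((((((p : ℝ) * q - j * p * l) / (p * q) : ℝ) : ℂ), -l) ::
            pairRow 1 (p - 1) (fun i => ((i : ℝ) * q - j * p * l) / (p * q)) (-l))
          ((-((p : ℝ) ^ (p * l) / (x ^ (p * l) * (q : ℝ) ^ q)) : ℝ) : ℂ))) ∧
        levyDensity α c x =
          ((l * √((p : ℝ) * q) / (x * (2 * Real.pi) ^ (((q : ℝ) - p) / 2)) : ℝ) : ℂ) *
              (((p : ℝ) ^ (l * p) / (x ^ (l * p) * (q : ℝ) ^ q) : ℝ) : ℂ) *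
              wrightPsi
                (pairRow 1 (q - 1) (fun i => -(((q : ℝ) - i) / q)) (-1))
                ((((1 - l : ℝ) : ℂ), -l) ::
                  pairRow 1 (p - 1) (fun i => ((i : ℝ) * q - p * l * q) / (p * q)) (-l))
                ((-((p : ℝ) ^ (p * l) / (x ^ (p * l) * (q : ℝ) ^ q)) : ℝ) : ℂ) +
            ((l * √((p : ℝ) * q) / (x * (2 * Real.pi) ^ (((q : ℝ) - p) / 2)) : ℝ) : ℂ) *
              ∑ j ∈ Finset.Icc 1 (q - 1),
                (((p : ℝ) ^ (j * l * (p / q)) / (x ^ (j * l * (p / q)) * (q : ℝ) ^ j) : ℝ) : ℂ) *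
                  wrightPsi
                    ((((1 - levyJump j q q : ℝ) : ℂ), (-1 : ℝ)) ::
                      pairRow 2 (q - 1) (fun i => (i : ℝ) / q - levyJump j q i) (-1))
                    ((((((p : ℝ) * q - j * p * l) / (p * q) : ℝ) : ℂ), -l) ::
                      pairRow 1 (p - 1) (fun i => ((i : ℝ) * q - j * p * l) / (p * q)) (-l))
                    ((-((p : ℝ) ^ (p * l) / (x ^ (p * l) * (q : ℝ) ^ q)) : ℝ) : ℂ)) ∧
    -- `l = 1`
    (l = 1 → l₁ = l₂ →
      (∀ d : ℝ,
        IsFoxHContour (q - 1) 0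
            (pairRow 1 (p - 1) (fun i => (i : ℝ) / p) 1)
            (pairRow 1 (q - 1) (fun j => (j : ℝ) / q) 1) d →
          Complex.VerticalIntegrable (foxHKernel (q - 1) 0
            (pairRow 1 (p - 1) (fun i => (i : ℝ) / p) 1)
            (pairRow 1 (q - 1) (fun j => (j : ℝ) / q) 1)) d ∧
          ∀ x : ℝ, 0 < x →
            levyDensity α c x =
              ((√((p : ℝ) * q) / (x * (2 * Real.pi) ^ (((q : ℝ) - p) / 2)) : ℝ) : ℂ) *
                foxH (q - 1) 0
                  (pairRow 1 (p - 1) (fun i => (i : ℝ) / p) 1)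
                  (pairRow 1 (q - 1) (fun j => (j : ℝ) / q) 1) d
                  ((p : ℝ) ^ p / (x ^ p * (q : ℝ) ^ q))) ∧
      ∀ x : ℝ, 0 < x →
        (∀ j ∈ Finset.Icc 1 (q - 1), Summable (hypergeomTerm
          (row 1 (p - 1) (fun i => 1 - ((i : ℝ) * q - j * p) / (p * q)))
          (row 2 (q - 1) (fun i => 1 - (i : ℝ) / q + levyJump j q i))
          (((-1) ^ (q - p) * ((p : ℝ) ^ p / (x ^ p * (q : ℝ) ^ q)) : ℝ) : ℂ))) ∧
        levyDensity α c x =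
          ((√((p : ℝ) * q) / (x * (2 * Real.pi) ^ (((q : ℝ) - p) / 2)) : ℝ) : ℂ) *
            ∑ j ∈ Finset.Icc 1 (q - 1),
              (((p : ℝ) ^ (j * ((p : ℝ) / q)) / (x ^ (j * ((p : ℝ) / q)) * (q : ℝ) ^ j) : ℝ) : ℂ) *
                ((∏ i ∈ Finset.Icc 2 (q - 1),
                    Complex.Gamma (((i : ℝ) / q - levyJump j q i : ℝ) : ℂ)) /
                  ∏ i ∈ Finset.Icc 1 (p - 1),
                    Complex.Gamma ((((i : ℝ) * q - j * p) / (p * q) : ℝ) : ℂ)) *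
                hypergeomF
                  (row 1 (p - 1) (fun i => 1 - ((i : ℝ) * q - j * p) / (p * q)))
                  (row 2 (q - 1) (fun i => 1 - (i : ℝ) / q + levyJump j q i))
                  (((-1) ^ (q - p) * ((p : ℝ) ^ p / (x ^ p * (q : ℝ) ^ q)) : ℝ) : ℂ)) ∧
    -- `l = k` is an integer with `2 ≤ k`
    (∀ k : ℕ, 2 ≤ k → l = k → l₁ ≠ l₂ →
      (∀ d : ℝ,
        IsFoxHContour (q - 1) 0
            (pairRow 1 (k - 1) (fun i => (i : ℝ) / l) 1 ++
              pairRow 1 (p - 1) (fun i => (i : ℝ) / p) l)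
            (pairRow 1 (q - 1) (fun j => (j : ℝ) / q) 1) d →
          Complex.VerticalIntegrable (foxHKernel (q - 1) 0
            (pairRow 1 (k - 1) (fun i => (i : ℝ) / l) 1 ++
              pairRow 1 (p - 1) (fun i => (i : ℝ) / p) l)
            (pairRow 1 (q - 1) (fun j => (j : ℝ) / q) 1)) d ∧
          ∀ x : ℝ, 0 < x →
            levyDensity α c x =
              ((√((p : ℝ) * q * l) / (x * (2 * Real.pi) ^ (((q : ℝ) + 1 - p - l) / 2)) : ℝ) : ℂ) *
                foxH (q - 1) 0
                  (pairRow 1 (k - 1) (fun i => (i : ℝ) / l) 1 ++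
                    pairRow 1 (p - 1) (fun i => (i : ℝ) / p) l)
                  (pairRow 1 (q - 1) (fun j => (j : ℝ) / q) 1) d
                  ((p : ℝ) ^ (p * l) * l ^ l / (x ^ (p * l) * (q : ℝ) ^ q))) ∧
      ∀ x : ℝ, 0 < x →
        (∀ j ∈ Finset.Icc 1 (q - 1), Summable (wrightTerm
          (pairRow 2 (q - 1) (fun i => (i : ℝ) / q - levyJump j q i) (-1))
          (pairRow 1 (k - 1) (fun i => ((i : ℝ) * q - j * l) / (l * q)) (-1) ++
            pairRow 1 (p - 1) (fun i => ((i : ℝ) * q - j * p * l) / (p * q)) (-l))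
          ((-((p : ℝ) ^ (p * l) * l ^ l / (x ^ (p * l) * (q : ℝ) ^ q)) : ℝ) : ℂ))) ∧
        levyDensity α c x =
          ((√((p : ℝ) * q * l) / (x * (2 * Real.pi) ^ (((q : ℝ) + 1 - l - p) / 2)) : ℝ) : ℂ) *
            ∑ j ∈ Finset.Icc 1 (q - 1),
              (((p : ℝ) ^ (j * l * (p / q)) * l ^ (j * (l / q)) /
                  (x ^ (j * l * (p / q)) * (q : ℝ) ^ j) : ℝ) : ℂ) *
                wrightPsi
                  (pairRow 2 (q - 1) (fun i => (i : ℝ) / q - levyJump j q i) (-1))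
                  (pairRow 1 (k - 1) (fun i => ((i : ℝ) * q - j * l) / (l * q)) (-1) ++
                    pairRow 1 (p - 1) (fun i => ((i : ℝ) * q - j * p * l) / (p * q)) (-l))
                  ((-((p : ℝ) ^ (p * l) * l ^ l / (x ^ (p * l) * (q : ℝ) ^ q)) : ℝ) : ℂ)) := by
  have hp' : (0 : ℝ) < p := by exact_mod_cast hp
  have hq' : (0 : ℝ) < q := by exact_mod_cast hp.trans hpq
  have hr : (0 : ℝ) < p / q := by positivity
  have hr1 : (p : ℝ) / q < 1 := by
    rw [div_lt_one hq']
    exact_mod_cast hpq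
  have he : (0 : ℝ) < (l₂ : ℝ) / l₁ := by positivity
  have hα0 : 0 < α := hc.trans hcα
  have hα1 : α < 1 := hα ▸ Real.rpow_lt_one hr.le hr1 he
  have hc1 : c < 1 := hcα.trans hα1
  -- This relation is what makes the scaling u = qs turn Γ(1+αu) into Γ(1+p·ls).
  have h : α * q = p * l := by
    rw [hl, Real.rpow_sub_one hr.ne', ← hα]
    field_simp
  refine ⟨⟨verticalIntegrable_levyKernel hα0 hα1 hc1,
    fun t ht => levyDensity_laplace hα0 hα1 hc1 ht⟩, fun _ _ => ?_, fun h1 _ => ?_,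
    fun k hk hlk _ => ?_⟩
  · exact ⟨fun d hd => levyDensity_foxH hp hpq hα0 hα1 hc1 h hd,
      fun x hx => levyDensity_eq_wrightPsi hp hpq hα0 hα1 hc1 h hx⟩
  · rw [h1, mul_one] at h
    exact ⟨fun d hd => levyDensity_foxH_one hp hpq hα0 hα1 hc1 h hd,
      fun x hx => levyDensity_eq_hypergeomF hp hpq hα0 hα1 hc1 h hx⟩
  · have hk' : 0 < k := by omega
    exact ⟨fun d hd => levyDensity_foxH_nat hp hpq hk' hα0 hα1 hc1 h hlk hd,
      fun x hx => levyDensity_eq_wrightPsi_nat hp hpq hk' hα0 hα1 hc1 h hlk hx⟩
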